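/- **Notation.** An $(n,p)$-parenthesis diagram is an involution $\sigma$ of $\{1,\dots,n\}$ with exactly $2p$ non-fixed points such that there are no $i<j<k$ with $\sigma(i)=k$, $\sigma(j)=j$, and no $i<j<k<l$ with $\sigma(i)=k$, $\sigma(j)=l$. Fixed points are called isolated dots, and $(i,j)$ with $i<j=\sigma(i)$ is called a pair. It is decorated by a set $\mathbb D$ of pairs such that every $(i,j)\in\mathbb D$ has no isolated dot to its left (if $\sigma(k)=k$ then $k>j$) and is not nested inside another pair (no pair $(k,l)$ has $k<i<j<l$). Let $M(n,p)$ be the set of decorated $(n,p)$-parenthesis diagrams. The type $D$ Temperley–Lieb algebra $\mathrm{TLD}_n(\delta)$ over a commutative ring $R$, $\delta\in R$, is the diagram algebra spanned by the decorated Temperley–Lieb $n$-diagrams: planar perfect matchings of a top and a bottom row of $n$ dots, either with an even number of decorated arcs, all of them exposed to the left boundary, or (for matchings other than the identity) with no decorated arc but with an additional decorated circuit. The product is concatenation, where an undecorated circuit is replaced by the factor $\delta$, two decorations on the same curve cancel, and in the presence of a decorated circuit every other decoration is removed. For $2p<n$ and $S,T\in M(n,p)$, let $C_{S,T}$ be the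 diagram with the cups of $S$ on the top, the caps of $T$ on the bottom, the isolated dots of $S$ joined to those of $T$ from left to right, and a decoration added to the leftmost vertical arc if $S$ and $T$ together have an odd number of decorations. The cell module $S(n,p)$ has basis $M(n,p)$, and its Gram matrix is $G(n,p)=(\Phi(T,U))_{T,U\in M(n,p)}$, where $\Phi(T,U)$ is the coefficient of $C_{S,V}$ in $C_{S,T}C_{U,V}$ (it is independent of $S,V$). For $n=2p$, $G(2p,p)$ denotes the matrix $(\Phi(\iota T,\iota U))_{T,U\in M(2p,p)}$, where $\iota:M(2p,p)\to M(2p+1,p)$ adds an isolated dot on the right and $\Phi$ is the form of $S(2p+1,p)$. The Chebyshev polynomials of type $D$ are $Q_1=1$, $Q_2=x^2$, $Q_3=x^3-2x$, $Q_{k+1}=xQ_k-Q_{k-1}$ for $k\ge 3$. **Proposition 6.16.** Let $n\ge 2p\ge 0$ be integers. Then $$\det G(n,p)=\prod_{r=0}^{p-1}\left(\frac{Q_{n-p-r+1}}{Q_{p-r}}\right)^{\binom{n}{r}}\ \prod_{s=1}^{p-1}\left[\prod_{r=0}^{p-s-1}\left(\frac{Q_{p-s-r+2}}{Q_{p-s-r}}\right)^{\binom{2(p-s)+1}{r}}\right]^{\binom{n-2(p-s+1)}{s-1}}.$$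 That is: the right-hand side, read in the field of fractions of $\mathbb Z[x]$, is a polynomial $F\in\mathbb Z[x]$, and for every commutative ring $R$ and $\delta\in R$ the determinant of $G(n,p)$ over $R$ is $F(\delta)$. In particular, over a field, the formula holds with $Q_k$ replaced by $Q_k(\delta)$ whenever $Q_k(\delta)\neq 0$ for $1\le k\le p$. -/

import Mathlib

namespace TLD

open Polynomial

/-- A decorated `(n, p)`-parenthesis diagram: a non-crossing involution `σ` of `n` dots, with exactly
`2p` non-fixed dots and with no fixed (isolated) dot underneath a pair, together with a set `D` of
pairs `(i, j)`, `i < j`, `σ i = j` (the decorations), all of them exposed to the left: a decorated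
pair has no isolated dot to its left and is not nested inside another pair. -/
@[ext]
structure DecParen (n p : ℕ) where
  σ : Fin n → Fin n
  D : Finset (Fin n × Fin n)
  invol : ∀ i, σ (σ i) = i
  isolated_outside : ∀ i j k, i < j → j < k → σ j = j → σ i ≠ k
  noncrossing : ∀ i j k l, i < j → j < k → k < l → ¬ (σ i = k ∧ σ j = l)
  card_paired : (Finset.univ.filter fun i => σ i ≠ i).card = 2 * p
  dec_pair : ∀ q ∈ D, q.1 < q.2 ∧ σ q.1 = q.2
  dec_isolated : ∀ q ∈ D, ∀ k, σ k = k → q.2 < k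
  dec_outer : ∀ q ∈ D, ∀ i, i < q.1 → ¬ q.2 < σ i

instance (n p : ℕ) : Finite (DecParen n p) :=
  Finite.of_injective (fun S : DecParen n p => (S.σ, S.D)) fun S T h => by
    have h' := Prod.mk.inj h
    exact DecParen.ext h'.1 h'.2

noncomputable instance (n p : ℕ) : Fintype (DecParen n p) := Fintype.ofFinite _

noncomputable instance (n p : ℕ) : DecidableEq (DecParen n p) := Classical.decEq _

/-- The number of isolated dots strictly to the left of the dot `i`. -/
def DecParen.rank {n p : ℕ} (S : DecParen n p) (i : Fin n) : ℕ :=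
  (Finset.univ.filter fun k => k < i ∧ S.σ k = k).card

/-- The map `ι` that adds an isolated dot on the right of a decorated parenthesis diagram. -/
def DecParen.addDot {n p : ℕ} (S : DecParen n p) : DecParen (n + 1) p where
  σ := Fin.lastCases (Fin.last n) fun i => (S.σ i).castSucc
  D := S.D.map (Fin.castSuccEmb.prodMap Fin.castSuccEmb)
  invol := by
    intro i
    induction i using Fin.lastCases <;> simp [S.invol]
  isolated_outside := by
    intro i j k hij hjk hj hik
    induction j using Fin.lastCases with
    | last => exact absurd (lt_of_lt_of_le hjk (Fin.le_last k)) (lt_irrefl _)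
    | cast j =>
      induction i using Fin.lastCases with
      | last => exact absurd (lt_of_lt_of_le hij (Fin.le_last _)) (lt_irrefl _)
      | cast i =>
        simp only [Fin.lastCases_castSucc, Fin.castSucc_inj] at hj hik
        subst hik
        exact S.isolated_outside i j _ (by simpa using hij) (by simpa using hjk) hj rfl
  noncrossing := by
    rintro i j k l hij hjk hkl ⟨hik, hjl⟩
    induction j using Fin.lastCases with
    | last => exact absurd (lt_of_lt_of_le hjk (Fin.le_last k)) (lt_irrefl _)
    | cast j =>
      induction i using Fin.lastCases with
      | last => exact absurd (lt_of_lt_of_le hij (Fin.le_last _)) (lt_irrefl _)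
      | cast i =>
        simp only [Fin.lastCases_castSucc] at hik hjl
        subst hik hjl
        exact S.noncrossing i j _ _ (by simpa using hij) (by simpa using hjk) (by simpa using hkl)
          ⟨rfl, rfl⟩
  card_paired := by
    refine Eq.trans ?_ ((Finset.card_map Fin.castSuccEmb).trans S.card_paired)
    congr 1
    refine Finset.ext fun i => ?_
    induction i using Fin.lastCases <;> simp
  dec_pair := by
    intro q hq
    obtain ⟨r, hr, rfl⟩ := Finset.mem_map.1 hq
    simpa using S.dec_pair r hr
  dec_isolated := by
    intro q hq k hk
    obtain ⟨r, hr, rfl⟩ := Finset.mem_map.1 hq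
    induction k using Fin.lastCases with
    | last => exact Fin.castSucc_lt_last _
    | cast k =>
      simp only [Fin.lastCases_castSucc, Fin.castSucc_inj] at hk
      simpa using S.dec_isolated r hr k hk
  dec_outer := by
    intro q hq i hi
    obtain ⟨r, hr, rfl⟩ := Finset.mem_map.1 hq
    induction i using Fin.lastCases with
    | last => exact absurd (lt_of_lt_of_le hi (Fin.le_last _)) (lt_irrefl _)
    | cast i => simpa using S.dec_outer r hr i (by simpa using hi)

/-- The `2n` dots of a diagram: `inl i` is the `i`-th dot of the top row and `inr i` is the `i`-th
dot of the bottom row. -/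
abbrev Dots (n : ℕ) : Type := Fin n ⊕ Fin n

/-- An `n`-diagram: a set of arcs joining the `2n` dots, the set of those arcs that carry a
decoration, and whether the diagram contains in addition a decorated circuit. The decorated
Temperley-Lieb `n`-diagrams are particular diagrams of this kind (perfect planar matchings with an
even number of decorations, all of them exposed to the left, or perfect planar matchings other than
the identity, without decorated arcs, with a decorated circuit). -/
@[ext]
structure Diagram (n : ℕ) where
  arcs : Set (Sym2 (Dots n))
  dec : Set (Sym2 (Dots n))
  loop : Prop

namespace Diagram

variable {n : ℕ}

/-- In the concatenation of `d` (on the top) and `e` (on the bottom) there are three rows of dots,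
numbered `0`, `1`, `2`: the bottom row of `d` is identified with the top row of `e`. -/
def upper : Dots n → Fin 3 × Fin n := Sum.elim (fun i => (0, i)) fun i => (1, i)

/-- The position of the dots of the lower diagram. -/
def lower : Dots n → Fin 3 × Fin n := Sum.elim (fun i => (1, i)) fun i => (2, i)

/-- The position of the dots of the product, the outer rows. -/
def outer : Dots n → Fin 3 × Fin n := Sum.elim (fun i => (0, i)) fun i => (2, i)

/-- The concatenation of `d` and `e`, as a graph on the three rows of dots. -/
def stack (d e : Diagram n) : SimpleGraph (Fin 3 × Fin n) :=
  SimpleGraph.fromEdgeSet (Sym2.map upper '' d.arcs ∪ Sym2.map lower '' e.arcs)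

/-- The curve of the concatenation on which a given dot lies. -/
def curve (d e : Diagram n) (v : Fin 3 × Fin n) : (stack d e).ConnectedComponent :=
  (stack d e).connectedComponentMk v

/-- The number of decorations on a curve of the concatenation. -/
noncomputable def decorations (d e : Diagram n) (c : (stack d e).ConnectedComponent) : ℕ :=
  {a ∈ d.dec | ∀ v ∈ a, curve d e (upper v) = c}.ncard +
    {a ∈ e.dec | ∀ v ∈ a, curve d e (lower v) = c}.ncard

/-- The circuits of the concatenation: the curves that do not meet the outer rows. -/
def circuits (d e : Diagram n) : Set (stack d e).ConnectedComponent :=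
  {c | ∀ x, curve d e (outer x) ≠ c}

/-- The diagram of the product. Two decorations on the same curve cancel; a circuit with an odd
number of decorations is a decorated circuit; in the presence of a decorated circuit all
other decorations are removed. -/
def comp (d e : Diagram n) : Diagram n where
  arcs := {a | ∃ x y, x ≠ y ∧ curve d e (outer x) = curve d e (outer y) ∧ a = s(x, y)}
  dec := {a | (¬ d.loop ∧ ¬ e.loop ∧ ∀ c ∈ circuits d e, ¬ Odd (decorations d e c)) ∧
    ∃ x y, x ≠ y ∧ curve d e (outer x) = curve d e (outer y) ∧ a = s(x, y) ∧
      Odd (decorations d e (curve d e (outer x)))}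
  loop := d.loop ∨ e.loop ∨ ∃ c ∈ circuits d e, Odd (decorations d e c)

open Classical in
/-- The number of circuits that are removed from the concatenation, each at the price of a factor
`δ`: all the circuits, except for one decorated circuit if there is any. -/
noncomputable def removed (d e : Diagram n) : ℕ :=
  (circuits d e).ncard + (if d.loop then 1 else 0) + (if e.loop then 1 else 0) -
    (if (comp d e).loop then 1 else 0)

end Diagram

/-- The bilinear multiplication of diagrams with parameter `δ`: the product of two diagrams is their
concatenation, reduced by the removing rules. The algebra `TLD_n(δ)` is the span of the
decorated Temperley-Lieb `n`-diagrams under this multiplication. -/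
noncomputable def mul {R : Type*} [CommRing R] (δ : R) (n : ℕ) :
    (Diagram n →₀ R) →ₗ[R] (Diagram n →₀ R) →ₗ[R] (Diagram n →₀ R) :=
  Finsupp.lsum R fun d => LinearMap.toSpanSingleton R _ <|
    Finsupp.lsum R fun e => LinearMap.toSpanSingleton R _ <|
      Finsupp.single (d.comp e) (δ ^ d.removed e)

/-- The diagram `C_{S,T}`: the cup diagram of `S` on the top, the cap diagram of `T` on the bottom,
the isolated dots of `S` joined with those of `T` from left to right; a decoration is added to
the leftmost vertical arc if the total number of decorations of `S` and `T` is odd. -/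
def cellDiagram {n p : ℕ} (S T : DecParen n p) : Diagram n where
  arcs := {a | (∃ i, S.σ i ≠ i ∧ a = s(Sum.inl i, Sum.inl (S.σ i))) ∨
    (∃ j, T.σ j ≠ j ∧ a = s(Sum.inr j, Sum.inr (T.σ j))) ∨
    (∃ i j, S.σ i = i ∧ T.σ j = j ∧ S.rank i = T.rank j ∧ a = s(Sum.inl i, Sum.inr j))}
  dec := {a | (∃ q ∈ S.D, a = s(Sum.inl q.1, Sum.inl q.2)) ∨
    (∃ q ∈ T.D, a = s(Sum.inr q.1, Sum.inr q.2)) ∨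
    (Odd (S.D.card + T.D.card) ∧
      ∃ i j, S.σ i = i ∧ T.σ j = j ∧ S.rank i = 0 ∧ T.rank j = 0 ∧ a = s(Sum.inl i, Sum.inr j))}
  loop := False

/-- The cellular basis element `C_{S,T}` of `TLD_n(δ)`. -/
noncomputable def cellBasis (R : Type*) [CommRing R] {n p : ℕ} (S T : DecParen n p) :
    Diagram n →₀ R :=
  Finsupp.single (cellDiagram S T) 1

/-- The bilinear form `Φ(T, U)` of the cell module `S(n, p)`, `2p < n`, on the basis elements. It is
given by `C_{S,T} C_{U,V} ≡ Φ(T, U) C_{S,V}` modulo the basis elements of the lower cells, that is,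
`Φ(T, U)` is the coefficient of `C_{S,V}` in `C_{S,T} C_{U,V}`. As it does not depend on `S`
and `V`, these are taken to be `T` and `U`. -/
noncomputable def cellForm {R : Type*} [CommRing R] (δ : R) {n p : ℕ} (T U : DecParen n p) : R :=
  mul δ n (cellBasis R T T) (cellBasis R U U) (cellDiagram T U)

/-- The matrix `G(n, p)`. For `2p < n` it is the Gram matrix of the cell module `S(n, p)`; for
`n = 2p` it is the matrix of the form of `S(n + 1, p)` on the diagrams in which the last dot is
isolated. -/
noncomputable def gram {R : Type*} [CommRing R] (δ : R) (n p : ℕ) :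
    Matrix (DecParen n p) (DecParen n p) R :=
  Matrix.of fun S T => if 2 * p < n then cellForm δ S T else cellForm δ S.addDot T.addDot

/-- The Chebyshev polynomials of type D: `Q_1 = 1`, `Q_2 = x²`, `Q_3 = x³ - 2x` and
`Q_{k+1} = x Q_k - Q_{k-1}` for `k ≥ 3`. The value at `0` plays no role. -/
noncomputable def Q : ℕ → ℤ[X]
  | 0 => 0
  | 1 => 1
  | 2 => X ^ 2
  | 3 => X ^ 3 - 2 * X
  | k + 4 => X * Q (k + 3) - Q (k + 2)

/-- The closed product formula, as a function of the values `q k` of the polynomials `Q_k`. -/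
def gramProduct {K : Type*} [Field K] (q : ℕ → K) (n p : ℕ) : K :=
  (∏ r ∈ Finset.range p, (q (n - p - r + 1) / q (p - r)) ^ n.choose r) *
    ∏ s ∈ Finset.Icc 1 (p - 1),
      (∏ r ∈ Finset.range (p - s),
        (q (p - s - r + 2) / q (p - s - r)) ^ (2 * (p - s) + 1).choose r) ^
          (n - 2 * (p - s + 1)).choose (s - 1)

end TLD

/-! The form is first made combinatorial. Superpose `S` and `T` on one row of dots and draw the
edges `i — S.σ i` and `i — T.σ i`; the components are loops and strands. By `cellForm_eq_phi`,
Φ(S,T) is δ to the number of loops if no strand joins two isolated dots of `T` and every loop has an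
even number of decorations, and 0 otherwise. Decorations on strands through from `S` to `T` impose
no condition: planarity puts them on the leftmost such strand, where their parity is that of the
total, as prescribed for C_{S,T}. The planarity of the union of the two diagrams is used through a
discrete Jordan curve argument, `below_linked`.

The determinant is then computed by induction on the number of dots. Write n+1 = 2(p+1)+k. If k > 0,
a diagram with p+1 pairs on n+1 dots either ends with an isolated dot or comes from some T in M(n,p)
by joining its last isolated dot to a new last dot (`splitEquiv`). Number 0,…,k+1 the isolated dots
of T together with the new one. Let T_i be the undecorated join of the dots i, i+1, and T_0' the
decorated join of 0, 1. For a diagram W with p+1 pairs, either all these joins pair to 0 with W, or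
exactly one strand returns to T, and it links consecutive dots j, j+1. In the latter case T_i pairs
with W, up to a common power of δ, to δ if i = j, to 1 if |i-j| = 1, and to 0 otherwise, except that
for j = 0 only one of T_0, T_0' gives δ, depending on a parity, and the other gives 0. These are the
rows of a matrix shaped like the Dynkin diagram of type D, with T_0, T_0' as the fork. The weights
w_0 = x (on both T_0 and T_0') and w_i = (-1)^i Q_{i+1} solve every equation but the last. Hence the
weighted sum is orthogonal to all diagrams ending with an isolated dot, and pairs with the closure
of U to -w_{k+1} Φ(T,U). Row elimination gives, with N = |M(n,p)|, Q_{k+1}^N det G(n+1,p+1) =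
Q_{k+2}^N det G(n,p+1) det G(n,p) (`det_gram_split`). If k = 0, sorting by the parity of the
decorations splits the matrix into two copies of δ G(n,p) (`det_gram_close`).

The closed product obeys the same recursions by Pascal's rule. All this takes place over ℤ[x], where
no Q_k with k ≥ 1 vanishes; other rings follow by evaluation. -/

namespace TLD

/-! ### Components of the graph of two involutions -/

section Linked

variable {α : Type*} {σ τ : α → α} {i j k : α}

/-- Two points are linked if they lie on the same component of the graph whose edges join `i` to
`σ i` and to `τ i`. -/
def Linked (σ τ : α → α) : α → α → Prop :=
  Relation.EqvGen fun i j => σ i = j ∨ τ i = j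

namespace Linked

@[refl] lemma refl (i : α) : Linked σ τ i i := Relation.EqvGen.refl i

@[symm] lemma symm (h : Linked σ τ i j) : Linked σ τ j i := Relation.EqvGen.symm _ _ h

lemma trans (h : Linked σ τ i j) (h' : Linked σ τ j k) : Linked σ τ i k :=
  Relation.EqvGen.trans _ _ _ h h'

lemma left (i : α) : Linked σ τ i (σ i) := Relation.EqvGen.rel _ _ (Or.inl rfl)

lemma right (i : α) : Linked σ τ i (τ i) := Relation.EqvGen.rel _ _ (Or.inr rfl)

lemma map_eq {β : Type*} {f : α → β} (hσ : ∀ i, f (σ i) = f i) (hτ : ∀ i, f (τ i) = f i)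
    (h : Linked σ τ i j) : f i = f j := by
  induction h with
  | rel x y h => rcases h with rfl | rfl <;> simp [hσ, hτ]
  | refl x => rfl
  | symm x y _ ih => exact ih.symm
  | trans x y z _ _ h1 h2 => exact h1.trans h2

lemma lift {r : α → α → Prop} (hr : Equivalence r) (hσ : ∀ i, r i (σ i)) (hτ : ∀ i, r i (τ i))
    (h : Linked σ τ i j) : r i j := by
  induction h with
  | rel x y h => rcases h with rfl | rfl <;> simp [hσ, hτ]
  | refl x => exact hr.refl x
  | symm x y _ ih => exact hr.symm ih
  | trans x y z _ _ h1 h2 => exact hr.trans h1 h2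

lemma equivalence (σ τ : α → α) : Equivalence (Linked σ τ) := ⟨refl, symm, trans⟩

lemma comm : Linked σ τ i j ↔ Linked τ σ i j :=
  ⟨lift (equivalence τ σ) right left, lift (equivalence σ τ) right left⟩

/-- Joining two fixed points `a`, `b` of `σ` merges their components. -/
lemma merge_iff {σ' : α → α} {a b : α} (ha : σ a = a) (hb : σ b = b) (ha' : σ' a = b)
    (hb' : σ' b = a) (h' : ∀ i, i ≠ a → i ≠ b → σ' i = σ i) :
    Linked σ' τ i j ↔ Linked σ τ i j ∨ (Linked σ τ i a ∧ Linked σ τ b j) ∨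
      (Linked σ τ i b ∧ Linked σ τ a j) := by
  have hab : Linked σ' τ a b := by simpa [ha'] using left (σ := σ') (τ := τ) a
  have hsub : ∀ {i j}, Linked σ τ i j → Linked σ' τ i j := fun h => by
    refine lift (equivalence σ' τ) (fun i => ?_) right h
    by_cases hia : i = a
    · rw [hia, ha]
    by_cases hib : i = b
    · rw [hib, hb]
    rw [← h' i hia hib]
    exact left i
  constructor
  · intro h
    refine lift (r := fun i j => Linked σ τ i j ∨ (Linked σ τ i a ∧ Linked σ τ b j) ∨
      (Linked σ τ i b ∧ Linked σ τ a j)) ⟨fun i => Or.inl (refl i), ?_, ?_⟩ ?_ ?_ h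
    · rintro x y (h | ⟨h, h'⟩ | ⟨h, h'⟩)
      · exact Or.inl h.symm
      · exact Or.inr (Or.inr ⟨h'.symm, h.symm⟩)
      · exact Or.inr (Or.inl ⟨h'.symm, h.symm⟩)
    · rintro x y z (h | ⟨h, h'⟩ | ⟨h, h'⟩) (k | ⟨k, k'⟩ | ⟨k, k'⟩)
      · exact Or.inl (h.trans k)
      · exact Or.inr (Or.inl ⟨h.trans k, k'⟩)
      · exact Or.inr (Or.inr ⟨h.trans k, k'⟩)
      · exact Or.inr (Or.inl ⟨h, h'.trans k⟩)
      · exact Or.inr (Or.inl ⟨h, k'⟩)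
      · exact Or.inl (h.trans k')
      · exact Or.inr (Or.inr ⟨h, h'.trans k⟩)
      · exact Or.inl (h.trans k')
      · exact Or.inr (Or.inr ⟨h, k'⟩)
    · intro i
      by_cases hia : i = a
      · subst hia
        exact Or.inr (Or.inl ⟨refl _, by rw [ha']⟩)
      by_cases hib : i = b
      · subst hib
        exact Or.inr (Or.inr ⟨refl _, by rw [hb']⟩)
      rw [h' i hia hib]
      exact Or.inl (left i)
    · exact fun i => Or.inl (right i)
  · rintro (h | ⟨h, h'⟩ | ⟨h, h'⟩)
    · exact hsub h
    · exact (hsub h).trans (hab.trans (hsub h'))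
    · exact (hsub h).trans (hab.symm.trans (hsub h'))

/-- A component with two distinct fixed points of `σ` does not contain a fixed point of `τ`. -/
lemma fixed_unique (hσ : Function.Involutive σ) (hτ : Function.Involutive τ) {a a' b : α}
    (ha : σ a = a) (ha' : σ a' = a') (hb : τ b = b) (haa' : Linked σ τ a a')
    (hab : Linked σ τ a b) : a = a' := by
  -- The involutions `s`, `t` generate a dihedral group. As `s` fixes `a`, the component of `a` is
  -- the orbit of `a` under the powers of `s * t`.
  let s : Equiv.Perm α := hσ.toPerm
  let t : Equiv.Perm α := hτ.toPerm
  have hss : s * s = 1 := Equiv.ext fun i => hσ i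
  have htt : t * t = 1 := Equiv.ext fun i => hτ i
  have hsi : s⁻¹ = s := inv_eq_of_mul_eq_one_right hss
  have hti : t⁻¹ = t := inv_eq_of_mul_eq_one_right htt
  have hconj : ∀ k : ℤ, s * (s * t) ^ k = (s * t) ^ (-k) * s := by
    intro k
    have h1 : s * (s * t) * s⁻¹ = (s * t)⁻¹ := by
      rw [mul_inv_rev, hsi, hti, ← mul_assoc, hss, one_mul]
    have h2 : s * (s * t) ^ k * s⁻¹ = (s * t) ^ (-k) := by
      rw [← conj_zpow, h1, inv_zpow']
    rw [← h2, inv_mul_cancel_right]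
  have hs : ∀ k : ℤ, σ (((s * t) ^ k) a) = ((s * t) ^ (-k)) a := by
    intro k
    have := congrArg (fun f : Equiv.Perm α => f a) (hconj k)
    simp only [Equiv.Perm.mul_apply] at this
    refine this.trans ?_
    congr 1
  have ht : ∀ k : ℤ, τ (((s * t) ^ k) a) = ((s * t) ^ (-k - 1)) a := by
    intro k
    have h1 : t * (s * t) ^ k = s * (s * t) ^ (k + 1) := by
      rw [add_comm, zpow_add, zpow_one, ← mul_assoc, ← mul_assoc, hss, one_mul]
    have := congrArg (fun f : Equiv.Perm α => f a) h1
    simp only [Equiv.Perm.mul_apply] at this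
    refine this.trans ((hs (k + 1)).trans ?_)
    congr 2
    ring
  have horb : ∀ {j}, Linked σ τ a j → ∃ k : ℤ, ((s * t) ^ k) a = j := by
    intro j h
    have key : (∃ k : ℤ, ((s * t) ^ k) a = a) = (∃ k : ℤ, ((s * t) ^ k) a = j) := by
      refine map_eq (f := fun j => ∃ k : ℤ, ((s * t) ^ k) a = j) (fun i => propext ⟨?_, ?_⟩)
        (fun i => propext ⟨?_, ?_⟩) h
      · rintro ⟨k, hk⟩
        exact ⟨-k, by rw [← hs, hk, hσ]⟩
      · rintro ⟨k, hk⟩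
        exact ⟨-k, by rw [← hs, hk]⟩
      · rintro ⟨k, hk⟩
        exact ⟨-k - 1, by rw [← ht, hk, hτ]⟩
      · rintro ⟨k, hk⟩
        exact ⟨-k - 1, by rw [← ht, hk]⟩
    exact key ▸ ⟨0, rfl⟩
  obtain ⟨k, rfl⟩ := horb haa'
  obtain ⟨l, rfl⟩ := horb hab
  rw [hs] at ha'
  rw [ht] at hb
  -- With `a' = (s * t) ^ k a` fixed by `s` and `b = (s * t) ^ l a` fixed by `t`, the exponents `2 *
  -- k` and `2 * l + 1` stabilize `a`, hence so does `k = (2 * l + 1) * k - 2 * k * l`.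
  have h1 : ((s * t) ^ (2 * k)) a = a := by
    have := congrArg ((s * t) ^ k) ha'
    rw [← Equiv.Perm.mul_apply, ← Equiv.Perm.mul_apply, ← zpow_add, ← zpow_add] at this
    rw [two_mul, ← this]
    simp
  have h2 : ((s * t) ^ (2 * l + 1)) a = a := by
    have := congrArg ((s * t) ^ (l + 1)) hb
    rw [← Equiv.Perm.mul_apply, ← Equiv.Perm.mul_apply, ← zpow_add, ← zpow_add] at this
    rw [show 2 * l + 1 = l + 1 + l by ring, ← this]
    simp
  have h3 : ((s * t) ^ ((2 * l + 1) * k)) a = a := by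
    rw [zpow_mul]
    exact Equiv.Perm.zpow_apply_eq_self_of_apply_eq_self h2 k
  have h4 : ((s * t) ^ (2 * k * l)) a = a := by
    rw [zpow_mul]
    exact Equiv.Perm.zpow_apply_eq_self_of_apply_eq_self h1 l
  have h5 : (2 * l + 1) * k = k + 2 * k * l := by ring
  rw [h5, zpow_add, Equiv.Perm.mul_apply, h4] at h3
  exact h3.symm

end Linked

/-- A sum modulo `2` over a set closed under an involution is the sum over the fixed points. -/
lemma sum_eq_sum_fixed {β : Type*} [DecidableEq β] {ρ : β → β} (hρ : Function.Involutive ρ)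
    (C : Finset β) (hC : ∀ x ∈ C, ρ x ∈ C) (h : β → ZMod 2) (hh : ∀ x ∈ C, h (ρ x) = h x) :
    ∑ x ∈ C, h x = ∑ x ∈ C with ρ x = x, h x := by
  rw [← Finset.sum_filter_add_sum_filter_not C (fun x => ρ x = x), add_eq_left]
  refine Finset.sum_involution (fun x _ => ρ x) ?_ ?_ ?_ ?_
  · intro x hx
    rw [hh x (Finset.mem_filter.1 hx).1]
    exact CharTwo.add_self_eq_zero _
  · intro x hx _
    exact (Finset.mem_filter.1 hx).2
  · intro x hx
    obtain ⟨h1, h2⟩ := Finset.mem_filter.1 hx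
    exact Finset.mem_filter.2 ⟨hC x h1, fun h => h2 ((hρ x).symm.trans h).symm⟩
  · intro x _
    exact hρ x

end Linked

end TLD

/-! ### Stability of intervals under a parenthesis diagram -/

namespace TLD

namespace DecParen

variable {n p q : ℕ}

lemma involutive (S : DecParen n p) : Function.Involutive S.σ := S.invol

/-- The isolated dots. -/
def ends (S : DecParen n p) : Finset (Fin n) := Finset.univ.filter fun i => S.σ i = i

@[simp] lemma mem_ends {S : DecParen n p} {i : Fin n} : i ∈ S.ends ↔ S.σ i = i := by
  simp [ends]

lemma card_ends_add (S : DecParen n p) : S.ends.card + 2 * p = n := by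
  have := Finset.card_filter_add_card_filter_not (s := (Finset.univ : Finset (Fin n)))
    (fun i => S.σ i = i)
  rw [S.card_paired] at this
  simpa [ends] using this

/-- A pair cannot straddle an isolated dot. -/
lemma lt_map_iff (S : DecParen n p) {x y : Fin n} (hy : S.σ y = y) : S.σ x < y ↔ x < y := by
  have key : ∀ x, x < y → S.σ x < y := by
    intro x hx
    rcases lt_trichotomy (S.σ x) y with h | h | h
    · exact h
    · rw [← h, S.invol] at hy
      rw [hy] at hx
      exact absurd (hx.trans_eq h.symm) (lt_irrefl _)
    · exact absurd rfl (S.isolated_outside x y _ hx h hy)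
  exact ⟨fun h => by simpa [S.invol] using key _ h, key x⟩

lemma between_map (S : DecParen n p) {x y : Fin n} (h1 : y < x) (h2 : x < S.σ y) :
    y < S.σ x ∧ S.σ x < S.σ y := by
  constructor
  · rcases lt_trichotomy y (S.σ x) with h | h | h
    · exact h
    · rw [h, S.invol] at h2
      exact absurd h2 (lt_irrefl _)
    · exact absurd ⟨S.invol x, rfl⟩ (S.noncrossing _ _ _ _ h h1 h2)
  · rcases lt_trichotomy (S.σ x) (S.σ y) with h | h | h
    · exact h
    · rw [S.involutive.injective h] at h1
      exact absurd h1 (lt_irrefl _)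
    · exact absurd ⟨rfl, rfl⟩ (S.noncrossing _ _ _ _ h1 h2 h)

/-- A decorated pair is outermost, so no pair covers or crosses it: the dots to its left are paired
among themselves or isolated. -/
lemma lt_dec_iff (S : DecParen n p) {d : Fin n × Fin n} (hd : d ∈ S.D) (x : Fin n) :
    S.σ x < d.1 ↔ x < d.1 := by
  have key : ∀ x, x < d.1 → S.σ x < d.1 := by
    intro x hx
    obtain ⟨h1, h2⟩ := S.dec_pair d hd
    rcases lt_trichotomy (S.σ x) d.1 with h | h | h
    · exact h
    · rw [← h, S.invol] at h2
      exact absurd (hx.trans h1) (by rw [h2]; exact lt_irrefl _)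
    · rcases lt_trichotomy (S.σ x) d.2 with h' | h' | h'
      · exact absurd ⟨rfl, h2⟩ (S.noncrossing _ _ _ _ hx h h')
      · rw [← h2] at h'
        exact absurd hx (by rw [S.involutive.injective h']; exact lt_irrefl _)
      · exact absurd h' (S.dec_outer d hd x hx)
  exact ⟨fun h => by simpa [S.invol] using key _ h, key x⟩

lemma dec_fst_not_fixed (S : DecParen n p) {d : Fin n × Fin n} (hd : d ∈ S.D) :
    S.σ d.1 ≠ d.1 := by
  obtain ⟨h1, h2⟩ := S.dec_pair d hd
  rw [h2]
  exact h1.ne'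

end DecParen

/-! ### Planarity as a parity argument -/

open DecParen

variable {n p q : ℕ}

/-- The parity of the number of points of `C` to the left of `y`. -/
def below (C : Finset (Fin n)) (y : Fin n) : ZMod 2 := ∑ x ∈ C, if x < y then 1 else 0

/-- Each pair of `C` lies on one side of an isolated dot, so it contributes an even number. -/
lemma below_of_fixed (S : DecParen n p) {C : Finset (Fin n)} (hC : ∀ x ∈ C, S.σ x ∈ C) {y : Fin n}
    (hy : S.σ y = y) :
    below C y = ∑ x ∈ C with S.σ x = x, if x < y then 1 else 0 :=
  sum_eq_sum_fixed S.involutive C hC _ fun x _ => by simp only [S.lt_map_iff hy]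

/-- To the left of a decorated pair there are only complete pairs and no isolated dot. -/
lemma below_of_dec (S : DecParen n p) {C : Finset (Fin n)} (hC : ∀ x ∈ C, S.σ x ∈ C)
    {d : Fin n × Fin n} (hd : d ∈ S.D) : below C d.1 = 0 := by
  rw [below, sum_eq_sum_fixed S.involutive C hC _ fun x _ => by simp only [S.lt_dec_iff hd]]
  refine Finset.sum_eq_zero fun x hx => if_neg fun h => ?_
  have h1 := S.dec_isolated d hd x (Finset.mem_filter.1 hx).2
  exact lt_asymm h ((S.dec_pair d hd).1.trans h1)

/-- The two counts differ by the points of `C` underneath the pair of `y`; these are paired among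
themselves, hence even in number. -/
lemma below_map (S : DecParen n p) {C : Finset (Fin n)} (hC : ∀ x ∈ C, S.σ x ∈ C) {y : Fin n}
    (hy : y ∉ C) : below C (S.σ y) = below C y := by
  have key : ∀ y, y ∉ C → y < S.σ y → below C (S.σ y) + below C y = 0 := by
    intro y hy hlt
    rw [below, below, ← Finset.sum_add_distrib]
    have hind : ∀ x ∈ C, ((if x < S.σ y then 1 else 0) + (if x < y then 1 else 0) : ZMod 2) =
        if y < x ∧ x < S.σ y then 1 else 0 := by
      intro x hx
      have hxy : x ≠ y := fun h => hy (h ▸ hx)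
      rcases lt_or_gt_of_ne hxy with h | h
      · have h2 : ¬ y < x := h.not_gt
        simp only [h.trans hlt, h, h2, if_true, false_and, if_false]
        exact CharTwo.add_self_eq_zero _
      · have h2 : ¬ x < y := h.not_gt
        simp [h, h2]
    rw [Finset.sum_congr rfl hind, sum_eq_sum_fixed S.involutive C hC]
    · refine Finset.sum_eq_zero fun x hx => if_neg fun h => ?_
      exact S.isolated_outside y x _ h.1 h.2 (Finset.mem_filter.1 hx).2 rfl
    · intro x _
      have : (y < S.σ x ∧ S.σ x < S.σ y) ↔ (y < x ∧ x < S.σ y) :=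
        ⟨fun h => by simpa [S.invol] using S.between_map h.1 h.2, fun h => S.between_map h.1 h.2⟩
      simp only [this]
  have h2 : below C (S.σ y) + below C y = 0 := by
    rcases lt_trichotomy y (S.σ y) with h | h | h
    · exact key y hy h
    · rw [← h]
      exact CharTwo.add_self_eq_zero _
    · have := key (S.σ y) (fun h' => hy (by simpa [S.invol] using hC _ h')) (by rwa [S.invol])
      rw [S.invol] at this
      rwa [add_comm]
  exact CharTwo.add_eq_zero.1 h2

/-- The discrete Jordan curve theorem: a curve disjoint from `C` never changes sides, so the parity
can be computed at whichever of its points is convenient. -/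
lemma below_linked (S : DecParen n p) (T : DecParen n q) {C : Finset (Fin n)}
    (hS : ∀ x ∈ C, S.σ x ∈ C) (hT : ∀ x ∈ C, T.σ x ∈ C) {y z : Fin n} (hy : y ∉ C)
    (h : Linked S.σ T.σ y z) : below C y = below C z := by
  have hS' : ∀ x, S.σ x ∈ C ↔ x ∈ C := fun x =>
    ⟨fun h => by simpa [S.invol] using hS _ h, hS x⟩
  have hT' : ∀ x, T.σ x ∈ C ↔ x ∈ C := fun x =>
    ⟨fun h => by simpa [T.invol] using hT _ h, hT x⟩
  have h1 : (y ∈ C) = (z ∈ C) :=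
    h.map_eq (f := (· ∈ C)) (fun i => propext (hS' i)) fun i => propext (hT' i)
  have hz : z ∉ C := h1 ▸ hy
  -- Extension by 0 on `C` makes the parity invariant at every dot, as `map_eq` requires.
  have h2 := h.map_eq (f := fun y => if y ∈ C then 0 else below C y)
    (fun i => by
      by_cases hi : i ∈ C
      · simp [hi, hS']
      · simp [hi, hS', below_map S hS hi])
    (fun i => by
      by_cases hi : i ∈ C
      · simp [hi, hT']
      · simp [hi, hT', below_map T hT hi])
  simpa [hy, hz] using h2

/-! ### Strands and their ends -/

open Classical in
/-- The component of `i` in the union of the two parenthesis diagrams `S` and `T`. -/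
noncomputable def strand (S : DecParen n p) (T : DecParen n q) (i : Fin n) : Finset (Fin n) :=
  Finset.univ.filter (Linked S.σ T.σ i)

section Strand

variable {S : DecParen n p} {T : DecParen n q} {i j : Fin n}

@[simp] lemma mem_strand : j ∈ strand S T i ↔ Linked S.σ T.σ i j := by simp [strand]

lemma strand_closed_left : ∀ x ∈ strand S T i, S.σ x ∈ strand S T i := fun x hx =>
  mem_strand.2 ((mem_strand.1 hx).trans (Linked.left x))

lemma strand_closed_right : ∀ x ∈ strand S T i, T.σ x ∈ strand S T i := fun x hx =>
  mem_strand.2 ((mem_strand.1 hx).trans (Linked.right x))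

lemma strand_eq_iff : strand S T i = strand S T j ↔ Linked S.σ T.σ i j := by
  constructor
  · intro h
    have : j ∈ strand S T i := h ▸ mem_strand.2 (Linked.refl j)
    exact mem_strand.1 this
  · intro h
    ext k
    simp only [mem_strand]
    exact ⟨h.symm.trans, h.trans⟩

lemma strand_comm : strand S T i = strand T S i := by
  ext k
  simp only [mem_strand]
  exact Linked.comm

/-- A component with exactly one end in `S` and one in `T`. -/
lemma below_strand_of_fixed {a b y : Fin n} (ha : S.σ a = a) (hb : T.σ b = b)
    (hab : Linked S.σ T.σ a b) (hy : S.σ y = y) :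
    below (strand S T a) y = if a < y then 1 else 0 := by
  rw [below_of_fixed S strand_closed_left hy]
  have : (strand S T a).filter (fun x => S.σ x = x) = {a} := by
    ext x
    simp only [Finset.mem_filter, mem_strand, Finset.mem_singleton]
    constructor
    · rintro ⟨h1, h2⟩
      exact (h1.fixed_unique S.involutive T.involutive ha h2 hb hab).symm
    · rintro rfl
      exact ⟨Linked.refl _, ha⟩
  rw [this, Finset.sum_singleton]

/-- Strands with one end in `S` and one end in `T` do not cross. -/
lemma lt_iff_lt_of_linked {a a' b b' : Fin n} (ha : S.σ a = a) (hb : T.σ b = b)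
    (hab : Linked S.σ T.σ a b) (ha' : S.σ a' = a') (hb' : T.σ b' = b')
    (hab' : Linked S.σ T.σ a' b') : a < a' ↔ b < b' := by
  by_cases h : Linked S.σ T.σ a a'
  · have h1 := h.fixed_unique S.involutive T.involutive ha ha' hb hab
    have h2 : b = b' := by
      refine (Linked.comm.1 (hab.symm.trans (h.trans hab'))).fixed_unique T.involutive S.involutive
        hb hb' ha (Linked.comm.1 hab.symm)
    subst h1 h2
    simp
  -- The parity relative to the strand of `a` is evaluated at both ends of the other strand: with
  -- `S` at `a'` it is the indicator of `a < a'`, with `T` at `b'` that of `b < b'`.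
  · have h1 := below_linked S T strand_closed_left strand_closed_right
      (fun h' => h (mem_strand.1 h')) hab'
    rw [below_strand_of_fixed ha hb hab ha', strand_eq_iff.2 hab, strand_comm,
      below_strand_of_fixed hb ha (Linked.comm.1 hab.symm) hb'] at h1
    constructor
    · intro h2
      by_contra h3
      simp [h2, h3] at h1
    · intro h3
      by_contra h2
      simp [h2, h3] at h1

/-- Decorations lie on the leftmost strand. -/
lemma le_of_linked_dec {a b y : Fin n} (ha : S.σ a = a) (hb : T.σ b = b)
    (hab : Linked S.σ T.σ a b) (hy : S.σ y = y) {d : Fin n × Fin n} (hd : d ∈ S.D ∨ d ∈ T.D)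
    (hdy : Linked S.σ T.σ d.1 y) : y ≤ a := by
  by_cases h : Linked S.σ T.σ a y
  · exact (h.fixed_unique S.involutive T.involutive ha hy hb hab).ge
  -- Relative to the strand of `a`, the parity is 0 at a decorated pair and the indicator of `a < y`
  -- at `y`.
  · have h1 := below_linked S T strand_closed_left strand_closed_right
      (fun h' => h ((mem_strand.1 h').trans hdy)) hdy
    have h2 : below (strand S T a) d.1 = 0 := by
      rcases hd with hd | hd
      · exact below_of_dec S strand_closed_left hd
      · exact below_of_dec T strand_closed_right hd
    rw [h2, below_strand_of_fixed ha hb hab hy] at h1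
    by_contra h3
    simp [not_le.1 h3] at h1

/-- No strand through `T` starts between the ends of a strand from `S` to `S`. -/
lemma not_between_of_linked {a a' x b : Fin n} (ha : S.σ a = a) (ha' : S.σ a' = a')
    (haa' : Linked S.σ T.σ a a') (hx : S.σ x = x) (hb : T.σ b = b) (hxb : Linked S.σ T.σ x b)
    (hax : a < x) (hxa' : x < a') : False := by
  have hxa : ¬ Linked S.σ T.σ x a := fun h =>
    hax.ne (h.fixed_unique S.involutive T.involutive hx ha hb hxb).symm
  have h1 := below_linked S T strand_closed_left strand_closed_right
      (fun h' => hxa (mem_strand.1 h')) haa'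
  rw [below_strand_of_fixed hx hb hxb ha, below_strand_of_fixed hx hb hxb ha'] at h1
  simp [hxa', hax.not_gt] at h1

/-- Both numbers have the parity of the cardinality of `C`. -/
lemma card_fixed_eq {C : Finset (Fin n)} (hS : ∀ x ∈ C, S.σ x ∈ C) (hT : ∀ x ∈ C, T.σ x ∈ C) :
    ((C.filter fun x => S.σ x = x).card : ZMod 2) = (C.filter fun x => T.σ x = x).card := by
  have h1 := sum_eq_sum_fixed S.involutive C hS (fun _ => 1) fun _ _ => rfl
  have h2 := sum_eq_sum_fixed T.involutive C hT (fun _ => 1) fun _ _ => rfl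
  rw [h1] at h2
  simpa using h2

lemma even_card_fixed_iff {C : Finset (Fin n)} (hS : ∀ x ∈ C, S.σ x ∈ C)
    (hT : ∀ x ∈ C, T.σ x ∈ C) :
    Even (C.filter fun x => S.σ x = x).card ↔ Even (C.filter fun x => T.σ x = x).card := by
  rw [← ZMod.natCast_eq_zero_iff_even, ← ZMod.natCast_eq_zero_iff_even, card_fixed_eq hS hT]

end Strand

end TLD

/-! ### The combinatorial form and the matching of isolated dots -/

namespace TLD

open DecParen

variable {n p q : ℕ}

open Classical in
/-- The components without ends. -/
noncomputable def loops (S : DecParen n p) (T : DecParen n q) : Finset (Finset (Fin n)) :=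
  Finset.univ.filter fun C => ∃ i, C = strand S T i ∧ ∀ j ∈ C, S.σ j ≠ j ∧ T.σ j ≠ j

/-- The number of decorations on `C`. -/
def decCount (S : DecParen n p) (T : DecParen n q) (C : Finset (Fin n)) : ℕ :=
  (S.D.filter fun d => d.1 ∈ C).card + (T.D.filter fun d => d.1 ∈ C).card

/-- No two isolated dots of `T` are connected. -/
def Separated (S : DecParen n p) (T : DecParen n q) : Prop :=
  ∀ b b', T.σ b = b → T.σ b' = b' → Linked S.σ T.σ b b' → b = b'

open Classical in
/-- The combinatorial form of the bilinear form of the cell module. -/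
noncomputable def phi {R : Type*} [CommRing R] (δ : R) (S : DecParen n p) (T : DecParen n q) : R :=
  if Separated S T ∧ ∀ C ∈ loops S T, Even (decCount S T C) then δ ^ (loops S T).card else 0

variable {S : DecParen n p} {T : DecParen n q}

lemma mem_loops {C : Finset (Fin n)} :
    C ∈ loops S T ↔ ∃ i, C = strand S T i ∧ ∀ j ∈ C, S.σ j ≠ j ∧ T.σ j ≠ j := by
  simp [loops]

/-- By separation the strand of `b` has one end in `T`, so by parity it has an end in `S`. -/
lemma Separated.exists_linked (h : Separated S T) {b : Fin n} (hb : T.σ b = b) :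
    ∃ a, S.σ a = a ∧ Linked S.σ T.σ a b := by
  have h1 : (strand S T b).filter (fun x => T.σ x = x) = {b} := by
    ext x
    simp only [Finset.mem_filter, mem_strand, Finset.mem_singleton]
    constructor
    · rintro ⟨h1, h2⟩
      exact (h b x hb h2 h1).symm
    · rintro rfl
      exact ⟨Linked.refl _, hb⟩
  have h2 := even_card_fixed_iff (S := S) (T := T) (C := strand S T b) strand_closed_left
    strand_closed_right
  rw [h1, Finset.card_singleton] at h2
  have h3 : (strand S T b).filter (fun x => S.σ x = x) ≠ ∅ := fun h4 => by simp [h4] at h2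
  obtain ⟨a, ha⟩ := Finset.nonempty_iff_ne_empty.2 h3
  obtain ⟨ha1, ha2⟩ := Finset.mem_filter.1 ha
  exact ⟨a, ha2, (mem_strand.1 ha1).symm⟩

open Classical in
/-- The isolated dots of `S` that are connected to an isolated dot of `T`. -/
noncomputable def matched (S : DecParen n p) (T : DecParen n q) : Finset (Fin n) :=
  S.ends.filter fun a => ∃ b, T.σ b = b ∧ Linked S.σ T.σ a b

lemma mem_matched {a : Fin n} :
    a ∈ matched S T ↔ S.σ a = a ∧ ∃ b, T.σ b = b ∧ Linked S.σ T.σ a b := by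
  simp [matched]

/-- Linking is a bijection: separation makes the end in `T` unique, `fixed_unique` the end in `S`.
-/
lemma Separated.card_matched (h : Separated S T) : (matched S T).card = T.ends.card := by
  symm
  have h1 : ∀ b : Fin n, ∃ a, T.σ b = b → S.σ a = a ∧ Linked S.σ T.σ a b := fun b => by
    by_cases hb : T.σ b = b
    · obtain ⟨a, ha⟩ := h.exists_linked hb
      exact ⟨a, fun _ => ha⟩
    · exact ⟨b, fun h => absurd h hb⟩
  choose f hf using h1
  refine Finset.card_bij (fun b _ => f b) ?_ ?_ ?_
  · intro b hb
    exact mem_matched.2 ⟨(hf b (mem_ends.1 hb)).1, b, mem_ends.1 hb, (hf b (mem_ends.1 hb)).2⟩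
  · intro b hb b' hb' hbb'
    refine h b b' (mem_ends.1 hb) (mem_ends.1 hb') ((hf b (mem_ends.1 hb)).2.symm.trans ?_)
    rw [hbb']
    exact (hf b' (mem_ends.1 hb')).2
  · intro a ha
    obtain ⟨ha, b, hb, hab⟩ := mem_matched.1 ha
    refine ⟨b, mem_ends.2 hb, ?_⟩
    exact ((hab.trans (hf b hb).2.symm).fixed_unique S.involutive T.involutive ha (hf b hb).1 hb
      hab).symm

/-- For equal `p` both diagrams have `n - 2 * p` isolated dots, so those of `S` are exhausted by the
matched ones. -/
lemma Separated.exists_linked' {T : DecParen n p} (h : Separated S T) {a : Fin n}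
    (ha : S.σ a = a) : ∃ b, T.σ b = b ∧ Linked S.σ T.σ a b := by
  have h1 : matched S T = S.ends := by
    refine Finset.eq_of_subset_of_card_le (fun x hx => mem_ends.2 (mem_matched.1 hx).1) ?_
    have h2 := S.card_ends_add
    have h3 := T.card_ends_add
    have := h.card_matched
    omega
  exact (mem_matched.1 (h1 ▸ mem_ends.2 ha)).2

lemma DecParen.rank_lt (S : DecParen n p) {a a' : Fin n} (ha : S.σ a = a)
    (h : a < a') : S.rank a < S.rank a' := by
  refine Finset.card_lt_card (Finset.ssubset_iff_of_subset ?_ |>.2 ⟨a, ?_, ?_⟩)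
  · intro k hk
    simp only [Finset.mem_filter, Finset.mem_univ, true_and] at hk ⊢
    exact ⟨hk.1.trans h, hk.2⟩
  · simp [h, ha]
  · simp

lemma DecParen.rank_inj (S : DecParen n p) {a a' : Fin n} (ha : S.σ a = a) (ha' : S.σ a' = a')
    (h : S.rank a = S.rank a') : a = a' := by
  rcases lt_trichotomy a a' with h1 | h1 | h1
  · exact absurd h (S.rank_lt ha h1).ne
  · exact h1
  · exact absurd h (S.rank_lt ha' h1).ne'

/-- Strands through do not cross, so linking is a bijection between the isolated dots to the left of
`a` and those to the left of `b`. -/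
lemma Separated.rank_eq {T : DecParen n p} (h : Separated S T) {a b : Fin n} (ha : S.σ a = a)
    (hb : T.σ b = b) (hab : Linked S.σ T.σ a b) : S.rank a = T.rank b := by
  have h1 : ∀ a : Fin n, ∃ b, S.σ a = a → T.σ b = b ∧ Linked S.σ T.σ a b := fun a => by
    by_cases ha : S.σ a = a
    · obtain ⟨b, hb⟩ := h.exists_linked' ha
      exact ⟨b, fun _ => hb⟩
    · exact ⟨a, fun h => absurd h ha⟩
  choose f hf using h1
  refine Finset.card_bij (fun k _ => f k) ?_ ?_ ?_
  · intro k hk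
    simp only [Finset.mem_filter, Finset.mem_univ, true_and] at hk ⊢
    exact ⟨(lt_iff_lt_of_linked hk.2 (hf k hk.2).1 (hf k hk.2).2 ha hb hab).1 hk.1, (hf k hk.2).1⟩
  · intro k hk k' hk' hkk'
    simp only [Finset.mem_filter, Finset.mem_univ, true_and] at hk hk'
    refine ((hf k hk.2).2.trans ?_).fixed_unique S.involutive T.involutive hk.2 hk'.2
      (hf k hk.2).1 (hf k hk.2).2
    rw [hkk']
    exact (hf k' hk'.2).2.symm
  · intro l hl
    simp only [Finset.mem_filter, Finset.mem_univ, true_and] at hl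
    obtain ⟨k, hk, hkl⟩ := h.exists_linked hl.2
    refine ⟨k, ?_, h _ _ (hf k hk).1 hl.2 ((hf k hk).2.symm.trans hkl)⟩
    simp only [Finset.mem_filter, Finset.mem_univ, true_and]
    exact ⟨(lt_iff_lt_of_linked hk hl.2 hkl ha hb hab).2 hl.1, hk⟩

lemma Separated.linked_iff {T : DecParen n p} (h : Separated S T) {a b : Fin n} (ha : S.σ a = a)
    (hb : T.σ b = b) : Linked S.σ T.σ a b ↔ S.rank a = T.rank b := by
  refine ⟨h.rank_eq ha hb, fun hr => ?_⟩
  obtain ⟨b', hb', hab'⟩ := h.exists_linked' ha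
  rwa [T.rank_inj hb hb' (hr.symm.trans (h.rank_eq ha hb' hab'))]

/-- If all components but one have an even number of decorations, the parity of the total number of
decorations is the one of this component. -/
lemma even_decCount_iff {a : Fin n}
    (h : ∀ i, strand S T i ≠ strand S T a → Even (decCount S T (strand S T i))) :
    Even (S.D.card + T.D.card) ↔ Even (decCount S T (strand S T a)) := by
  classical
  let t : Finset (Finset (Fin n)) := Finset.univ.image (strand S T)
  have key : ∀ D : Finset (Fin n × Fin n),
      D.card = ∑ C ∈ t, (D.filter fun d => d.1 ∈ C).card := by
    intro D
    rw [Finset.card_eq_sum_card_fiberwise (f := fun d => strand S T d.1) (t := t)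
      (fun d _ => Finset.mem_coe.2 (Finset.mem_image_of_mem _ (Finset.mem_univ _)))]
    refine Finset.sum_congr rfl fun C hC => ?_
    obtain ⟨i, -, rfl⟩ := Finset.mem_image.1 hC
    congr 1
    refine Finset.filter_congr fun d _ => ?_
    rw [mem_strand, eq_comm, strand_eq_iff]
  have h1 : S.D.card + T.D.card = ∑ C ∈ t, decCount S T C := by
    rw [key S.D, key T.D, ← Finset.sum_add_distrib]
    rfl
  rw [← ZMod.natCast_eq_zero_iff_even, ← ZMod.natCast_eq_zero_iff_even, h1, Nat.cast_sum,
    Finset.sum_eq_single (strand S T a)]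
  · intro C hC hCa
    obtain ⟨i, -, rfl⟩ := Finset.mem_image.1 hC
    exact ZMod.natCast_eq_zero_iff_even.2 (h i hCa)
  · intro h
    exact absurd (Finset.mem_image_of_mem _ (Finset.mem_univ _)) h

lemma decCount_eq_zero {C : Finset (Fin n)} (h : ∀ d, d ∈ S.D ∨ d ∈ T.D → d.1 ∉ C) :
    decCount S T C = 0 := by
  rw [decCount, Finset.filter_false_of_mem fun d hd => h d (Or.inl hd),
    Finset.filter_false_of_mem fun d hd => h d (Or.inr hd)]
  rfl

/-- If the isolated dots are connected in pairs and the loops are even, the decorations of the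
strand of an isolated dot which is not the leftmost one are none, and the parity of the decorations
of the leftmost strand is the one of the total number. -/
lemma even_decCount_iff_of_separated {T : DecParen n p} (h : Separated S T)
    (hl : ∀ C ∈ loops S T, Even (decCount S T C)) {a : Fin n} (ha : S.σ a = a)
    (ha0 : ∀ k, S.σ k = k → a ≤ k) :
    Even (S.D.card + T.D.card) ↔ Even (decCount S T (strand S T a)) := by
  refine even_decCount_iff fun i hi => ?_
  by_cases hC : ∀ j ∈ strand S T i, S.σ j ≠ j ∧ T.σ j ≠ j
  · exact hl _ (mem_loops.2 ⟨i, rfl, hC⟩)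
  -- A component that is neither a loop nor the strand of `a` ends at an isolated dot to the right
  -- of `a`; the strand through `a` shields it from all decorations.
  · have h1 : ∃ y, S.σ y = y ∧ Linked S.σ T.σ i y := by
      push Not at hC
      obtain ⟨j, hj, hj2⟩ := hC
      by_cases h2 : S.σ j = j
      · exact ⟨j, h2, mem_strand.1 hj⟩
      · obtain ⟨y, hy, hyj⟩ := h.exists_linked (hj2 h2)
        exact ⟨y, hy, (mem_strand.1 hj).trans hyj.symm⟩
    obtain ⟨y, hy, hiy⟩ := h1
    obtain ⟨b, hb, hab⟩ := h.exists_linked' ha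
    rw [decCount_eq_zero]
    · exact Even.zero
    · intro d hd hdi
      have h3 := le_of_linked_dec ha hb hab hy hd ((mem_strand.1 hdi).symm.trans hiy)
      rw [le_antisymm h3 (ha0 y hy)] at hiy
      exact hi (strand_eq_iff.2 hiy)

lemma not_mem_strand_of_dec {T : DecParen n p} (h : Separated S T) {a y : Fin n} (ha : S.σ a = a)
    (hy : S.σ y = y) (hay : a < y) {d : Fin n × Fin n} (hd : d ∈ S.D ∨ d ∈ T.D) :
    d.1 ∉ strand S T y := by
  obtain ⟨b, hb, hab⟩ := h.exists_linked' ha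
  intro hdy
  exact absurd (le_of_linked_dec ha hb hab hy hd (mem_strand.1 hdy).symm) (not_le.2 hay)

end TLD

/-! ### The curves of a product of two cell diagrams -/

namespace TLD

open DecParen Diagram

variable {n p : ℕ}

section Membership

variable {S T : DecParen n p} {i j : Fin n}

@[simp] lemma top_mem_arcs : s(Sum.inl i, Sum.inl j) ∈ (cellDiagram S T).arcs ↔
    S.σ i ≠ i ∧ S.σ i = j := by
  simp only [cellDiagram, Set.mem_ofPred_eq, Sym2.eq_iff, Sum.inl.injEq, reduceCtorEq, and_false,
    false_and, or_false, exists_false, and_self]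
  constructor
  · rintro ⟨k, hk, ⟨rfl, rfl⟩ | ⟨rfl, rfl⟩⟩
    · exact ⟨hk, rfl⟩
    · rw [S.invol]
      exact ⟨hk.symm, rfl⟩
  · rintro ⟨h, rfl⟩
    exact ⟨i, h, Or.inl ⟨rfl, rfl⟩⟩

@[simp] lemma bottom_mem_arcs : s(Sum.inr i, Sum.inr j) ∈ (cellDiagram S T).arcs ↔
    T.σ i ≠ i ∧ T.σ i = j := by
  simp only [cellDiagram, Set.mem_ofPred_eq, Sym2.eq_iff, Sum.inr.injEq, reduceCtorEq, and_false,
    false_and, or_false, exists_false, and_self, false_or]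
  constructor
  · rintro ⟨k, hk, ⟨rfl, rfl⟩ | ⟨rfl, rfl⟩⟩
    · exact ⟨hk, rfl⟩
    · rw [T.invol]
      exact ⟨hk.symm, rfl⟩
  · rintro ⟨h, rfl⟩
    exact ⟨i, h, Or.inl ⟨rfl, rfl⟩⟩

@[simp] lemma vertical_mem_arcs : s(Sum.inl i, Sum.inr j) ∈ (cellDiagram S T).arcs ↔
    S.σ i = i ∧ T.σ j = j ∧ S.rank i = T.rank j := by
  simp only [cellDiagram, Set.mem_ofPred_eq, Sym2.eq_iff, Sum.inr.injEq, Sum.inl.injEq,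
    reduceCtorEq, and_false, false_and, or_false, exists_false, false_or]
  constructor
  · rintro ⟨k, l, hk, hl, h, rfl, rfl⟩
    exact ⟨hk, hl, h⟩
  · rintro ⟨hk, hl, h⟩
    exact ⟨i, j, hk, hl, h, rfl, rfl⟩

@[simp] lemma top_mem_dec : s(Sum.inl i, Sum.inl j) ∈ (cellDiagram S T).dec ↔
    (i, j) ∈ S.D ∨ (j, i) ∈ S.D := by
  simp only [cellDiagram, Set.mem_ofPred_eq, Sym2.eq_iff, Sum.inl.injEq, reduceCtorEq, and_false,
    false_and, or_false, exists_false, and_self]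
  constructor
  · rintro ⟨⟨k, l⟩, hk, ⟨rfl, rfl⟩ | ⟨rfl, rfl⟩⟩
    · exact Or.inl hk
    · exact Or.inr hk
  · rintro (h | h)
    · exact ⟨_, h, Or.inl ⟨rfl, rfl⟩⟩
    · exact ⟨_, h, Or.inr ⟨rfl, rfl⟩⟩

@[simp] lemma bottom_mem_dec : s(Sum.inr i, Sum.inr j) ∈ (cellDiagram S T).dec ↔
    (i, j) ∈ T.D ∨ (j, i) ∈ T.D := by
  simp only [cellDiagram, Set.mem_ofPred_eq, Sym2.eq_iff, Sum.inr.injEq, reduceCtorEq, and_false,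
    false_and, or_false, exists_false, and_self, false_or]
  constructor
  · rintro ⟨⟨k, l⟩, hk, ⟨rfl, rfl⟩ | ⟨rfl, rfl⟩⟩
    · exact Or.inl hk
    · exact Or.inr hk
  · rintro (h | h)
    · exact ⟨_, h, Or.inl ⟨rfl, rfl⟩⟩
    · exact ⟨_, h, Or.inr ⟨rfl, rfl⟩⟩

@[simp] lemma vertical_mem_dec : s(Sum.inl i, Sum.inr j) ∈ (cellDiagram S T).dec ↔
    Odd (S.D.card + T.D.card) ∧ S.σ i = i ∧ T.σ j = j ∧ S.rank i = 0 ∧ T.rank j = 0 := by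
  simp only [cellDiagram, Set.mem_ofPred_eq, Sym2.eq_iff, Sum.inr.injEq, Sum.inl.injEq,
    reduceCtorEq, and_false, false_and, or_false, exists_false, false_or]
  refine and_congr_right fun _ => ?_
  constructor
  · rintro ⟨k, l, hk, hl, h, h', rfl, rfl⟩
    exact ⟨hk, hl, h, h'⟩
  · rintro ⟨hk, hl, h, h'⟩
    exact ⟨i, j, hk, hl, h, h', rfl, rfl⟩

lemma mem_comp_arcs {d e : Diagram n} {x y : Dots n} : s(x, y) ∈ (d.comp e).arcs ↔
    x ≠ y ∧ curve d e (outer x) = curve d e (outer y) := by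
  simp only [comp, Set.mem_ofPred_eq, Sym2.eq_iff]
  constructor
  · rintro ⟨x', y', h1, h2, ⟨rfl, rfl⟩ | ⟨rfl, rfl⟩⟩
    · exact ⟨h1, h2⟩
    · exact ⟨h1.symm, h2.symm⟩
  · rintro ⟨h1, h2⟩
    exact ⟨x, y, h1, h2, Or.inl ⟨rfl, rfl⟩⟩

lemma mem_comp_dec {d e : Diagram n} {x y : Dots n} (h : ¬ (d.comp e).loop) :
    s(x, y) ∈ (d.comp e).dec ↔
    x ≠ y ∧ curve d e (outer x) = curve d e (outer y) ∧
      Odd (decorations d e (curve d e (outer x))) := by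
  have h' : ¬ d.loop ∧ ¬ e.loop ∧ ∀ c ∈ circuits d e, ¬ Odd (decorations d e c) := by
    simp only [comp, not_or, not_exists, not_and] at h
    exact h
  simp only [comp, Set.mem_ofPred_eq, Sym2.eq_iff]
  constructor
  · rintro ⟨-, x', y', h1, h2, ⟨rfl, rfl⟩ | ⟨rfl, rfl⟩, h3⟩
    · exact ⟨h1, h2, h3⟩
    · exact ⟨h1.symm, h2.symm, h2 ▸ h3⟩
  · rintro ⟨h1, h2, h3⟩
    exact ⟨h', x, y, h1, h2, Or.inl ⟨rfl, rfl⟩, h3⟩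

end Membership

section Curves

variable (S T : DecParen n p)

/-- An invariant of the curves of the concatenation of two cell diagrams. -/
noncomputable def curveKey (v : Fin 3 × Fin n) : Fin 3 × Finset (Fin n) :=
  if v.1 = 0 ∧ S.σ v.2 ≠ v.2 then (0, {v.2, S.σ v.2})
  else if v.1 = 2 ∧ T.σ v.2 ≠ v.2 then (2, {v.2, T.σ v.2})
  else (1, strand S T v.2)

variable {S T} {i j : Fin n}

lemma curveKey_mid : curveKey S T (1, i) = (1, strand S T i) := by simp [curveKey]

lemma curveKey_top (h : S.σ i ≠ i) : curveKey S T (0, i) = (0, {i, S.σ i}) := by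
  simp [curveKey, h]

lemma curveKey_top_fixed (h : S.σ i = i) : curveKey S T (0, i) = (1, strand S T i) := by
  simp [curveKey, h]

lemma curveKey_bottom (h : T.σ i ≠ i) : curveKey S T (2, i) = (2, {i, T.σ i}) := by
  simp [curveKey, h]

lemma curveKey_bottom_fixed (h : T.σ i = i) : curveKey S T (2, i) = (1, strand S T i) := by
  simp [curveKey, h]

/-- Within one diagram `S` equal rank means equal position, so each vertical arc of `cellDiagram S
S` joins the two copies of one dot. -/
lemma curveKey_eq_of_upper {x y : Dots n} (h : s(x, y) ∈ (cellDiagram S S).arcs) :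
    curveKey S T (upper x) = curveKey S T (upper y) := by
  rcases x with i | i <;> rcases y with j | j
  · obtain ⟨h1, rfl⟩ := top_mem_arcs.1 h
    have h2 : S.σ (S.σ i) ≠ S.σ i := fun h => h1 (S.involutive.injective h)
    simp only [upper, Sum.elim_inl]
    rw [curveKey_top h1, curveKey_top h2, S.invol, Finset.pair_comm]
  · obtain ⟨h1, h2, h3⟩ := vertical_mem_arcs.1 h
    obtain rfl := S.rank_inj h1 h2 h3
    simp only [upper, Sum.elim_inl, Sum.elim_inr]
    rw [curveKey_top_fixed h1, curveKey_mid]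
  · rw [Sym2.eq_swap] at h
    obtain ⟨h1, h2, h3⟩ := vertical_mem_arcs.1 h
    obtain rfl := S.rank_inj h1 h2 h3
    simp only [upper, Sum.elim_inl, Sum.elim_inr]
    rw [curveKey_top_fixed h1, curveKey_mid]
  · obtain ⟨h1, rfl⟩ := bottom_mem_arcs.1 h
    simp only [upper, Sum.elim_inr]
    rw [curveKey_mid, curveKey_mid, strand_eq_iff.2 (Linked.left i)]

lemma curveKey_eq_of_lower {x y : Dots n} (h : s(x, y) ∈ (cellDiagram T T).arcs) :
    curveKey S T (lower x) = curveKey S T (lower y) := by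
  rcases x with i | i <;> rcases y with j | j
  · obtain ⟨h1, rfl⟩ := top_mem_arcs.1 h
    simp only [lower, Sum.elim_inl]
    rw [curveKey_mid, curveKey_mid, strand_eq_iff.2 (Linked.right i)]
  · obtain ⟨h1, h2, h3⟩ := vertical_mem_arcs.1 h
    obtain rfl := T.rank_inj h1 h2 h3
    simp only [lower, Sum.elim_inl, Sum.elim_inr]
    rw [curveKey_bottom_fixed h1, curveKey_mid]
  · rw [Sym2.eq_swap] at h
    obtain ⟨h1, h2, h3⟩ := vertical_mem_arcs.1 h
    obtain rfl := T.rank_inj h1 h2 h3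
    simp only [lower, Sum.elim_inl, Sum.elim_inr]
    rw [curveKey_bottom_fixed h1, curveKey_mid]
  · obtain ⟨h1, rfl⟩ := bottom_mem_arcs.1 h
    have h2 : T.σ (T.σ i) ≠ T.σ i := fun h => h1 (T.involutive.injective h)
    simp only [lower, Sum.elim_inr]
    rw [curveKey_bottom h1, curveKey_bottom h2, T.invol, Finset.pair_comm]

lemma curve_eq_of_upper {d e : Diagram n} {x y : Dots n} (h : s(x, y) ∈ d.arcs) :
    curve d e (upper x) = curve d e (upper y) := by
  by_cases hxy : upper x = upper y
  · rw [hxy]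
  · refine SimpleGraph.ConnectedComponent.eq.2 (SimpleGraph.Adj.reachable ?_)
    exact (SimpleGraph.fromEdgeSet_adj _).2 ⟨Or.inl ⟨_, h, by simp⟩, hxy⟩

lemma curve_eq_of_lower {d e : Diagram n} {x y : Dots n} (h : s(x, y) ∈ e.arcs) :
    curve d e (lower x) = curve d e (lower y) := by
  by_cases hxy : lower x = lower y
  · rw [hxy]
  · refine SimpleGraph.ConnectedComponent.eq.2 (SimpleGraph.Adj.reachable ?_)
    exact (SimpleGraph.fromEdgeSet_adj _).2 ⟨Or.inr ⟨_, h, by simp⟩, hxy⟩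

/-- The curve of a point in the concatenation of two cell diagrams. -/
noncomputable abbrev cellCurve (S T : DecParen n p) (v : Fin 3 × Fin n) :
    (stack (cellDiagram S S) (cellDiagram T T)).ConnectedComponent :=
  curve (cellDiagram S S) (cellDiagram T T) v

lemma cellCurve_mid_eq (h : Linked S.σ T.σ i j) : cellCurve S T (1, i) = cellCurve S T (1, j) := by
  refine h.map_eq (f := fun i => cellCurve S T (1, i)) (fun i => ?_) fun i => ?_
  · by_cases hi : S.σ i = i
    · simp [hi]
    · exact (curve_eq_of_upper (x := Sum.inr i) (y := Sum.inr (S.σ i))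
        (bottom_mem_arcs.2 ⟨hi, rfl⟩)).symm
  · by_cases hi : T.σ i = i
    · simp [hi]
    · exact (curve_eq_of_lower (x := Sum.inl i) (y := Sum.inl (T.σ i))
        (top_mem_arcs.2 ⟨hi, rfl⟩)).symm

lemma cellCurve_top_fixed (h : S.σ i = i) : cellCurve S T (0, i) = cellCurve S T (1, i) :=
  curve_eq_of_upper (x := Sum.inl i) (y := Sum.inr i) (vertical_mem_arcs.2 ⟨h, h, rfl⟩)

lemma cellCurve_bottom_fixed (h : T.σ i = i) : cellCurve S T (2, i) = cellCurve S T (1, i) :=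
  (curve_eq_of_lower (x := Sum.inl i) (y := Sum.inr i) (vertical_mem_arcs.2 ⟨h, h, rfl⟩)).symm

lemma cellCurve_top (h : S.σ i ≠ i) : cellCurve S T (0, i) = cellCurve S T (0, S.σ i) :=
  curve_eq_of_upper (x := Sum.inl i) (y := Sum.inl (S.σ i)) (top_mem_arcs.2 ⟨h, rfl⟩)

lemma cellCurve_bottom (h : T.σ i ≠ i) : cellCurve S T (2, i) = cellCurve S T (2, T.σ i) :=
  curve_eq_of_lower (x := Sum.inr i) (y := Sum.inr (T.σ i)) (bottom_mem_arcs.2 ⟨h, rfl⟩)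

/-- Every curve is the curve of a point of the middle row, a top arc or a bottom arc. -/
lemma cellCurve_cases (v : Fin 3 × Fin n) :
    (∃ i, cellCurve S T v = cellCurve S T (1, i) ∧ curveKey S T v = (1, strand S T i)) ∨
    (∃ i, S.σ i ≠ i ∧ v = (0, i)) ∨ ∃ i, T.σ i ≠ i ∧ v = (2, i) := by
  obtain ⟨r, i⟩ := v
  fin_cases r
  · by_cases h : S.σ i = i
    · exact Or.inl ⟨i, cellCurve_top_fixed h, curveKey_top_fixed h⟩
    · exact Or.inr (Or.inl ⟨i, h, rfl⟩)
  · exact Or.inl ⟨i, rfl, curveKey_mid⟩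
  · by_cases h : T.σ i = i
    · exact Or.inl ⟨i, cellCurve_bottom_fixed h, curveKey_bottom_fixed h⟩
    · exact Or.inr (Or.inr ⟨i, h, rfl⟩)

lemma mem_pair_of_eq {ρ : Fin n → Fin n} (h : ({i, ρ i} : Finset (Fin n)) = {j, ρ j}) :
    j = i ∨ j = ρ i := by
  have : j ∈ ({i, ρ i} : Finset (Fin n)) := by rw [h]; simp
  simpa using this

/-- `curveKey` is a complete invariant of curves. It is constant along the edges; conversely its tag
tells top arcs, bottom arcs and curves through the middle row apart, and a curve of the last kind is
determined by its strand. -/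
lemma cellCurve_eq_iff {u v : Fin 3 × Fin n} :
    cellCurve S T u = cellCurve S T v ↔ curveKey S T u = curveKey S T v := by
  constructor
  · intro h
    obtain ⟨w⟩ := SimpleGraph.ConnectedComponent.eq.1 h
    clear h
    induction w with
    | nil => rfl
    | cons h _ ih =>
      refine Eq.trans ?_ ih
      obtain ⟨h1 | h1, -⟩ := (SimpleGraph.fromEdgeSet_adj _).1 h
      · obtain ⟨a, ha, ha'⟩ := h1
        induction a using Sym2.ind with
        | _ x y =>
          rw [Sym2.map_mk, Sym2.eq_iff] at ha'
          rcases ha' with ⟨h2, h3⟩ | ⟨h2, h3⟩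
          · rw [← h2, ← h3]
            exact curveKey_eq_of_upper ha
          · rw [← h2, ← h3]
            exact (curveKey_eq_of_upper ha).symm
      · obtain ⟨a, ha, ha'⟩ := h1
        induction a using Sym2.ind with
        | _ x y =>
          rw [Sym2.map_mk, Sym2.eq_iff] at ha'
          rcases ha' with ⟨h2, h3⟩ | ⟨h2, h3⟩
          · rw [← h2, ← h3]
            exact curveKey_eq_of_lower ha
          · rw [← h2, ← h3]
            exact (curveKey_eq_of_lower ha).symm
  · rcases cellCurve_cases (S := S) (T := T) u with ⟨i, h1, h2⟩ | ⟨i, hi, rfl⟩ | ⟨i, hi, rfl⟩ <;>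
    rcases cellCurve_cases (S := S) (T := T) v with ⟨j, h3, h4⟩ | ⟨j, hj, rfl⟩ | ⟨j, hj, rfl⟩
    · rw [h1, h2, h3, h4]
      intro h
      exact cellCurve_mid_eq (strand_eq_iff.1 (congrArg Prod.snd h))
    · rw [h2, curveKey_top hj]
      simp
    · rw [h2, curveKey_bottom hj]
      simp
    · rw [h4, curveKey_top hi]
      simp
    · rw [curveKey_top hi, curveKey_top hj]
      intro h
      rcases mem_pair_of_eq (congrArg Prod.snd h) with rfl | rfl
      · rfl
      · exact cellCurve_top hi
    · rw [curveKey_top hi, curveKey_bottom hj]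
      simp
    · rw [h4, curveKey_bottom hi]
      simp
    · rw [curveKey_top hj, curveKey_bottom hi]
      simp
    · rw [curveKey_bottom hi, curveKey_bottom hj]
      intro h
      rcases mem_pair_of_eq (congrArg Prod.snd h) with rfl | rfl
      · rfl
      · exact cellCurve_bottom hi

lemma cellCurve_mid_iff : cellCurve S T (1, i) = cellCurve S T (1, j) ↔ Linked S.σ T.σ i j := by
  rw [cellCurve_eq_iff, curveKey_mid, curveKey_mid, Prod.mk.injEq, strand_eq_iff]
  simp

/-- A strand escapes to an outer row precisely through its isolated dots, and a curve missing the
middle row is an outer arc. -/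
lemma mem_circuits {c : (stack (cellDiagram S S) (cellDiagram T T)).ConnectedComponent} :
    c ∈ circuits (cellDiagram S S) (cellDiagram T T) ↔
      ∃ i, c = cellCurve S T (1, i) ∧ ∀ j ∈ strand S T i, S.σ j ≠ j ∧ T.σ j ≠ j := by
  induction c using SimpleGraph.ConnectedComponent.ind with
  | _ v =>
  change cellCurve S T v ∈ _ ↔ ∃ i, cellCurve S T v = _ ∧ _
  constructor
  · intro h
    rcases cellCurve_cases (S := S) (T := T) v with ⟨i, h1, -⟩ | ⟨i, hi, rfl⟩ | ⟨i, hi, rfl⟩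
    · refine ⟨i, h1, fun j hj => ⟨fun hS => ?_, fun hT => ?_⟩⟩
      · refine h (Sum.inl j) ?_
        rw [h1]
        exact (cellCurve_top_fixed hS).trans (cellCurve_mid_eq (mem_strand.1 hj).symm)
      · refine h (Sum.inr j) ?_
        rw [h1]
        exact (cellCurve_bottom_fixed hT).trans (cellCurve_mid_eq (mem_strand.1 hj).symm)
    · exact absurd rfl (h (Sum.inl i))
    · exact absurd rfl (h (Sum.inr i))
  · rintro ⟨i, hi, h⟩
    rw [hi]
    rintro (j | j) hj
    · have hj' : cellCurve S T (0, j) = cellCurve S T (1, i) := hj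
      by_cases hS : S.σ j = j
      · rw [cellCurve_top_fixed hS, cellCurve_mid_iff] at hj'
        exact (h j (mem_strand.2 hj'.symm)).1 hS
      · rw [cellCurve_eq_iff, curveKey_top hS, curveKey_mid] at hj'
        simp at hj'
    · have hj' : cellCurve S T (2, j) = cellCurve S T (1, i) := hj
      by_cases hS : T.σ j = j
      · rw [cellCurve_bottom_fixed hS, cellCurve_mid_iff] at hj'
        exact (h j (mem_strand.2 hj'.symm)).2 hS
      · rw [cellCurve_eq_iff, curveKey_bottom hS, curveKey_mid] at hj'
        simp at hj'

lemma ncard_circuits :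
    (circuits (cellDiagram S S) (cellDiagram T T)).ncard = (loops S T).card := by
  classical
  let f : (stack (cellDiagram S S) (cellDiagram T T)).ConnectedComponent → Finset (Fin n) :=
    fun c => Finset.univ.filter fun i => cellCurve S T (1, i) = c
  have hf : ∀ i, f (cellCurve S T (1, i)) = strand S T i := by
    intro i
    ext j
    simp only [f, Finset.mem_filter, Finset.mem_univ, true_and, mem_strand, cellCurve_mid_iff]
    exact ⟨Linked.symm, Linked.symm⟩
  have h1 : f '' circuits (cellDiagram S S) (cellDiagram T T) = ↑(loops S T) := by
    ext C
    simp only [Set.mem_image, mem_circuits, Finset.mem_coe, mem_loops]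
    constructor
    · rintro ⟨c, ⟨i, rfl, hi⟩, rfl⟩
      refine ⟨i, hf i, ?_⟩
      rwa [hf]
    · rintro ⟨i, rfl, hi⟩
      exact ⟨_, ⟨i, rfl, hi⟩, hf i⟩
  rw [← Set.ncard_coe_finset, ← h1, Set.InjOn.ncard_image]
  intro c hc c' hc' h
  obtain ⟨i, rfl, -⟩ := mem_circuits.1 hc
  obtain ⟨j, rfl, -⟩ := mem_circuits.1 hc'
  rw [hf, hf, strand_eq_iff] at h
  exact cellCurve_mid_iff.2 h

/-- The order `d.1 < d.2` prevents two ordered pairs from giving the same arc. -/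
lemma ncard_arcs {g : Fin n → Dots n} (hg : Function.Injective g) (D : Finset (Fin n × Fin n))
    (hD : ∀ d ∈ D, d.1 < d.2) {A : Set (Sym2 (Dots n))}
    (hA : ∀ a, a ∈ A ↔ ∃ d ∈ D, a = s(g d.1, g d.2)) : A.ncard = D.card := by
  have h1 : A = (fun d : Fin n × Fin n => s(g d.1, g d.2)) '' ↑D := by
    ext a
    rw [hA]
    simp [eq_comm]
  rw [h1, Set.InjOn.ncard_image, Set.ncard_coe_finset]
  intro d hd d' hd' h
  have h2 := hD d hd
  have h3 := hD d' hd'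
  rcases Sym2.eq_iff.1 h with ⟨h4, h5⟩ | ⟨h4, h5⟩
  · exact Prod.ext (hg h4) (hg h5)
  · rw [hg h4, hg h5] at h2
    exact absurd h2 h3.not_gt

/-- The total number of decorations is twice that of `S`, so the vertical arcs of `cellDiagram S S`
are undecorated. -/
lemma mem_dec_self {a : Sym2 (Dots n)} : a ∈ (cellDiagram S S).dec ↔
    (∃ d ∈ S.D, a = s(Sum.inl d.1, Sum.inl d.2)) ∨ ∃ d ∈ S.D, a = s(Sum.inr d.1, Sum.inr d.2) := by
  have : ¬ Odd (S.D.card + S.D.card) := by simp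
  simp [cellDiagram, this]

lemma linked_dec {d : Fin n × Fin n} (hd : d ∈ S.D) : Linked S.σ T.σ d.1 d.2 := by
  rw [← (S.dec_pair d hd).2]
  exact Linked.left _

/-- Decorated arcs in the outer rows are curves by themselves, so only the copies of the decorations
in the middle row count. -/
lemma decorations_mid : decorations (cellDiagram S S) (cellDiagram T T) (cellCurve S T (1, i)) =
    decCount S T (strand S T i) := by
  have htop : ∀ d ∈ S.D, cellCurve S T (0, d.1) ≠ cellCurve S T (1, i) := by
    intro d hd h
    rw [cellCurve_eq_iff, curveKey_mid, curveKey_top (S.dec_fst_not_fixed hd)] at h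
    simp at h
  have hbot : ∀ d ∈ T.D, cellCurve S T (2, d.1) ≠ cellCurve S T (1, i) := by
    intro d hd h
    rw [cellCurve_eq_iff, curveKey_mid, curveKey_bottom (T.dec_fst_not_fixed hd)] at h
    simp at h
  unfold decorations decCount
  congr 1
  · refine ncard_arcs Sum.inr_injective _
      (fun d hd => (S.dec_pair d (Finset.mem_filter.1 hd).1).1) fun a => ?_
    rw [Set.mem_sep_iff, mem_dec_self]
    constructor
    · rintro ⟨⟨d, hd, rfl⟩ | ⟨d, hd, rfl⟩, h⟩
      · exact absurd (h _ (Sym2.mem_mk_left _ _)) (htop d hd)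
      · refine ⟨d, Finset.mem_filter.2 ⟨hd, ?_⟩, rfl⟩
        exact mem_strand.2 (cellCurve_mid_iff.1 (h _ (Sym2.mem_mk_left _ _))).symm
    · rintro ⟨d, hd, rfl⟩
      obtain ⟨h1, h2⟩ := Finset.mem_filter.1 hd
      refine ⟨Or.inr ⟨d, h1, rfl⟩, fun v hv => ?_⟩
      rcases Sym2.mem_iff.1 hv with rfl | rfl
      · exact cellCurve_mid_eq (mem_strand.1 h2).symm
      · exact cellCurve_mid_eq ((mem_strand.1 h2).trans (linked_dec h1)).symm
  · refine ncard_arcs Sum.inl_injective _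
      (fun d hd => (T.dec_pair d (Finset.mem_filter.1 hd).1).1) fun a => ?_
    rw [Set.mem_sep_iff, mem_dec_self]
    constructor
    · rintro ⟨⟨d, hd, rfl⟩ | ⟨d, hd, rfl⟩, h⟩
      · refine ⟨d, Finset.mem_filter.2 ⟨hd, ?_⟩, rfl⟩
        exact mem_strand.2 (cellCurve_mid_iff.1 (h _ (Sym2.mem_mk_left _ _))).symm
      · exact absurd (h _ (Sym2.mem_mk_left _ _)) (hbot d hd)
    · rintro ⟨d, hd, rfl⟩
      obtain ⟨h1, h2⟩ := Finset.mem_filter.1 hd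
      refine ⟨Or.inl ⟨d, h1, rfl⟩, fun v hv => ?_⟩
      rcases Sym2.mem_iff.1 hv with rfl | rfl
      · exact cellCurve_mid_eq (mem_strand.1 h2).symm
      · exact cellCurve_mid_eq ((mem_strand.1 h2).trans (Linked.comm.1 (linked_dec h1))).symm

lemma odd_ncard_iff {β : Type*} {A : Set β} {x : β} (h : A ⊆ {x}) : Odd A.ncard ↔ x ∈ A := by
  rcases Set.subset_singleton_iff_eq.1 h with rfl | rfl <;> simp

lemma odd_decorations_top (hi : S.σ i ≠ i) :
    Odd (decorations (cellDiagram S S) (cellDiagram T T) (cellCurve S T (0, i))) ↔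
      (i, S.σ i) ∈ S.D ∨ (S.σ i, i) ∈ S.D := by
  have hmid : ∀ j, cellCurve S T (1, j) ≠ cellCurve S T (0, i) := by
    intro j h
    rw [cellCurve_eq_iff, curveKey_mid, curveKey_top hi] at h
    simp at h
  have h0 : {a ∈ (cellDiagram T T).dec | ∀ v ∈ a, cellCurve S T (lower v) =
      cellCurve S T (0, i)} = ∅ := by
    rw [Set.eq_empty_iff_forall_notMem]
    rintro a ⟨ha, h⟩
    rcases mem_dec_self.1 ha with ⟨d, hd, rfl⟩ | ⟨d, hd, rfl⟩
    · exact hmid d.1 (h _ (Sym2.mem_mk_left _ _))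
    · have h1 : cellCurve S T (2, d.1) = _ := h _ (Sym2.mem_mk_left _ _)
      rw [cellCurve_eq_iff, curveKey_bottom (T.dec_fst_not_fixed hd), curveKey_top hi] at h1
      simp at h1
  unfold decorations
  rw [h0, Set.ncard_empty, add_zero, odd_ncard_iff (x := s(Sum.inl i, Sum.inl (S.σ i)))]
  · rw [Set.mem_sep_iff, top_mem_dec, and_iff_left]
    intro v hv
    rcases Sym2.mem_iff.1 hv with rfl | rfl
    · rfl
    · exact (cellCurve_top hi).symm
  · rintro a ⟨ha, h⟩
    rcases mem_dec_self.1 ha with ⟨d, hd, rfl⟩ | ⟨d, hd, rfl⟩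
    · have h1 : cellCurve S T (0, d.1) = _ := h _ (Sym2.mem_mk_left _ _)
      rw [cellCurve_eq_iff, curveKey_top (S.dec_fst_not_fixed hd), curveKey_top hi] at h1
      rw [Set.mem_singleton_iff, ← (S.dec_pair d hd).2]
      rcases mem_pair_of_eq (congrArg Prod.snd h1) with h2 | h2
      · rw [h2]
      · rw [h2, S.invol, Sym2.eq_swap]
    · exact absurd (h _ (Sym2.mem_mk_left _ _)) (hmid d.1)

lemma odd_decorations_bottom (hi : T.σ i ≠ i) :
    Odd (decorations (cellDiagram S S) (cellDiagram T T) (cellCurve S T (2, i))) ↔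
      (i, T.σ i) ∈ T.D ∨ (T.σ i, i) ∈ T.D := by
  have hmid : ∀ j, cellCurve S T (1, j) ≠ cellCurve S T (2, i) := by
    intro j h
    rw [cellCurve_eq_iff, curveKey_mid, curveKey_bottom hi] at h
    simp at h
  have h0 : {a ∈ (cellDiagram S S).dec | ∀ v ∈ a, cellCurve S T (upper v) =
      cellCurve S T (2, i)} = ∅ := by
    rw [Set.eq_empty_iff_forall_notMem]
    rintro a ⟨ha, h⟩
    rcases mem_dec_self.1 ha with ⟨d, hd, rfl⟩ | ⟨d, hd, rfl⟩
    · have h1 : cellCurve S T (0, d.1) = _ := h _ (Sym2.mem_mk_left _ _)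
      rw [cellCurve_eq_iff, curveKey_top (S.dec_fst_not_fixed hd), curveKey_bottom hi] at h1
      simp at h1
    · exact hmid d.1 (h _ (Sym2.mem_mk_left _ _))
  unfold decorations
  rw [h0, Set.ncard_empty, zero_add, odd_ncard_iff (x := s(Sum.inr i, Sum.inr (T.σ i)))]
  · rw [Set.mem_sep_iff, bottom_mem_dec, and_iff_left]
    intro v hv
    rcases Sym2.mem_iff.1 hv with rfl | rfl
    · rfl
    · exact (cellCurve_bottom hi).symm
  · rintro a ⟨ha, h⟩
    rcases mem_dec_self.1 ha with ⟨d, hd, rfl⟩ | ⟨d, hd, rfl⟩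
    · exact absurd (h _ (Sym2.mem_mk_left _ _)) (hmid d.1)
    · have h1 : cellCurve S T (2, d.1) = _ := h _ (Sym2.mem_mk_left _ _)
      rw [cellCurve_eq_iff, curveKey_bottom (T.dec_fst_not_fixed hd), curveKey_bottom hi] at h1
      rw [Set.mem_singleton_iff, ← (T.dec_pair d hd).2]
      rcases mem_pair_of_eq (congrArg Prod.snd h1) with h2 | h2
      · rw [h2]
      · rw [h2, T.invol, Sym2.eq_swap]

end Curves

end TLD

/-! ### The bilinear form expressed by strands -/

namespace TLD

open DecParen Diagram

variable {n p : ℕ} {S T : DecParen n p}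

lemma comp_loop_iff : ((cellDiagram S S).comp (cellDiagram T T)).loop ↔
    ¬ ∀ C ∈ loops S T, Even (decCount S T C) := by
  have h1 : ((cellDiagram S S).comp (cellDiagram T T)).loop ↔
      ∃ c ∈ circuits (cellDiagram S S) (cellDiagram T T),
        Odd (decorations (cellDiagram S S) (cellDiagram T T) c) := by
    simp [comp, cellDiagram]
  rw [h1]
  push Not
  constructor
  · rintro ⟨c, hc, h⟩
    obtain ⟨i, rfl, hi⟩ := mem_circuits.1 hc
    rw [decorations_mid] at h
    exact ⟨_, mem_loops.2 ⟨i, rfl, hi⟩, Nat.not_even_iff_odd.2 h⟩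
  · rintro ⟨C, hC, h⟩
    obtain ⟨i, rfl, hi⟩ := mem_loops.1 hC
    refine ⟨_, mem_circuits.2 ⟨i, rfl, hi⟩, ?_⟩
    rw [decorations_mid]
    exact Nat.not_even_iff_odd.1 h

lemma outer_top_iff (h : Separated S T) {i j : Fin n} :
    (i ≠ j ∧ cellCurve S T (0, i) = cellCurve S T (0, j)) ↔ S.σ i ≠ i ∧ S.σ i = j := by
  by_cases hi : S.σ i = i
  · simp only [ne_eq, hi, not_true_eq_false, false_and, iff_false, not_and]
    intro hij h1
    rw [cellCurve_top_fixed hi] at h1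
    by_cases hj : S.σ j = j
    · rw [cellCurve_top_fixed hj, cellCurve_mid_iff] at h1
      obtain ⟨b, hb, hib⟩ := h.exists_linked' hi
      exact hij (h1.fixed_unique S.involutive T.involutive hi hj hb hib)
    · rw [cellCurve_eq_iff, curveKey_mid, curveKey_top hj] at h1
      simp at h1
  · constructor
    · rintro ⟨hij, h1⟩
      by_cases hj : S.σ j = j
      · rw [cellCurve_top_fixed hj, cellCurve_eq_iff, curveKey_mid, curveKey_top hi] at h1
        simp at h1
      · rw [cellCurve_eq_iff, curveKey_top hi, curveKey_top hj] at h1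
        rcases mem_pair_of_eq (congrArg Prod.snd h1) with h2 | h2
        · exact absurd h2.symm hij
        · exact ⟨hi, h2.symm⟩
    · rintro ⟨h1, rfl⟩
      exact ⟨Ne.symm h1, cellCurve_top h1⟩

lemma outer_bottom_iff (h : Separated S T) {i j : Fin n} :
    (i ≠ j ∧ cellCurve S T (2, i) = cellCurve S T (2, j)) ↔ T.σ i ≠ i ∧ T.σ i = j := by
  by_cases hi : T.σ i = i
  · simp only [ne_eq, hi, not_true_eq_false, false_and, iff_false, not_and]
    intro hij h1
    rw [cellCurve_bottom_fixed hi] at h1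
    by_cases hj : T.σ j = j
    · rw [cellCurve_bottom_fixed hj, cellCurve_mid_iff] at h1
      exact hij (h i j hi hj h1)
    · rw [cellCurve_eq_iff, curveKey_mid, curveKey_bottom hj] at h1
      simp at h1
  · constructor
    · rintro ⟨hij, h1⟩
      by_cases hj : T.σ j = j
      · rw [cellCurve_bottom_fixed hj, cellCurve_eq_iff, curveKey_mid, curveKey_bottom hi] at h1
        simp at h1
      · rw [cellCurve_eq_iff, curveKey_bottom hi, curveKey_bottom hj] at h1
        rcases mem_pair_of_eq (congrArg Prod.snd h1) with h2 | h2
        · exact absurd h2.symm hij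
        · exact ⟨hi, h2.symm⟩
    · rintro ⟨h1, rfl⟩
      exact ⟨Ne.symm h1, cellCurve_bottom h1⟩

lemma outer_vertical_iff (h : Separated S T) {i j : Fin n} :
    cellCurve S T (0, i) = cellCurve S T (2, j) ↔
      S.σ i = i ∧ T.σ j = j ∧ S.rank i = T.rank j := by
  by_cases hi : S.σ i = i <;> by_cases hj : T.σ j = j
  · rw [cellCurve_top_fixed hi, cellCurve_bottom_fixed hj, cellCurve_mid_iff, h.linked_iff hi hj]
    simp [hi, hj]
  · rw [cellCurve_top_fixed hi, cellCurve_eq_iff, curveKey_mid, curveKey_bottom hj]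
    simp [hj]
  · rw [cellCurve_bottom_fixed hj, cellCurve_eq_iff, curveKey_mid, curveKey_top hi]
    simp [hi]
  · rw [cellCurve_eq_iff, curveKey_top hi, curveKey_bottom hj]
    simp [hi]

/-- When the loops are even, every strand through but the leftmost is undecorated, so the leftmost
carries the parity of the total. This is the rule for the vertical arc of `cellDiagram S T`. -/
lemma odd_decorations_vertical (h : Separated S T)
    (hl : ∀ C ∈ loops S T, Even (decCount S T C)) {i j : Fin n} (hi : S.σ i = i)
    (hij : S.rank i = T.rank j) :
    Odd (decorations (cellDiagram S S) (cellDiagram T T) (cellCurve S T (0, i))) ↔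
      Odd (S.D.card + T.D.card) ∧ S.rank i = 0 ∧ T.rank j = 0 := by
  rw [cellCurve_top_fixed hi, decorations_mid, ← hij, and_self]
  by_cases hr : S.rank i = 0
  · have h0 : ∀ k, S.σ k = k → i ≤ k := by
      intro k hk
      by_contra hik
      have := S.rank_lt hk (not_le.1 hik)
      omega
    simp only [hr, and_true]
    rw [← Nat.not_even_iff_odd, ← Nat.not_even_iff_odd, even_decCount_iff_of_separated h hl hi h0]
  · simp only [hr, and_false, iff_false]
    obtain ⟨a, ha⟩ := Finset.card_ne_zero.1 hr
    simp only [Finset.mem_filter, Finset.mem_univ, true_and] at ha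
    rw [decCount_eq_zero fun d hd => not_mem_strand_of_dec h ha.2 hi ha.1 hd]
    simp

/-- A strand joining two isolated dots of `T` creates an arc between them that `cellDiagram S T`
lacks, and an odd loop creates a decorated circuit. Otherwise strands through match isolated dots of
equal rank, and arcs and decorations agree. -/
lemma comp_eq_iff : (cellDiagram S S).comp (cellDiagram T T) = cellDiagram S T ↔
    Separated S T ∧ ∀ C ∈ loops S T, Even (decCount S T C) := by
  constructor
  · intro h
    constructor
    · intro b b' hb hb' hbb'
      by_contra hne
      have h1 : s(Sum.inr b, Sum.inr b') ∈ ((cellDiagram S S).comp (cellDiagram T T)).arcs := by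
        rw [mem_comp_arcs]
        refine ⟨fun h => hne (Sum.inr_injective h), ?_⟩
        change cellCurve S T (2, b) = cellCurve S T (2, b')
        rw [cellCurve_bottom_fixed hb, cellCurve_bottom_fixed hb', cellCurve_mid_iff]
        exact hbb'
      rw [h, bottom_mem_arcs] at h1
      exact h1.1 hb
    · by_contra h1
      rw [← comp_loop_iff, h] at h1
      exact h1
  · rintro ⟨h, hl⟩
    have hloop : ¬ ((cellDiagram S S).comp (cellDiagram T T)).loop := fun h' =>
      comp_loop_iff.1 h' hl
    have harc : ∀ x y, s(x, y) ∈ ((cellDiagram S S).comp (cellDiagram T T)).arcs ↔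
        s(x, y) ∈ (cellDiagram S T).arcs := by
      have hv : ∀ i j, s(Sum.inl i, Sum.inr j) ∈
          ((cellDiagram S S).comp (cellDiagram T T)).arcs ↔
            s(Sum.inl i, Sum.inr j) ∈ (cellDiagram S T).arcs := by
        intro i j
        rw [mem_comp_arcs, vertical_mem_arcs, ← outer_vertical_iff h, and_iff_right (by simp)]
        rfl
      rintro (i | i) (j | j)
      · rw [mem_comp_arcs, top_mem_arcs, ← outer_top_iff h, ne_eq, Sum.inl.injEq]
        rfl
      · exact hv i j
      · rw [Sym2.eq_swap]
        exact hv j i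
      · rw [mem_comp_arcs, bottom_mem_arcs, ← outer_bottom_iff h, ne_eq, Sum.inr.injEq]
        rfl
    have hdec : ∀ x y, s(x, y) ∈ ((cellDiagram S S).comp (cellDiagram T T)).dec ↔
        s(x, y) ∈ (cellDiagram S T).dec := by
      have hv : ∀ i j, s(Sum.inl i, Sum.inr j) ∈
          ((cellDiagram S S).comp (cellDiagram T T)).dec ↔
            s(Sum.inl i, Sum.inr j) ∈ (cellDiagram S T).dec := by
        intro i j
        rw [mem_comp_dec hloop, vertical_mem_dec, and_iff_right (by simp)]
        change cellCurve S T (0, i) = cellCurve S T (2, j) ∧ Odd (decorations (cellDiagram S S)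
          (cellDiagram T T) (cellCurve S T (0, i))) ↔ _
        rw [outer_vertical_iff h]
        constructor
        · rintro ⟨⟨h1, h2, h3⟩, h4⟩
          rw [odd_decorations_vertical h hl h1 h3] at h4
          exact ⟨h4.1, h1, h2, h4.2⟩
        · rintro ⟨h1, h2, h3, h4, h5⟩
          refine ⟨⟨h2, h3, h4.trans h5.symm⟩, ?_⟩
          rw [odd_decorations_vertical h hl h2 (h4.trans h5.symm)]
          exact ⟨h1, h4, h5⟩
      rintro (i | i) (j | j)
      · rw [mem_comp_dec hloop, top_mem_dec, ← and_assoc, ne_eq, Sum.inl.injEq]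
        change (i ≠ j ∧ cellCurve S T (0, i) = cellCurve S T (0, j)) ∧ Odd (decorations
          (cellDiagram S S) (cellDiagram T T) (cellCurve S T (0, i))) ↔ _
        rw [outer_top_iff h]
        constructor
        · rintro ⟨⟨h1, rfl⟩, h2⟩
          exact (odd_decorations_top h1).1 h2
        · intro h1
          have h2 : S.σ i ≠ i ∧ S.σ i = j := by
            rcases h1 with h1 | h1
            · exact ⟨S.dec_fst_not_fixed h1, (S.dec_pair _ h1).2⟩
            · have h3 : S.σ j = i := (S.dec_pair _ h1).2
              rw [← h3, S.invol]
              exact ⟨(S.dec_fst_not_fixed h1).symm, rfl⟩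
          refine ⟨h2, (odd_decorations_top h2.1).2 ?_⟩
          rwa [h2.2]
      · exact hv i j
      · rw [Sym2.eq_swap]
        exact hv j i
      · rw [mem_comp_dec hloop, bottom_mem_dec, ← and_assoc, ne_eq, Sum.inr.injEq]
        change (i ≠ j ∧ cellCurve S T (2, i) = cellCurve S T (2, j)) ∧ Odd (decorations
          (cellDiagram S S) (cellDiagram T T) (cellCurve S T (2, i))) ↔ _
        rw [outer_bottom_iff h]
        constructor
        · rintro ⟨⟨h1, rfl⟩, h2⟩
          exact (odd_decorations_bottom h1).1 h2
        · intro h1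
          have h2 : T.σ i ≠ i ∧ T.σ i = j := by
            rcases h1 with h1 | h1
            · exact ⟨T.dec_fst_not_fixed h1, (T.dec_pair _ h1).2⟩
            · have h3 : T.σ j = i := (T.dec_pair _ h1).2
              rw [← h3, T.invol]
              exact ⟨(T.dec_fst_not_fixed h1).symm, rfl⟩
          refine ⟨h2, (odd_decorations_bottom h2.1).2 ?_⟩
          rwa [h2.2]
    refine Diagram.ext (Set.ext fun a => ?_) (Set.ext fun a => ?_) (propext ?_)
    · induction a using Sym2.ind with
      | _ x y => exact harc x y
    · induction a using Sym2.ind with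
      | _ x y => exact hdec x y
    · exact ⟨hloop, False.elim⟩

/-- The product of two diagrams is a multiple of one diagram, so the coefficient is 0 unless that
diagram is `cellDiagram S T`. In that case there is no decorated circuit and every loop is removed.
-/
lemma cellForm_eq_phi {R : Type*} [CommRing R] (δ : R) (S T : DecParen n p) :
    cellForm δ S T = phi δ S T := by
  classical
  have h1 : cellForm δ S T = if (cellDiagram S S).comp (cellDiagram T T) = cellDiagram S T
      then δ ^ (cellDiagram S S).removed (cellDiagram T T) else 0 := by
    simp [cellForm, mul, cellBasis, Finsupp.single_apply]
  rw [h1, phi]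
  by_cases h : (cellDiagram S S).comp (cellDiagram T T) = cellDiagram S T
  · rw [if_pos h, if_pos (comp_eq_iff.1 h), removed, h, ncard_circuits]
    simp [cellDiagram]
  · rw [if_neg h, if_neg fun h' => h (comp_eq_iff.2 h')]

end TLD

/-! ### Adding an isolated dot on the right -/

namespace TLD

open DecParen

variable {n p q : ℕ} {S : DecParen n p} {T : DecParen n q}

section AddDot

@[simp] lemma DecParen.addDot_castSucc (S : DecParen n p) (i : Fin n) :
    S.addDot.σ i.castSucc = (S.σ i).castSucc := by
  simp [addDot]

@[simp] lemma DecParen.addDot_last (S : DecParen n p) : S.addDot.σ (Fin.last n) = Fin.last n := by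
  simp [addDot]

lemma strand_addDot (i : Fin n) :
    strand S.addDot T.addDot i.castSucc = (strand S T i).map Fin.castSuccEmb := by
  -- The value `none` at the new dot separates it from the old components in this invariant.
  have h1 : ∀ {x y}, Linked S.addDot.σ T.addDot.σ x y →
      (Fin.lastCases none (fun i => some (strand S T i)) x : Option (Finset (Fin n))) =
        Fin.lastCases none (fun i => some (strand S T i)) y := by
    intro x y h
    refine h.map_eq (f := fun x => (Fin.lastCases none (fun i => some (strand S T i)) x :
      Option (Finset (Fin n)))) (fun i => ?_) fun i => ?_
    · induction i using Fin.lastCases with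
      | last => simp
      | cast i => simp [strand_eq_iff.2 (Linked.left (σ := S.σ) (τ := T.σ) i)]
    · induction i using Fin.lastCases with
      | last => simp
      | cast i => simp [strand_eq_iff.2 (Linked.right (σ := S.σ) (τ := T.σ) i)]
  ext j
  rw [mem_strand, Finset.mem_map]
  constructor
  · intro h
    have h2 := h1 h
    induction j using Fin.lastCases with
    | last => simp at h2
    | cast j =>
      simp only [Fin.lastCases_castSucc, Option.some.injEq, strand_eq_iff] at h2
      exact ⟨j, mem_strand.2 h2, rfl⟩
  · rintro ⟨k, hk, rfl⟩
    refine Linked.lift (r := fun i k => Linked S.addDot.σ T.addDot.σ (Fin.castSucc i)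
      (Fin.castSucc k)) ⟨fun _ => Linked.refl _, Linked.symm, Linked.trans⟩ (fun i => ?_)
      (fun i => ?_) (mem_strand.1 hk)
    · rw [← S.addDot_castSucc]
      exact Linked.left _
    · rw [← T.addDot_castSucc]
      exact Linked.right _

lemma linked_addDot {i j : Fin n} :
    Linked S.addDot.σ T.addDot.σ i.castSucc j.castSucc ↔ Linked S.σ T.σ i j := by
  rw [← mem_strand, strand_addDot]
  simp

lemma linked_last_iff {X : DecParen (n + 1) p} {Y : DecParen (n + 1) q}
    (hX : X.σ (Fin.last n) = Fin.last n) (hY : Y.σ (Fin.last n) = Fin.last n) {x : Fin (n + 1)} :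
    Linked X.σ Y.σ (Fin.last n) x ↔ x = Fin.last n := by
  constructor
  · intro h
    have := h.map_eq (f := fun x => x = Fin.last n)
      (fun i => propext ⟨fun h => X.involutive.injective (h.trans hX.symm), fun h => by rw [h, hX]⟩)
      (fun i => propext ⟨fun h => Y.involutive.injective (h.trans hY.symm), fun h => by rw [h, hY]⟩)
    exact this ▸ rfl
  · rintro rfl
    exact Linked.refl _

lemma decCount_addDot (C : Finset (Fin n)) :
    decCount S.addDot T.addDot (C.map Fin.castSuccEmb) = decCount S T C := by
  have key : ∀ {r : ℕ} (U : DecParen n r),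
      (U.addDot.D.filter fun d => d.1 ∈ C.map Fin.castSuccEmb).card =
        (U.D.filter fun d => d.1 ∈ C).card := by
    intro r U
    rw [addDot, Finset.filter_map, Finset.card_map]
    congr 1
    refine Finset.filter_congr fun d _ => ?_
    simp
  rw [decCount, decCount, key, key]

lemma loops_addDot : loops S.addDot T.addDot =
    (loops S T).map (Finset.mapEmbedding Fin.castSuccEmb).toEmbedding := by
  ext C
  simp only [mem_loops, Finset.mem_map, RelEmbedding.coe_toEmbedding, Finset.mapEmbedding_apply]
  constructor
  · rintro ⟨i, rfl, h⟩
    induction i using Fin.lastCases with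
    | last => exact absurd S.addDot_last (h _ (mem_strand.2 (Linked.refl _))).1
    | cast i =>
      refine ⟨strand S T i, ⟨i, rfl, fun j hj => ?_⟩, (strand_addDot i).symm⟩
      have := h j.castSucc (by simpa [linked_addDot] using hj)
      simpa using this
  · rintro ⟨C, ⟨i, rfl, h⟩, rfl⟩
    refine ⟨i.castSucc, (strand_addDot i).symm, fun j hj => ?_⟩
    obtain ⟨k, hk, rfl⟩ := Finset.mem_map.1 hj
    simpa using h k hk

lemma separated_addDot : Separated S.addDot T.addDot ↔ Separated S T := by
  constructor
  · intro h b b' hb hb' hbb'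
    have := h b.castSucc b'.castSucc (by simp [hb]) (by simp [hb']) (linked_addDot.2 hbb')
    simpa using this
  · intro h b b' hb hb' hbb'
    induction b using Fin.lastCases with
    | last => exact ((linked_last_iff S.addDot_last T.addDot_last).1 hbb').symm
    | cast b =>
      induction b' using Fin.lastCases with
      | last => exact (linked_last_iff S.addDot_last T.addDot_last).1 hbb'.symm
      | cast b' =>
        rw [h b b' (by simpa using hb) (by simpa using hb') (linked_addDot.1 hbb')]

lemma phi_addDot {R : Type*} [CommRing R] (δ : R) (S : DecParen n p) (T : DecParen n q) :
    phi δ S.addDot T.addDot = phi δ S T := by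
  unfold phi
  rw [separated_addDot, loops_addDot, Finset.card_map]
  congr 2
  refine propext ?_
  simp [decCount_addDot]

/-- Both cases of the definition of `gram` agree, because an added dot is a strand by itself and
does not change `phi`. -/
lemma gram_eq_phi {R : Type*} [CommRing R] (δ : R) (n p : ℕ) :
    gram δ n p = Matrix.of fun S T => phi δ S T := by
  ext S T
  simp [gram, cellForm_eq_phi, phi_addDot]

end AddDot

end TLD

/-! ### Joining two consecutive isolated dots -/

namespace TLD

open DecParen

variable {n p q : ℕ}

/-- Two consecutive isolated dots. -/
structure DecParen.Adjacent (S : DecParen n p) (a b : Fin n) : Prop where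
  left : S.σ a = a
  right : S.σ b = b
  lt : a < b
  not_between : ∀ x, S.σ x = x → ¬ (a < x ∧ x < b)

/-- The diagram obtained by joining two consecutive isolated dots; the new pair is decorated if `ε`,
which requires the dots to be the first ones. -/
def DecParen.join (S : DecParen n p) (a b : Fin n) (ε : Bool) (h : S.Adjacent a b)
    (hε : ε = true → ∀ x, S.σ x = x → a ≤ x) : DecParen n (p + 1) where
  σ i := if i = a then b else if i = b then a else S.σ i
  D := if ε then insert (a, b) S.D else S.D
  invol := by
    have hab := h.lt.ne
    have hab' := h.lt.ne'
    intro i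
    by_cases hia : i = a
    · simp [hia, hab']
    by_cases hib : i = b
    · simp [hib, hab']
    have h1 : S.σ i ≠ a := fun h' => hia (by rw [← S.invol i, h', h.left])
    have h2 : S.σ i ≠ b := fun h' => hib (by rw [← S.invol i, h', h.right])
    simp [hia, hib, h1, h2, S.invol]
  isolated_outside := by
    intro i j k hij hjk hj hik
    by_cases hja : j = a
    · simp only [hja, if_true] at hj
      exact h.lt.ne' hj
    by_cases hjb : j = b
    · simp only [hjb, h.lt.ne', if_true, if_false] at hj
      exact h.lt.ne hj
    simp only [hja, hjb, if_false] at hj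
    by_cases hia : i = a
    · simp only [hia, if_true] at hik
      exact h.not_between j hj ⟨hia ▸ hij, hik ▸ hjk⟩
    by_cases hib : i = b
    · simp only [hib, h.lt.ne', if_true, if_false] at hik
      exact absurd (hij.trans hjk) (by rw [hib, ← hik]; exact h.lt.not_gt)
    simp only [hia, hib, if_false] at hik
    exact S.isolated_outside i j k hij hjk hj hik
  noncrossing := by
    rintro i j k l hij hjk hkl ⟨hik, hjl⟩
    have hbne := h.lt.ne'
    by_cases hia : i = a
    · simp only [hia, if_true] at hik
      subst hia hik
      simp only [hij.ne', hjk.ne, if_false] at hjl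
      exact S.isolated_outside j b l hjk hkl h.right hjl
    by_cases hib : i = b
    · simp only [hib, hbne, if_true, if_false] at hik
      exact absurd (hij.trans hjk) (by rw [hib, ← hik]; exact h.lt.not_gt)
    simp only [hia, hib, if_false] at hik
    by_cases hja : j = a
    · subst hja
      exact S.isolated_outside i j k hij hjk h.left hik
    by_cases hjb : j = b
    · simp only [hjb, hbne, if_true, if_false] at hjl
      exact absurd (hjk.trans hkl) (by rw [hjb, ← hjl]; exact h.lt.not_gt)
    simp only [hja, hjb, if_false] at hjl
    exact S.noncrossing i j k l hij hjk hkl ⟨hik, hjl⟩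
  card_paired := by
    have hab := h.lt.ne
    have hab' := h.lt.ne'
    have h1 : (Finset.univ.filter fun i => (if i = a then b else if i = b then a else S.σ i) ≠ i) =
        insert a (insert b (Finset.univ.filter fun i => S.σ i ≠ i)) := by
      ext i
      simp only [Finset.mem_filter, Finset.mem_univ, true_and, Finset.mem_insert]
      by_cases hia : i = a
      · simp [hia, hab']
      by_cases hib : i = b
      · simp [hib, hab, hab']
      simp [hia, hib]
    rw [h1, Finset.card_insert_of_notMem, Finset.card_insert_of_notMem, S.card_paired]
    · ring
    · simp [h.right]
    · simp [h.left, hab]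
  dec_pair := by
    have hbne := h.lt.ne'
    intro d hd
    have key : d ∈ S.D → d.1 < d.2 ∧ (if d.1 = a then b else if d.1 = b then a else S.σ d.1) =
        d.2 := by
      intro hd
      obtain ⟨h1, h2⟩ := S.dec_pair d hd
      have h3 := S.dec_isolated d hd
      refine ⟨h1, ?_⟩
      rw [if_neg, if_neg, h2]
      · intro h4
        exact absurd (h1.trans (h3 b h.right)) (by rw [h4]; exact lt_irrefl _)
      · intro h4
        exact absurd (h1.trans (h3 a h.left)) (by rw [h4]; exact lt_irrefl _)
    cases ε with
    | false => exact key hd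
    | true =>
      rcases Finset.mem_insert.1 (by simpa using hd) with rfl | hd
      · simp [h.lt]
      · exact key hd
  dec_isolated := by
    intro d hd k hk
    by_cases hka : k = a
    · simp only [hka, if_true] at hk
      exact absurd hk h.lt.ne'
    by_cases hkb : k = b
    · simp only [hkb, h.lt.ne', if_true, if_false] at hk
      exact absurd hk h.lt.ne
    simp only [hka, hkb, if_false] at hk
    cases ε with
    | false => exact S.dec_isolated d hd k hk
    | true =>
      rcases Finset.mem_insert.1 (by simpa using hd) with rfl | hd
      -- A decorated new pair joins the first two isolated dots, so the remaining ones lie to its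
      -- right.
      · have h1 : a < k := lt_of_le_of_ne (hε rfl k hk) (Ne.symm hka)
        exact lt_of_le_of_ne (not_lt.1 fun h2 => h.not_between k hk ⟨h1, h2⟩) (Ne.symm hkb)
      · exact S.dec_isolated d hd k hk
  dec_outer := by
    have key : ∀ d ∈ S.D, ∀ i, i < d.1 →
        ¬ d.2 < (if i = a then b else if i = b then a else S.σ i) := by
      intro d hd i hi
      have h1 := (S.dec_pair d hd).1
      rw [if_neg, if_neg]
      · exact S.dec_outer d hd i hi
      · rintro rfl
        exact lt_asymm (hi.trans h1) (S.dec_isolated d hd _ h.right)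
      · rintro rfl
        exact lt_asymm (hi.trans h1) (S.dec_isolated d hd _ h.left)
    intro d hd
    cases ε with
    | false => exact key d hd
    | true =>
      rcases Finset.mem_insert.1 (by simpa using hd) with rfl | hd
      · intro i hi h1
        dsimp only at hi h1
        rw [if_neg hi.ne, if_neg (hi.trans h.lt).ne] at h1
        exact S.isolated_outside i a _ hi (h.lt.trans h1) h.left rfl
      · exact key d hd

section Join

variable {X : DecParen n p} {W : DecParen n q} {a b : Fin n} {ε : Bool} {h : X.Adjacent a b}
  {hε : ε = true → ∀ x, X.σ x = x → a ≤ x}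

lemma join_left : (X.join a b ε h hε).σ a = b := by simp [DecParen.join]

lemma join_right : (X.join a b ε h hε).σ b = a := by simp [DecParen.join, h.lt.ne']

lemma join_of_ne {i : Fin n} (ha : i ≠ a) (hb : i ≠ b) : (X.join a b ε h hε).σ i = X.σ i := by
  simp [DecParen.join, ha, hb]

lemma join_fixed_iff {i : Fin n} :
    (X.join a b ε h hε).σ i = i ↔ X.σ i = i ∧ i ≠ a ∧ i ≠ b := by
  by_cases ha : i = a
  · rw [ha, join_left]
    simp [h.lt.ne']
  by_cases hb : i = b
  · rw [hb, join_right]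
    simp [h.lt.ne]
  rw [join_of_ne ha hb]
  simp [ha, hb]

lemma linked_join_iff {i j : Fin n} :
    Linked (X.join a b ε h hε).σ W.σ i j ↔ Linked X.σ W.σ i j ∨
      (Linked X.σ W.σ i a ∧ Linked X.σ W.σ b j) ∨ (Linked X.σ W.σ i b ∧ Linked X.σ W.σ a j) :=
  Linked.merge_iff h.left h.right join_left join_right fun _ => join_of_ne

lemma strand_join_of_not {i : Fin n} (ha : ¬ Linked X.σ W.σ i a) (hb : ¬ Linked X.σ W.σ i b) :
    strand (X.join a b ε h hε) W i = strand X W i := by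
  ext j
  simp only [mem_strand, linked_join_iff]
  tauto

lemma strand_join_left :
    strand (X.join a b ε h hε) W a = strand X W a ∪ strand X W b := by
  ext j
  simp only [mem_strand, linked_join_iff, Finset.mem_union]
  have := Linked.refl (σ := X.σ) (τ := W.σ) a
  tauto

lemma strand_join_of_linked {i : Fin n} (hi : Linked X.σ W.σ i a ∨ Linked X.σ W.σ i b) :
    strand (X.join a b ε h hε) W i = strand X W a ∪ strand X W b := by
  rw [← strand_join_left (h := h) (hε := hε), strand_eq_iff, linked_join_iff]
  have := Linked.refl (σ := X.σ) (τ := W.σ) a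
  tauto

lemma not_linked_of_mem_loops {C : Finset (Fin n)} (hC : C ∈ loops X W) {i : Fin n} (hi : i ∈ C)
    {x : Fin n} (hx : X.σ x = x) : ¬ Linked X.σ W.σ i x := by
  obtain ⟨k, rfl, hk⟩ := mem_loops.1 hC
  exact fun h => (hk x (mem_strand.2 ((mem_strand.1 hi).trans h))).1 hx

/-- Joining merges the components of `a` and `b` and touches no other. Old loops avoid both, as
these dots were isolated; the merged component is the only possible new loop. -/
lemma mem_loops_join {C : Finset (Fin n)} : C ∈ loops (X.join a b ε h hε) W ↔
    C ∈ loops X W ∨ (C = strand X W a ∪ strand X W b ∧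
      ∀ j ∈ C, (X.join a b ε h hε).σ j ≠ j ∧ W.σ j ≠ j) := by
  constructor
  · intro hC
    obtain ⟨i, rfl, hi⟩ := mem_loops.1 hC
    by_cases hl : Linked X.σ W.σ i a ∨ Linked X.σ W.σ i b
    · exact Or.inr ⟨strand_join_of_linked hl, hi⟩
    · push Not at hl
      rw [strand_join_of_not hl.1 hl.2] at hi ⊢
      refine Or.inl (mem_loops.2 ⟨i, rfl, fun j hj => ⟨fun hj1 => ?_, (hi j hj).2⟩⟩)
      refine (hi j hj).1 (join_fixed_iff.2 ⟨hj1, ?_, ?_⟩)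
      · rintro rfl
        exact hl.1 (mem_strand.1 hj)
      · rintro rfl
        exact hl.2 (mem_strand.1 hj)
  · rintro (hC | ⟨rfl, hC⟩)
    · obtain ⟨i, rfl, hi⟩ := mem_loops.1 hC
      have hi0 : i ∈ strand X W i := mem_strand.2 (Linked.refl i)
      rw [← strand_join_of_not (h := h) (hε := hε) (not_linked_of_mem_loops hC hi0 h.left)
        (not_linked_of_mem_loops hC hi0 h.right)] at hi ⊢
      refine mem_loops.2 ⟨i, rfl, fun j hj => ⟨fun hj1 => ?_, (hi j hj).2⟩⟩
      exact (hi j hj).1 (join_fixed_iff.1 hj1).1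
    · exact mem_loops.2 ⟨a, strand_join_left.symm, hC⟩

lemma loops_subset_join : loops X W ⊆ loops (X.join a b ε h hε) W :=
  fun _ hC => mem_loops_join.2 (Or.inl hC)

lemma fst_ne_of_mem_dec {d : Fin n × Fin n} (hd : d ∈ X.D) {x : Fin n} (hx : X.σ x = x) :
    d.1 ≠ x := by
  rintro rfl
  exact X.dec_fst_not_fixed hd hx

lemma decCount_join_of_notMem {C : Finset (Fin n)} (hC : a ∉ C) :
    decCount (X.join a b ε h hε) W C = decCount X W C := by
  unfold decCount
  congr 2
  cases ε with
  | false => rfl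
  | true => simp [DecParen.join, Finset.filter_insert, hC]

lemma decCount_join_of_mem {C : Finset (Fin n)} (hC : a ∈ C) :
    decCount (X.join a b ε h hε) W C = decCount X W C + ε.toNat := by
  unfold decCount
  cases ε with
  | false => rfl
  | true =>
    have h1 : (a, b) ∉ X.D.filter fun d => d.1 ∈ C := fun h' =>
      fst_ne_of_mem_dec (Finset.mem_filter.1 h').1 h.left rfl
    simp only [DecParen.join, if_true, Finset.filter_insert, hC]
    rw [Finset.card_insert_of_notMem h1, Bool.toNat_true]
    ring

lemma decCount_join_of_mem_loops {C : Finset (Fin n)} (hC : C ∈ loops X W) :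
    decCount (X.join a b ε h hε) W C = decCount X W C :=
  decCount_join_of_notMem fun ha => not_linked_of_mem_loops hC ha h.left (Linked.refl a)

lemma Separated.of_join (hs : Separated (X.join a b ε h hε) W) : Separated X W :=
  fun y y' hy hy' hyy' => hs y y' hy hy' (linked_join_iff.2 (Or.inl hyy'))

variable {R : Type*} [CommRing R] (δ : R)

/-- The isolated dots of `W` are separated and all the loops are even. -/
def Admissible (X : DecParen n p) (W : DecParen n q) : Prop :=
  Separated X W ∧ ∀ C ∈ loops X W, Even (decCount X W C)

lemma phi_of_admissible (hA : Admissible X W) : phi δ X W = δ ^ (loops X W).card := if_pos hA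

lemma phi_of_not_admissible (hA : ¬ Admissible X W) : phi δ X W = 0 := if_neg hA

/-- Joining preserves odd loops and links between isolated dots of `W`, so it cannot repair an
obstruction. -/
lemma phi_join_of_not_admissible (hA : ¬ Admissible X W) :
    phi δ (X.join a b ε h hε) W = 0 :=
  phi_of_not_admissible δ fun h' => hA ⟨h'.1.of_join, fun C hC => by
    rw [← decCount_join_of_mem_loops (h := h) (hε := hε) hC]
    exact h'.2 C (loops_subset_join hC)⟩

/-- Joining the two ends of a strand creates a loop. -/
lemma phi_join_closed (hA : Admissible X W) (hab : Linked X.σ W.σ a b)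
    (hX : ∀ x, X.σ x = x → Linked X.σ W.σ a x → x = a ∨ x = b)
    (hW : ∀ y, W.σ y = y → ¬ Linked X.σ W.σ a y) :
    phi δ (X.join a b ε h hε) W =
      if Even (decCount X W (strand X W a) + ε.toNat) then δ ^ (loops X W).card * δ else 0 := by
  have h1 : strand X W a ∪ strand X W b = strand X W a := by
    rw [strand_eq_iff.2 hab, Finset.union_self]
  have h2 : ∀ j ∈ strand X W a, (X.join a b ε h hε).σ j ≠ j ∧ W.σ j ≠ j := by
    intro j hj
    refine ⟨fun hj1 => ?_, fun hj1 => hW j hj1 (mem_strand.1 hj)⟩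
    obtain ⟨hj2, hj3, hj4⟩ := join_fixed_iff.1 hj1
    rcases hX j hj2 (mem_strand.1 hj) with h3 | h3
    · exact hj3 h3
    · exact hj4 h3
  have h3 : loops (X.join a b ε h hε) W = insert (strand X W a) (loops X W) := by
    ext C
    rw [mem_loops_join, h1, Finset.mem_insert, or_comm]
    refine or_congr_left ⟨fun h => h.1, ?_⟩
    rintro rfl
    exact ⟨rfl, h2⟩
  have ha : a ∈ strand X W a := mem_strand.2 (Linked.refl a)
  have h4 : strand X W a ∉ loops X W := fun hC =>
    not_linked_of_mem_loops hC ha h.left (Linked.refl a)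
  have h5 : Separated (X.join a b ε h hε) W := by
    intro y y' hy hy' hyy'
    rcases linked_join_iff.1 hyy' with h6 | ⟨h6, -⟩ | ⟨-, h6⟩
    · exact hA.1 y y' hy hy' h6
    · exact absurd h6.symm (hW y hy)
    · exact absurd h6 (hW y' hy')
  have h6 : (∀ C ∈ loops (X.join a b ε h hε) W, Even (decCount (X.join a b ε h hε) W C)) ↔
      Even (decCount X W (strand X W a) + ε.toNat) := by
    rw [h3, Finset.forall_mem_insert, decCount_join_of_mem ha, and_iff_left]
    intro C hC
    rw [decCount_join_of_mem_loops hC]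
    exact hA.2 C hC
  unfold phi
  simp only [h5, true_and, h6]
  rw [h3, Finset.card_insert_of_notMem h4, pow_succ]

/-- Joining a strand with a strand through does not create a loop. -/
lemma phi_join_open (hA : Admissible X W)
    (hab : ((∀ y, W.σ y = y → ¬ Linked X.σ W.σ a y) ∧ ∃ y, W.σ y = y ∧ Linked X.σ W.σ b y) ∨
      ((∀ y, W.σ y = y → ¬ Linked X.σ W.σ b y) ∧ ∃ y, W.σ y = y ∧ Linked X.σ W.σ a y)) :
    phi δ (X.join a b ε h hε) W = δ ^ (loops X W).card := by
  have h3 : loops (X.join a b ε h hε) W = loops X W := by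
    refine Finset.Subset.antisymm (fun C hC => ?_) loops_subset_join
    rcases mem_loops_join.1 hC with hC | ⟨rfl, hC⟩
    · exact hC
    · rcases hab with ⟨-, y, hy, hby⟩ | ⟨-, y, hy, hby⟩
      · exact absurd hy (hC y (Finset.mem_union_right _ (mem_strand.2 hby))).2
      · exact absurd hy (hC y (Finset.mem_union_left _ (mem_strand.2 hby))).2
  rw [phi_of_admissible, h3]
  constructor
  · intro y y' hy hy' hyy'
    rcases linked_join_iff.1 hyy' with h6 | ⟨h6, h7⟩ | ⟨h6, h7⟩
    · exact hA.1 y y' hy hy' h6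
    · rcases hab with ⟨h8, -⟩ | ⟨h8, -⟩
      · exact absurd h6.symm (h8 y hy)
      · exact absurd h7 (h8 y' hy')
    · rcases hab with ⟨h8, -⟩ | ⟨h8, -⟩
      · exact absurd h7 (h8 y' hy')
      · exact absurd h6.symm (h8 y hy)
  · rw [h3]
    intro C hC
    rw [decCount_join_of_mem_loops hC]
    exact hA.2 C hC

/-- Joining two strands through gives zero. -/
lemma phi_join_through {y y' : Fin n} (hy : W.σ y = y) (hy' : W.σ y' = y')
    (hay : Linked X.σ W.σ a y) (hby' : Linked X.σ W.σ b y') :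
    phi δ (X.join a b ε h hε) W = 0 := by
  refine phi_of_not_admissible δ fun hA => ?_
  have h1 := hA.1 y y' hy hy' (linked_join_iff.2 (Or.inr (Or.inl ⟨hay.symm, hby'⟩)))
  subst h1
  exact h.lt.ne ((hay.trans hby'.symm).fixed_unique X.involutive W.involutive h.left h.right hy hay)

end Join

/-- If `W` has two isolated dots less than `X`, there is exactly one strand from `X` to `X`. -/
lemma Separated.exists_strand {X : DecParen n p} {W : DecParen n (p + 1)} (h : Separated X W) :
    ∃ u v, X.Adjacent u v ∧ Linked X.σ W.σ u v ∧
      ∀ x, X.σ x = x → ((∃ y, W.σ y = y ∧ Linked X.σ W.σ x y) ↔ x ≠ u ∧ x ≠ v) := by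
  have h1 := X.card_ends_add
  have h2 := W.card_ends_add
  have hsub : matched X W ⊆ X.ends := fun x hx => mem_ends.2 (mem_matched.1 hx).1
  -- Separation matches the `n - 2 * p - 2` isolated dots of `W` with as many of the `n - 2 * p` of
  -- `X`, leaving two.
  have h3 : (X.ends \ matched X W).card = 2 := by
    rw [Finset.card_sdiff_of_subset hsub, h.card_matched]
    omega
  have h4 : ∃ u v, u < v ∧ X.ends \ matched X W = {u, v} := by
    obtain ⟨u, v, huv, h4⟩ := Finset.card_eq_two.1 h3
    rcases lt_or_gt_of_ne huv with h5 | h5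
    · exact ⟨u, v, h5, h4⟩
    · exact ⟨v, u, h5, by rw [h4, Finset.pair_comm]⟩
  obtain ⟨u, v, huv, h4⟩ := h4
  have h5 : ∀ x, X.σ x = x → ((∃ y, W.σ y = y ∧ Linked X.σ W.σ x y) ↔ x ≠ u ∧ x ≠ v) := by
    intro x hx
    have h6 : x ∈ X.ends \ matched X W ↔ x = u ∨ x = v := by rw [h4]; simp
    simp only [Finset.mem_sdiff, mem_ends, mem_matched, hx, true_and] at h6
    rw [← not_or, ← h6, not_not]
  have hu : X.σ u = u := by
    have : u ∈ X.ends \ matched X W := by rw [h4]; simp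
    exact mem_ends.1 (Finset.mem_sdiff.1 this).1
  have hv : X.σ v = v := by
    have : v ∈ X.ends \ matched X W := by rw [h4]; simp
    exact mem_ends.1 (Finset.mem_sdiff.1 this).1
  have hun : ∀ y, W.σ y = y → ¬ Linked X.σ W.σ u y := fun y hy huy =>
    ((h5 u hu).1 ⟨y, hy, huy⟩).1 rfl
  -- Otherwise the strand of `u` would have one end in `X` and none in `W`, against parity.
  have hl : Linked X.σ W.σ u v := by
    by_contra hl
    have h6 := even_card_fixed_iff (S := X) (T := W) (C := strand X W u) strand_closed_left
      strand_closed_right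
    have h7 : (strand X W u).filter (fun x => W.σ x = x) = ∅ :=
      Finset.filter_false_of_mem fun x hx hx' => hun x hx' (mem_strand.1 hx)
    have h8 : (strand X W u).filter (fun x => X.σ x = x) = {u} := by
      ext x
      simp only [Finset.mem_filter, mem_strand, Finset.mem_singleton]
      constructor
      · rintro ⟨h8, hx⟩
        by_contra hxu
        by_cases hxv : x = v
        · exact hl (hxv ▸ h8)
        · obtain ⟨y, hy, hxy⟩ := (h5 x hx).2 ⟨hxu, hxv⟩
          exact hun y hy (h8.trans hxy)
      · rintro rfl
        exact ⟨Linked.refl _, hu⟩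
    rw [h7, h8] at h6
    simp at h6
  refine ⟨u, v, ⟨hu, hv, huv, fun x hx hx' => ?_⟩, hl, h5⟩
  obtain ⟨y, hy, hxy⟩ := (h5 x hx).2 ⟨hx'.1.ne', hx'.2.ne⟩
  exact not_between_of_linked hu hv hl hx hy hxy hx'.1 hx'.2

end TLD

/-! ### The orthogonal combination of joins -/

namespace TLD

open DecParen

variable {n p m : ℕ}

namespace DecParen

/-- The increasing enumeration of the isolated dots. -/
def iso (S : DecParen n p) (hm : n = 2 * p + m) : Fin m ↪o Fin n :=
  S.ends.orderEmbOfFin (by have := S.card_ends_add; omega)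

variable (S : DecParen n p)

lemma iso_fixed (hm : n = 2 * p + m) (i : Fin m) : S.σ (S.iso hm i) = S.iso hm i :=
  mem_ends.1 (Finset.orderEmbOfFin_mem _ _ _)

lemma exists_iso (hm : n = 2 * p + m) {x : Fin n} (hx : S.σ x = x) : ∃ i, S.iso hm i = x := by
  have : x ∈ Set.range (S.iso hm) := by
    rw [iso, Finset.range_orderEmbOfFin]
    exact mem_ends.2 hx
  exact this

lemma adjacent_iso (hm : n = 2 * p + (m + 1)) (i : Fin m) :
    S.Adjacent (S.iso hm i.castSucc) (S.iso hm i.succ) where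
  left := S.iso_fixed hm _
  right := S.iso_fixed hm _
  lt := (S.iso hm).lt_iff_lt.2 (Fin.castSucc_lt_succ)
  not_between := by
    rintro x hx ⟨h1, h2⟩
    obtain ⟨j, rfl⟩ := S.exists_iso hm hx
    have h3 := (S.iso hm).lt_iff_lt.1 h1
    have h4 := (S.iso hm).lt_iff_lt.1 h2
    simp only [Fin.lt_def, Fin.val_castSucc, Fin.val_succ] at h3 h4
    omega

lemma Adjacent.exists_iso {S : DecParen n p} {u v : Fin n} (h : S.Adjacent u v)
    (hm : n = 2 * p + (m + 1)) :
    ∃ i : Fin m, u = S.iso hm i.castSucc ∧ v = S.iso hm i.succ := by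
  obtain ⟨j, rfl⟩ := S.exists_iso hm h.left
  obtain ⟨k, rfl⟩ := S.exists_iso hm h.right
  have h1 : j < k := (S.iso hm).lt_iff_lt.1 h.lt
  have hjm : j.val < m := by have := k.isLt; have := Fin.lt_def.1 h1; omega
  refine ⟨⟨j, hjm⟩, rfl, ?_⟩
  congr 1
  by_contra h2
  refine h.not_between (S.iso hm (Fin.succ ⟨j, hjm⟩)) (S.iso_fixed hm _)
    ⟨(S.iso hm).lt_iff_lt.2 ?_, (S.iso hm).lt_iff_lt.2 ?_⟩
  · simp [Fin.lt_def]
  · have h3 : k.val ≠ j.val + 1 := fun h3 => h2 (Fin.ext h3)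
    simp only [Fin.lt_def, Fin.val_succ] at h1 ⊢
    omega

lemma iso_le (hm : n = 2 * p + m) {i : Fin m} (hi : i.val = 0) {x : Fin n} (hx : S.σ x = x) :
    S.iso hm i ≤ x := by
  obtain ⟨j, rfl⟩ := S.exists_iso hm hx
  refine (S.iso hm).le_iff_le.2 ?_
  simp [Fin.le_def, hi]

/-- The diagram obtained by joining the isolated dots number `i` and `i + 1`. -/
def joinAt (hm : n = 2 * p + (m + 1)) (i : Fin m) (ε : Bool) (hε : ε = true → i.val = 0) :
    DecParen n (p + 1) :=
  S.join (S.iso hm i.castSucc) (S.iso hm i.succ) ε (S.adjacent_iso hm i) fun h _ hx =>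
    S.iso_le hm (hε h) hx

end DecParen

section

variable {R : Type*} [CommRing R] (δ : R) {X : DecParen n p} {W : DecParen n (p + 1)}

/-- The only strand from `X` to `X` joins the isolated dots number `j` and `j + 1`. -/
def IsGap (X : DecParen n p) (W : DecParen n (p + 1)) (hm : n = 2 * p + (m + 1)) (j : Fin m) :
    Prop :=
  Linked X.σ W.σ (X.iso hm j.castSucc) (X.iso hm j.succ) ∧
    ∀ i, (∃ y, W.σ y = y ∧ Linked X.σ W.σ (X.iso hm i) y) ↔ i ≠ j.castSucc ∧ i ≠ j.succ

lemma Separated.exists_gap (h : Separated X W) (hm : n = 2 * p + (m + 1)) :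
    ∃ j, IsGap X W hm j := by
  obtain ⟨u, v, h1, h2, h3⟩ := h.exists_strand
  obtain ⟨j, rfl, rfl⟩ := h1.exists_iso hm
  refine ⟨j, h2, fun i => ?_⟩
  rw [h3 _ (X.iso_fixed hm i)]
  simp

/-- If the gap is not the first one, the isolated dot number 0 starts a strand through, and no
decoration lies on a strand to its right. -/
lemma IsGap.decCount_eq_zero {hm : n = 2 * p + (m + 1)} {j : Fin m} (hj : IsGap X W hm j)
    (h0 : j.val ≠ 0) : decCount X W (strand X W (X.iso hm j.castSucc)) = 0 := by
  refine TLD.decCount_eq_zero fun d hd hdj => ?_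
  obtain ⟨y, hy, hay⟩ := (hj.2 0).2
    ⟨fun h => h0 (by simpa using (congrArg Fin.val h).symm), (Fin.succ_ne_zero j).symm⟩
  have h1 := le_of_linked_dec (X.iso_fixed hm 0) hy hay (X.iso_fixed hm j.castSucc) hd
    (mem_strand.1 hdj).symm
  have h2 := (X.iso hm).le_iff_le.1 h1
  rw [Fin.le_zero_iff] at h2
  exact h0 (by simpa using congrArg Fin.val h2)

/-- Joining the dots of the gap closes a loop, worth `δ` if it is even and 0 if odd. Joining one of
them to a neighbour only prolongs a strand through. Any other join connects two strands through and
gives 0. -/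
lemma phi_joinAt {hm : n = 2 * p + (m + 1)} {j : Fin m} (hA : Admissible X W)
    (hj : IsGap X W hm j) (i : Fin m) (ε : Bool) (hε : ε = true → i.val = 0) :
    phi δ (X.joinAt hm i ε hε) W = δ ^ (loops X W).card *
      if i = j then
        (if Even (decCount X W (strand X W (X.iso hm j.castSucc)) + ε.toNat) then δ else 0)
      else if i.val + 1 = j ∨ j.val + 1 = i then 1 else 0 := by
  have hun : ∀ k, (k = j.castSucc ∨ k = j.succ) → ∀ y, W.σ y = y →
      ¬ Linked X.σ W.σ (X.iso hm k) y := by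
    intro k hk y hy h
    have := (hj.2 k).1 ⟨y, hy, h⟩
    tauto
  by_cases hij : i = j
  · subst hij
    rw [if_pos rfl, joinAt, phi_join_closed δ hA hj.1 ?_ ?_]
    · rw [mul_ite, mul_zero]
    · intro x hx hlx
      obtain ⟨k, rfl⟩ := X.exists_iso hm hx
      by_contra h
      push Not at h
      obtain ⟨y, hy, hky⟩ := (hj.2 k).2 ⟨fun h' => h.1 (by rw [h']), fun h' => h.2 (by rw [h'])⟩
      exact hun _ (Or.inl rfl) y hy (hlx.trans hky)
    · exact hun _ (Or.inl rfl)
  · rw [if_neg hij]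
    have hij' : i.val ≠ j.val := fun h => hij (Fin.ext h)
    by_cases h1 : i.val + 1 = j ∨ j.val + 1 = i
    · rw [if_pos h1, mul_one, joinAt]
      refine phi_join_open δ hA ?_
      rcases h1 with h1 | h1
      · right
        have h2 : i.succ = j.castSucc := Fin.ext (by simpa using h1)
        refine ⟨hun _ (Or.inl h2), (hj.2 _).2 ⟨fun h => ?_, fun h => ?_⟩⟩
        · exact hij' (by simpa using congrArg Fin.val h)
        · have := congrArg Fin.val h
          simp only [Fin.val_castSucc, Fin.val_succ] at this
          omega
      · left
        have h2 : i.castSucc = j.succ := Fin.ext (by simpa using h1.symm)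
        refine ⟨hun _ (Or.inr h2), (hj.2 _).2 ⟨fun h => ?_, fun h => ?_⟩⟩
        · have := congrArg Fin.val h
          simp only [Fin.val_castSucc, Fin.val_succ] at this
          omega
        · exact hij' (by simpa using congrArg Fin.val h)
    · rw [if_neg h1, mul_zero, joinAt]
      push Not at h1
      obtain ⟨y, hy, h2⟩ := (hj.2 i.castSucc).2 ⟨fun h => hij' (by simpa using congrArg Fin.val h),
        fun h => h1.2 (by simpa using (congrArg Fin.val h).symm)⟩
      obtain ⟨y', hy', h3⟩ := (hj.2 i.succ).2 ⟨fun h => h1.1 (by simpa using congrArg Fin.val h),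
        fun h => hij' (by simpa using congrArg Fin.val h)⟩
      exact phi_join_through δ hy hy' h2 h3

lemma sum_neighbours (w : ℕ → R) {m j : ℕ} (hj : j < m) :
    ∑ i ∈ Finset.range m, w i * (if i = j then δ else if i + 1 = j ∨ j + 1 = i then 1 else 0) =
      w j * δ + (if 0 < j then w (j - 1) else 0) + if j + 1 < m then w (j + 1) else 0 := by
  -- The guard `0 < j` is needed since `j - 1` is truncated: for `j = 0` there is no left neighbour.
  have h1 : ∀ i, w i * (if i = j then δ else if i + 1 = j ∨ j + 1 = i then 1 else 0) =
      (if i = j then w i * δ else 0) + (if i = j - 1 then (if 0 < j then w i else 0) else 0) +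
        if i = j + 1 then w i else 0 := by
    intro i
    by_cases h1 : i = j
    · by_cases h2 : 0 < j
      · have h3 : j ≠ j - 1 := by omega
        simp [h1, h3]
      · simp [h1, h2]
    · by_cases h2 : i + 1 = j
      · have h3 : i = j - 1 := by omega
        have h4 : i ≠ j + 1 := by omega
        have h5 : 0 < j := by omega
        rw [if_neg h1, if_pos (Or.inl h2), if_neg h1, if_pos h3, if_pos h5, if_neg h4]
        ring
      · by_cases h3 : j + 1 = i
        · have h4 : i ≠ j - 1 := by omega
          rw [if_neg h1, if_pos (Or.inr h3), if_neg h1, if_neg h4, if_pos h3.symm]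
          ring
        · by_cases h4 : i = j - 1
          · have h5 : ¬ 0 < j := by omega
            have h6 : i ≠ j + 1 := by omega
            simp [h1, h2, h3, h5, h6]
          · have h6 : i ≠ j + 1 := by omega
            simp [h1, h2, h3, h4, h6]
  simp only [h1, Finset.sum_add_distrib, Finset.sum_ite_eq', Finset.mem_range]
  have h2 : j - 1 < m := by omega
  simp [hj, h2]

/-- The linear combination of the joins of `X` that is orthogonal to the diagrams `W` in which the
last isolated dot of `X` is not connected to the previous one. -/
lemma sum_phi_joinAt (w : ℕ → R) (hw0 : w 0 * δ + w 1 = 0) (hw1 : w 1 * δ + 2 * w 0 + w 2 = 0)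
    (hw : ∀ j, 2 ≤ j → w j * δ + w (j - 1) + w (j + 1) = 0) (hm : n = 2 * p + (m + 1))
    (hm2 : 2 ≤ m) {j : Fin m} (hA : Admissible X W) (hj : IsGap X W hm j) :
    ∑ i : Fin m, w i * phi δ (X.joinAt hm i false (by simp)) W +
      w 0 * phi δ (X.joinAt hm ⟨0, by omega⟩ true (by simp)) W =
      if j.val + 1 = m then - w m * δ ^ (loops X W).card else 0 := by
  have hsum : ∀ c : R, ∑ i : Fin m, w i * (if i = j then c else
      if i.val + 1 = j ∨ j.val + 1 = i then 1 else 0) =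
      w j * c + (if 0 < j.val then w (j - 1) else 0) + if j.val + 1 < m then w (j + 1) else 0 := by
    intro c
    rw [← sum_neighbours c w j.isLt, ← Fin.sum_univ_eq_sum_range (fun i => w i *
      (if i = j.val then c else if i + 1 = j ∨ j.val + 1 = i then 1 else 0)) m]
    simp only [Fin.ext_iff]
  simp only [phi_joinAt δ hA hj]
  set z := δ ^ (loops X W).card
  have hz : ∀ c : R, ∑ i : Fin m, w i * (z * (if i = j then c else
      if i.val + 1 = j ∨ j.val + 1 = i then 1 else 0)) = z * ∑ i : Fin m, w i * (if i = j then c else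
      if i.val + 1 = j ∨ j.val + 1 = i then 1 else 0) := fun c => by
    rw [Finset.mul_sum]
    exact Finset.sum_congr rfl fun i _ => by ring
  rw [hz, hsum]
  -- At the end of the fork exactly one of the two joins at 0 closes an even loop, so `w 0 * δ`
  -- occurs once.
  by_cases h0 : j.val = 0
  · have h1 : (⟨0, by omega⟩ : Fin m) = j := Fin.ext h0.symm
    have h2 : ¬ (j.val + 1 = m) := by omega
    have h3 : j.val + 1 < m := by omega
    rw [if_pos h1, if_neg h2, if_pos h3]
    simp only [h0, lt_irrefl, if_false, zero_add, add_zero, Bool.toNat_false, Bool.toNat_true]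
    by_cases he : Even (decCount X W (strand X W (X.iso hm j.castSucc)))
    · have he' : ¬ Even (decCount X W (strand X W (X.iso hm j.castSucc)) + 1) := by
        rwa [Nat.even_add_one, not_not]
      rw [if_pos he, if_neg he']
      linear_combination z * hw0
    · have he' : Even (decCount X W (strand X W (X.iso hm j.castSucc)) + 1) := by
        rwa [Nat.even_add_one]
      rw [if_neg he, if_pos he']
      linear_combination z * hw0
  · have h1 : ¬ ((⟨0, by omega⟩ : Fin m) = j) := fun h => h0 (congrArg Fin.val h).symm
    rw [if_neg h1, hj.decCount_eq_zero h0, if_pos (by simp), if_pos (by omega : 0 < j.val)]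
    have h2 : ¬ (j.val + 1 = 0) := by omega
    -- At the branching node both joins at 0 are neighbours, whence `2 * w 0`.
    by_cases hj1 : j.val = 1
    · rw [if_pos (Or.inl (by simp [hj1]))]
      simp only [hj1]
      by_cases h3 : 1 + 1 < m
      · have h4 : ¬ (1 + 1 = m) := by omega
        rw [if_pos h3, if_neg h4]
        linear_combination z * hw1
      · have h4 : m = 2 := by omega
        subst h4
        norm_num
        linear_combination z * hw1
    · have h3 : ¬ (0 + 1 = j.val ∨ j.val + 1 = 0) := by omega
      rw [if_neg h3]
      have h5 := hw j (by omega)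
      -- In the last row the neighbour of weight `w m` is missing, and the recurrence leaves `- w
      -- m`.
      by_cases h4 : j.val + 1 = m
      · have h6 : ¬ (j.val + 1 < m) := by omega
        rw [if_pos h4, if_neg h6]
        rw [h4] at h5
        linear_combination z * h5
      · have h6 : j.val + 1 < m := by omega
        rw [if_neg h4, if_pos h6]
        linear_combination z * h5

end

end TLD

/-! ### Decomposition of diagrams by their last dot -/

namespace TLD

open DecParen

variable {n p q k : ℕ}

lemma DecParen.addDot_injective :
    Function.Injective (DecParen.addDot : DecParen n p → DecParen (n + 1) p) := by
  intro S T h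
  refine DecParen.ext (funext fun i => ?_) ?_
  · have := congrFun (congrArg DecParen.σ h) i.castSucc
    simpa using this
  · have h1 := congrArg DecParen.D h
    exact Finset.map_injective _ h1

/-- A diagram in which the last dot is isolated comes from a smaller diagram. -/
lemma DecParen.exists_addDot (S : DecParen (n + 1) p) (h : S.σ (Fin.last n) = Fin.last n) :
    ∃ T : DecParen n p, T.addDot = S := by
  have hne : ∀ i : Fin n, S.σ i.castSucc ≠ Fin.last n := by
    intro i hi
    rw [← h] at hi
    exact (Fin.castSucc_lt_last i).ne (S.involutive.injective hi)
  choose τ hτ using fun i => Fin.exists_castSucc_eq.2 (hne i)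
  have hfix : ∀ i, τ i = i ↔ S.σ i.castSucc = i.castSucc := fun i => by
    rw [← hτ, Fin.castSucc_inj]
  have hlast : ∀ d ∈ S.D, d.1 ≠ Fin.last n ∧ d.2 ≠ Fin.last n := by
    intro d hd
    have h1 := S.dec_pair d hd
    have h2 := S.dec_isolated d hd _ h
    exact ⟨(h1.1.trans h2).ne, h2.ne⟩
  let T : DecParen n p :=
    { σ := τ
      D := Finset.univ.filter fun d => (d.1.castSucc, d.2.castSucc) ∈ S.D
      invol := fun i => by
        rw [← Fin.castSucc_inj, hτ, hτ, S.invol]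
      isolated_outside := fun i j k hij hjk hj hik =>
        S.isolated_outside i.castSucc j.castSucc k.castSucc (by simpa) (by simpa) ((hfix j).1 hj)
          (by rw [← hτ, hik])
      noncrossing := fun i j k l hij hjk hkl h =>
        S.noncrossing i.castSucc j.castSucc k.castSucc l.castSucc (by simpa) (by simpa) (by simpa)
          (by rw [← hτ, ← hτ, h.1, h.2]; exact ⟨rfl, rfl⟩)
      card_paired := by
        rw [← S.card_paired, ← Finset.card_map Fin.castSuccEmb]
        congr 1
        ext i
        induction i using Fin.lastCases with
        | last => simp [h]
        | cast i => simp [hfix]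
      dec_pair := fun d hd => by
        have h1 := S.dec_pair _ (Finset.mem_filter.1 hd).2
        refine ⟨by simpa using h1.1, ?_⟩
        rw [← Fin.castSucc_inj, hτ]
        exact h1.2
      dec_isolated := fun d hd i hi => by
        have h1 := S.dec_isolated _ (Finset.mem_filter.1 hd).2 i.castSucc ((hfix i).1 hi)
        simpa using h1
      dec_outer := fun d hd i hi => by
        have h1 := S.dec_outer _ (Finset.mem_filter.1 hd).2 i.castSucc (by simpa using hi)
        rw [← hτ] at h1
        simpa using h1 }
  refine ⟨T, DecParen.ext (funext fun i => ?_) (Finset.ext fun d => ?_)⟩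
  · induction i using Fin.lastCases with
    | last => rw [addDot_last, h]
    | cast i => rw [addDot_castSucc, ← hτ]
  · obtain ⟨x, y⟩ := d
    change (x, y) ∈ T.D.map (Fin.castSuccEmb.prodMap Fin.castSuccEmb) ↔ _
    simp only [Finset.mem_map, T, Finset.mem_filter, Finset.mem_univ, true_and]
    constructor
    · rintro ⟨d, hd, h1⟩
      simp only [Function.Embedding.coe_prodMap, Fin.coe_castSuccEmb, Prod.map, Prod.mk.injEq] at h1
      rwa [← h1.1, ← h1.2]
    · intro h1
      obtain ⟨h2, h3⟩ := hlast _ h1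
      obtain ⟨x, rfl⟩ := Fin.exists_castSucc_eq.2 h2
      obtain ⟨y, rfl⟩ := Fin.exists_castSucc_eq.2 h3
      exact ⟨(x, y), h1, rfl⟩

/-- Cutting the pair that contains the last dot. -/
lemma DecParen.exists_join (W : DecParen (n + 1) (p + 1))
    (hW : W.σ (Fin.last n) ≠ Fin.last n) :
    ∃ (Y : DecParen (n + 1) p) (ε : Bool) (b : Fin (n + 1)) (h : Y.Adjacent b (Fin.last n))
      (hε : ε = true → ∀ x, Y.σ x = x → b ≤ x), Y.join b (Fin.last n) ε h hε = W := by
  classical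
  set b := W.σ (Fin.last n) with hb
  have hb' : W.σ b = Fin.last n := W.invol _
  have hblt : b < Fin.last n := lt_of_le_of_ne (Fin.le_last _) hW
  have hne : ∀ i, i ≠ b → i ≠ Fin.last n → W.σ i ≠ b ∧ W.σ i ≠ Fin.last n := by
    intro i h1 h2
    refine ⟨fun h => h2 (W.involutive.injective (h.trans hb)), fun h => h1 ?_⟩
    exact W.involutive.injective (h.trans hb'.symm)
  -- A decorated pair neither crosses the pair `(b, Fin.last n)` nor lies beneath it.
  have hdec : ∀ d ∈ W.D, d ≠ (b, Fin.last n) → d.2 < b := by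
    intro d hd hdb
    obtain ⟨h1, h2⟩ := W.dec_pair d hd
    have h3 : d.1 ≠ b := fun h => hdb (Prod.ext h (by rw [← h2, h, hb']))
    have h4 : d.2 ≠ Fin.last n := fun h => h3 (by rw [← W.invol d.1, h2, h])
    have h5 : d.2 ≠ b := fun h => (h1.trans_le (Fin.le_last _)).ne (by rw [← W.invol d.1, h2, h, hb'])
    have h6 : d.2 < Fin.last n := lt_of_le_of_ne (Fin.le_last _) h4
    rcases lt_or_gt_of_ne h3 with h7 | h7
    · rcases lt_or_gt_of_ne h5 with h8 | h8
      · exact h8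
      · exact absurd ⟨h2, hb'⟩ (W.noncrossing _ _ _ _ h7 h8 h6)
    · exact absurd h6 (by rw [← hb']; exact W.dec_outer d hd b h7)
  let Y : DecParen (n + 1) p :=
    { σ := fun i => if i = b then b else if i = Fin.last n then Fin.last n else W.σ i
      D := W.D.erase (b, Fin.last n)
      invol := fun i => by
        by_cases h1 : i = b
        · simp [h1]
        by_cases h2 : i = Fin.last n
        · simp [h2, hblt.ne']
        obtain ⟨h3, h4⟩ := hne i h1 h2
        simp [h1, h2, h3, h4, W.invol]
      isolated_outside := fun i j k hij hjk hj hik => by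
        by_cases h1 : i = b
        · simp only [h1, if_true] at hik
          exact (hij.trans hjk).ne (h1.trans hik)
        by_cases h2 : i = Fin.last n
        · exact absurd hij (by rw [h2]; exact (Fin.le_last j).not_gt)
        simp only [h1, h2, if_false] at hik
        by_cases h3 : j = b
        · have h4 : k ≠ Fin.last n := fun h => (hne i h1 h2).2 (hik.trans h)
          exact W.noncrossing i j k (Fin.last n) hij hjk (lt_of_le_of_ne (Fin.le_last _) h4)
            ⟨hik, h3 ▸ hb'⟩
        by_cases h4 : j = Fin.last n
        · exact absurd hjk (by rw [h4]; exact (Fin.le_last k).not_gt)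
        simp only [h3, h4, if_false] at hj
        exact W.isolated_outside i j k hij hjk hj hik
      noncrossing := fun i j k l hij hjk hkl h => by
        obtain ⟨hik, hjl⟩ := h
        by_cases h1 : i = b
        · simp only [h1, if_true] at hik
          exact (hij.trans hjk).ne (h1.trans hik)
        by_cases h2 : i = Fin.last n
        · exact absurd hij (by rw [h2]; exact (Fin.le_last j).not_gt)
        by_cases h3 : j = b
        · simp only [h3, if_true] at hjl
          exact (hjk.trans hkl).ne (h3.trans hjl)
        by_cases h4 : j = Fin.last n
        · exact absurd hjk (by rw [h4]; exact (Fin.le_last k).not_gt)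
        simp only [h1, h2, h3, h4, if_false] at hik hjl
        exact W.noncrossing i j k l hij hjk hkl ⟨hik, hjl⟩
      card_paired := by
        have h1 := W.card_paired
        have h2 : (Finset.univ.filter fun i => W.σ i ≠ i) = insert b (insert (Fin.last n)
            (Finset.univ.filter fun i =>
              (if i = b then b else if i = Fin.last n then Fin.last n else W.σ i) ≠ i)) := by
          ext i
          simp only [Finset.mem_filter, Finset.mem_univ, true_and, Finset.mem_insert]
          by_cases h1 : i = b
          · simp only [h1, true_or, iff_true, hb']
            exact hblt.ne'
          by_cases h2 : i = Fin.last n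
          · simp only [h2, true_or, or_true, iff_true]
            exact hW
          simp [h1, h2]
        rw [h2, Finset.card_insert_of_notMem, Finset.card_insert_of_notMem] at h1
        · omega
        · simp [hblt.ne']
        · simp [hblt.ne]
      dec_pair := fun d hd => by
        obtain ⟨hd1, hd2⟩ := Finset.mem_erase.1 hd
        obtain ⟨h1, h2⟩ := W.dec_pair d hd2
        have h3 := hdec d hd2 hd1
        refine ⟨h1, ?_⟩
        rw [if_neg (h1.trans h3).ne, if_neg (h1.trans_le (Fin.le_last _)).ne, h2]
      dec_isolated := fun d hd k hk => by
        obtain ⟨hd1, hd2⟩ := Finset.mem_erase.1 hd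
        have h3 := hdec d hd2 hd1
        by_cases h1 : k = b
        · rwa [h1]
        by_cases h2 : k = Fin.last n
        · rw [h2]
          exact h3.trans hblt
        simp only [h1, h2, if_false] at hk
        exact W.dec_isolated d hd2 k hk
      dec_outer := fun d hd i hi => by
        obtain ⟨hd1, hd2⟩ := Finset.mem_erase.1 hd
        have h3 := hdec d hd2 hd1
        have h4 := hi.trans ((W.dec_pair d hd2).1.trans h3)
        rw [if_neg h4.ne, if_neg (h4.trans hblt).ne]
        exact W.dec_outer d hd2 i hi }
  have hYb : Y.σ b = b := by simp [Y]
  have hYl : Y.σ (Fin.last n) = Fin.last n := by simp [Y, hblt.ne']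
  have hYne : ∀ i, i ≠ b → i ≠ Fin.last n → Y.σ i = W.σ i := by
    intro i h1 h2
    simp [Y, h1, h2]
  have hadj : Y.Adjacent b (Fin.last n) := ⟨hYb, hYl, hblt, fun x hx h => by
    rw [hYne x h.1.ne' h.2.ne] at hx
    exact W.isolated_outside b x _ h.1 h.2 hx hb'⟩
  -- If this pair is decorated, `W` has no isolated dot, since one would have to lie to the right of
  -- the last dot.
  have hε : decide ((b, Fin.last n) ∈ W.D) = true → ∀ x, Y.σ x = x → b ≤ x := by
    intro h x hx
    by_cases h1 : x = b
    · exact h1.ge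
    by_cases h2 : x = Fin.last n
    · exact h2 ▸ hblt.le
    rw [hYne x h1 h2] at hx
    have h3 := W.dec_isolated _ (of_decide_eq_true h) x hx
    exact absurd h3 (Fin.le_last x).not_gt
  refine ⟨Y, decide ((b, Fin.last n) ∈ W.D), b, hadj, hε, DecParen.ext (funext fun i => ?_) ?_⟩
  · by_cases h1 : i = b
    · rw [h1, join_left, hb']
    by_cases h2 : i = Fin.last n
    · rw [h2, join_right]
    rw [join_of_ne h1 h2, hYne i h1 h2]
  · by_cases h : (b, Fin.last n) ∈ W.D
    · simp [DecParen.join, h, Y]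
    · simp [DecParen.join, h, Y]

section Join

variable {X : DecParen n p} {a b : Fin n} {ε : Bool} {h : X.Adjacent a b}
  {hε : ε = true → ∀ x, X.σ x = x → a ≤ x}

lemma join_dec_erase : (X.join a b ε h hε).D.erase (a, b) = X.D := by
  have h1 : (a, b) ∉ X.D := fun h' => fst_ne_of_mem_dec h' h.left rfl
  cases ε <;> simp [DecParen.join, h1]

lemma mem_join_dec : (a, b) ∈ (X.join a b ε h hε).D ↔ ε = true := by
  have h1 : (a, b) ∉ X.D := fun h' => fst_ne_of_mem_dec h' h.left rfl
  cases ε <;> simp [DecParen.join, h1]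

lemma join_injective {X' : DecParen n p} {a' : Fin n} {ε' : Bool} {h' : X'.Adjacent a' b}
    {hε' : ε' = true → ∀ x, X'.σ x = x → a' ≤ x}
    (heq : X.join a b ε h hε = X'.join a' b ε' h' hε') : X = X' ∧ ε = ε' := by
  have ha : a = a' := by
    rw [← join_right (h := h) (hε := hε), heq, join_right]
  subst ha
  refine ⟨DecParen.ext (funext fun i => ?_) ?_, ?_⟩
  · by_cases h1 : i = a
    · rw [h1, h.left, h'.left]
    by_cases h2 : i = b
    · rw [h2, h.right, h'.right]
    rw [← join_of_ne (h := h) (hε := hε) h1 h2, heq, join_of_ne h1 h2]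
  · rw [← join_dec_erase (h := h) (hε := hε), heq, join_dec_erase]
  · have h1 := mem_join_dec (h := h) (hε := hε)
    rw [heq, mem_join_dec] at h1
    exact (Bool.eq_iff_iff.2 h1).symm

end Join

lemma DecParen.iso_last (X : DecParen (n + 1) p) (hX : X.σ (Fin.last n) = Fin.last n)
    (hm : n + 1 = 2 * p + (k + 1)) : X.iso hm (Fin.last k) = Fin.last n := by
  obtain ⟨i, hi⟩ := X.exists_iso hm hX
  refine le_antisymm (Fin.le_last _) ?_
  rw [← hi]
  exact (X.iso hm).le_iff_le.2 (Fin.le_last i)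

/-- The diagram obtained by joining the last isolated dot with a new dot on the right. -/
def DecParen.close (T : DecParen n p) (hk : n + 1 = 2 * p + (k + 1 + 1)) (ε : Bool)
    (hε : ε = true → k = 0) : DecParen (n + 1) (p + 1) :=
  T.addDot.joinAt hk (Fin.last k) ε fun h => by simp [hε h]

lemma DecParen.exists_close (W : DecParen (n + 1) (p + 1))
    (hk : n + 1 = 2 * p + (k + 1 + 1)) (hW : W.σ (Fin.last n) ≠ Fin.last n) :
    ∃ (T : DecParen n p) (ε : Bool) (hε : ε = true → k = 0), T.close hk ε hε = W := by
  obtain ⟨Y, ε, b, h, hε, rfl⟩ := W.exists_join hW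
  obtain ⟨T, rfl⟩ := Y.exists_addDot h.right
  obtain ⟨i, hi1, hi2⟩ := h.exists_iso hk
  have h1 : i.succ = Fin.last (k + 1) := by
    refine (T.addDot.iso hk).injective ?_
    rw [← hi2, T.addDot.iso_last T.addDot_last]
  have h2 : i = Fin.last k := Fin.succ_injective _ h1
  subst h2
  refine ⟨T, ε, fun h3 => ?_, ?_⟩
  · have h4 := hε h3 _ (T.addDot.iso_fixed hk 0)
    rw [hi1] at h4
    have h5 := (T.addDot.iso hk).le_iff_le.1 h4
    simpa [Fin.le_def] using h5
  · subst hi1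
    unfold DecParen.close DecParen.joinAt
    congr 1
    exact hi2.symm

lemma DecParen.close_eq_join (T : DecParen n p) (hk : n + 1 = 2 * p + (k + 1 + 1)) (ε : Bool)
    (hε : ε = true → k = 0) :
    ∃ (h : T.addDot.Adjacent (T.addDot.iso hk (Fin.last k).castSucc) (Fin.last n))
      (hε' : ε = true → ∀ x, T.addDot.σ x = x → T.addDot.iso hk (Fin.last k).castSucc ≤ x),
      T.close hk ε hε = T.addDot.join _ (Fin.last n) ε h hε' := by
  have key : ∀ b, T.addDot.iso hk (Fin.last k).succ = b →
      ∃ (h : T.addDot.Adjacent (T.addDot.iso hk (Fin.last k).castSucc) b)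
        (hε' : ε = true → ∀ x, T.addDot.σ x = x → T.addDot.iso hk (Fin.last k).castSucc ≤ x),
        T.close hk ε hε = T.addDot.join _ b ε h hε' := by
    rintro _ rfl
    exact ⟨T.addDot.adjacent_iso hk (Fin.last k),
      fun h _ hx => T.addDot.iso_le hk (by simp [hε h]) hx, rfl⟩
  refine key _ ?_
  rw [Fin.succ_last, T.addDot.iso_last T.addDot_last]

lemma DecParen.close_injective {T T' : DecParen n p} {hk : n + 1 = 2 * p + (k + 1 + 1)}
    {ε ε' : Bool} {hε : ε = true → k = 0} {hε' : ε' = true → k = 0}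
    (h : T.close hk ε hε = T'.close hk ε' hε') : T = T' ∧ ε = ε' := by
  obtain ⟨h1, h2, h3⟩ := T.close_eq_join hk ε hε
  obtain ⟨h1', h2', h3'⟩ := T'.close_eq_join hk ε' hε'
  rw [h3, h3'] at h
  obtain ⟨h4, h5⟩ := join_injective h
  exact ⟨addDot_injective h4, h5⟩

lemma DecParen.close_last_ne (T : DecParen n p) (hk : n + 1 = 2 * p + (k + 1 + 1)) (ε : Bool)
    (hε : ε = true → k = 0) : (T.close hk ε hε).σ (Fin.last n) ≠ Fin.last n := by
  obtain ⟨h1, h2, h3⟩ := T.close_eq_join hk ε hε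
  rw [h3, join_right]
  exact h1.lt.ne

/-- A diagram with an isolated dot either ends with an isolated dot or with a pair. -/
noncomputable def splitEquiv (hk : n + 1 = 2 * p + (k + 1 + 1)) (hk0 : k ≠ 0) :
    DecParen n (p + 1) ⊕ DecParen n p ≃ DecParen (n + 1) (p + 1) :=
  Equiv.ofBijective (Sum.elim addDot fun T => T.close hk false (by simp)) <| by
    constructor
    · rintro (S | T) (S' | T') h
      · exact congrArg _ (addDot_injective h)
      · refine absurd S.addDot_last ?_
        have h' : S.addDot = T'.close hk false (by simp) := h
        rw [h']
        exact T'.close_last_ne hk _ _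
      · refine absurd S'.addDot_last ?_
        have h' : T.close hk false (by simp) = S'.addDot := h
        rw [← h']
        exact T.close_last_ne hk _ _
      · have h' : T.close hk false (by simp) = T'.close hk false (by simp) := h
        exact congrArg _ (close_injective h').1
    · intro W
      by_cases hW : W.σ (Fin.last n) = Fin.last n
      · obtain ⟨S, rfl⟩ := W.exists_addDot hW
        exact ⟨Sum.inl S, rfl⟩
      · obtain ⟨T, ε, hε, rfl⟩ := W.exists_close hk hW
        have h1 : ε = false := by
          cases ε with
          | false => rfl
          | true => exact absurd (hε rfl) hk0
        subst h1
        exact ⟨Sum.inr T, rfl⟩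

/-- A diagram without isolated dots ends with a pair. -/
noncomputable def closeEquiv (hk : n + 1 = 2 * p + (0 + 1 + 1)) :
    DecParen n p × Bool ≃ DecParen (n + 1) (p + 1) :=
  Equiv.ofBijective
    -- The twist by `xor` makes the Boolean coordinate the parity of all decorations of the closed
    -- diagram, so that the Gram matrix becomes block diagonal.
    (fun x => x.1.close hk (xor x.2 (decide (Odd x.1.D.card))) fun _ => rfl) <| by
    constructor
    · rintro ⟨T, ε⟩ ⟨T', ε'⟩ h
      obtain ⟨h1, h2⟩ := close_injective h
      dsimp only at h1 h2
      subst h1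
      simpa using h2
    · intro W
      have hW : W.σ (Fin.last n) ≠ Fin.last n := by
        intro h
        have h1 := W.card_ends_add
        have h2 : W.ends.card = 0 := by omega
        rw [Finset.card_eq_zero] at h2
        have h3 := mem_ends.2 h
        rw [h2] at h3
        simp at h3
      obtain ⟨T, ε, hε, rfl⟩ := W.exists_close hk hW
      refine ⟨(T, xor ε (decide (Odd T.D.card))), ?_⟩
      simp

end TLD

/-! ### The form on closed diagrams -/

namespace TLD

open DecParen

variable {n p q k : ℕ}

section Comm

variable {S : DecParen n p} {T : DecParen n q}

lemma loops_comm : loops S T = loops T S := by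
  ext C
  simp only [mem_loops, strand_comm (S := S) (T := T), and_comm]

lemma decCount_comm (C : Finset (Fin n)) : decCount S T C = decCount T S C := add_comm _ _

lemma admissible_addDot : Admissible S.addDot T.addDot ↔ Admissible S T := by
  unfold Admissible
  rw [separated_addDot, loops_addDot]
  refine and_congr_right fun _ => ?_
  simp [decCount_addDot]

end Comm

section JoinRight

variable {X : DecParen n p} {Y : DecParen n q} {a b : Fin n} {ε : Bool} {h : Y.Adjacent a b}
  {hε : ε = true → ∀ x, Y.σ x = x → a ≤ x}

lemma linked_join_right_iff {i j : Fin n} :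
    Linked X.σ (Y.join a b ε h hε).σ i j ↔ Linked X.σ Y.σ i j ∨
      (Linked X.σ Y.σ i a ∧ Linked X.σ Y.σ b j) ∨ (Linked X.σ Y.σ i b ∧ Linked X.σ Y.σ a j) := by
  rw [Linked.comm, linked_join_iff]
  simp only [Linked.comm (σ := X.σ)]

/-- The dot `b` remains isolated in `X`, so the merged component is not a loop. -/
lemma loops_join_right (hb : X.σ b = b) : loops X (Y.join a b ε h hε) = loops X Y := by
  rw [loops_comm, loops_comm (S := X)]
  refine Finset.Subset.antisymm (fun C hC => ?_) loops_subset_join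
  rcases mem_loops_join.1 hC with hC | ⟨rfl, hC⟩
  · exact hC
  · exact absurd hb (hC b (Finset.mem_union_right _ (mem_strand.2 (Linked.refl b)))).2

lemma decCount_join_right {C : Finset (Fin n)} (hC : C ∈ loops X Y) :
    decCount X (Y.join a b ε h hε) C = decCount X Y C := by
  rw [decCount_comm, decCount_comm (S := X)]
  exact decCount_join_of_mem_loops (loops_comm (S := X) ▸ hC)

lemma card_join_dec : (Y.join a b ε h hε).D.card = Y.D.card + ε.toNat := by
  have h1 := decCount_join_of_mem (h := h) (hε := hε) (W := Y) (Finset.mem_univ a)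
  simp only [decCount, Finset.mem_univ, Finset.filter_true] at h1
  omega

end JoinRight

variable {T U : DecParen n p} {hk : n + 1 = 2 * p + (k + 1 + 1)} {ε : Bool}
  {hε : ε = true → k = 0}

lemma IsGap.unique {m : ℕ} {X : DecParen n p} {W : DecParen n (p + 1)}
    {hm : n = 2 * p + (m + 1)} {i j : Fin m} (hi : IsGap X W hm i) (hj : IsGap X W hm j) :
    i = j := by
  have h1 := (hi.2 i.castSucc).symm.trans (hj.2 i.castSucc)
  have h2 := (hi.2 i.succ).symm.trans (hj.2 i.succ)
  simp only [ne_eq, not_true_eq_false, false_and, and_false, false_iff, not_and, not_not,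
    Fin.ext_iff, Fin.val_castSucc, Fin.val_succ] at h1 h2
  refine Fin.ext ?_
  omega

lemma loops_close : (loops T.addDot (U.close hk ε hε)).card = (loops T U).card := by
  obtain ⟨h1, h2, h3⟩ := U.close_eq_join hk ε hε
  rw [h3, loops_join_right T.addDot_last, loops_addDot, Finset.card_map]

/-- In `T.addDot` and `U.addDot` the last dot is a strand by itself. Closing `U` attaches it to the
strand of the last isolated dot of `U`, which then returns to the last dot of `T.addDot`. The two
ends of this strand in `T.addDot` are consecutive, so they form the last gap; undoing the join gives
the converse. -/
lemma admissible_iff_close : Admissible T U ↔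
    Admissible T.addDot (U.close hk ε hε) ∧ IsGap T.addDot (U.close hk ε hε) hk (Fin.last k) := by
  have hlastX : T.addDot.iso hk (Fin.last k).succ = Fin.last n := by
    rw [Fin.succ_last, T.addDot.iso_last T.addDot_last]
  have hlt : ∀ {i}, i ≠ Fin.last (k + 1) → T.addDot.iso hk i ≠ Fin.last n := by
    intro i hi h
    rw [← hlastX] at h
    exact hi ((T.addDot.iso hk).injective h)
  have hkl : (Fin.last k).castSucc ≠ Fin.last (k + 1) := (Fin.castSucc_lt_last _).ne
  obtain ⟨h1, h2, h3⟩ := U.close_eq_join hk ε hε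
  rw [h3]
  set b := U.addDot.iso hk (Fin.last k).castSucc
  set X := T.addDot
  set Y := U.addDot
  have hlast : ∀ {x}, Linked X.σ Y.σ (Fin.last n) x ↔ x = Fin.last n :=
    linked_last_iff T.addDot_last U.addDot_last
  have hlast' : ∀ {x}, Linked X.σ Y.σ x (Fin.last n) ↔ x = Fin.last n :=
    ⟨fun h => hlast.1 h.symm, fun h => (hlast.2 h).symm⟩
  have heven : (∀ C ∈ loops X (Y.join b (Fin.last n) ε h1 h2),
      Even (decCount X (Y.join b (Fin.last n) ε h1 h2) C)) ↔
      ∀ C ∈ loops X Y, Even (decCount X Y C) := by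
    rw [loops_join_right T.addDot_last]
    exact forall₂_congr fun C hC => by rw [decCount_join_right hC]
  rw [← admissible_addDot]
  unfold Admissible
  rw [heven, and_right_comm]
  refine and_congr_left fun _ => ?_
  constructor
  · intro hs
    have hsW : Separated X (Y.join b (Fin.last n) ε h1 h2) := by
      intro y y' hy hy' hyy'
      obtain ⟨hy1, hy2, hy3⟩ := join_fixed_iff.1 hy
      obtain ⟨hy1', hy2', hy3'⟩ := join_fixed_iff.1 hy'
      rcases linked_join_right_iff.1 hyy' with h4 | ⟨-, h4⟩ | ⟨h4, -⟩
      · exact hs y y' hy1 hy1' h4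
      · exact absurd (hlast.1 h4) hy3'
      · exact absurd (hlast'.1 h4) hy3
    refine ⟨hsW, ?_⟩
    obtain ⟨j, hj⟩ := hsW.exists_gap hk
    obtain ⟨a', ha', hab⟩ := hs.exists_linked h1.left
    obtain ⟨i, rfl⟩ := X.exists_iso hk ha'
    have hlX : X.σ (Fin.last n) = Fin.last n := T.addDot_last
    have hi : i ≠ Fin.last (k + 1) := by
      rintro rfl
      rw [show X.iso hk (Fin.last (k + 1)) = Fin.last n from hlastX] at hab
      exact h1.lt.ne (hlast.1 hab)
    have hun : ¬ ∃ y, (Y.join b (Fin.last n) ε h1 h2).σ y = y ∧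
        Linked X.σ (Y.join b (Fin.last n) ε h1 h2).σ (X.iso hk (Fin.last k).succ) y := by
      rintro ⟨y, hy, hly⟩
      rw [hlastX] at hly
      have h4 : Linked X.σ (Y.join b (Fin.last n) ε h1 h2).σ (Fin.last n) (X.iso hk i) :=
        linked_join_right_iff.2 (Or.inr (Or.inr ⟨Linked.refl _, hab.symm⟩))
      exact hlt hi (h4.fixed_unique X.involutive (DecParen.involutive _) hlX ha' hy hly).symm
    rw [hj.2] at hun
    have h5 : Fin.last k = j := by
      refine Fin.ext ?_
      simp only [ne_eq, Fin.ext_iff, Fin.val_castSucc, Fin.val_succ] at hun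
      have := j.isLt
      simp only [Fin.val_last] at hun ⊢
      omega
    subst h5
    exact hj
  · rintro ⟨hs, hg⟩
    have hab : Linked X.σ Y.σ (X.iso hk (Fin.last k).castSucc) b := by
      have h4 := hg.1
      rw [hlastX] at h4
      rcases linked_join_right_iff.1 h4 with h5 | ⟨h5, -⟩ | ⟨h5, -⟩
      · exact absurd (hlast'.1 h5) (hlt hkl)
      · exact h5
      · exact absurd (hlast'.1 h5) (hlt hkl)
    have hb : ∀ y, Y.σ y = y → Linked X.σ Y.σ b y → b = y := fun y hy h =>
      (Linked.comm.1 h).fixed_unique Y.involutive X.involutive h1.left hy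
        (X.iso_fixed hk (Fin.last k).castSucc) (Linked.comm.1 hab.symm)
    intro y y' hy hy' hyy'
    by_cases h4 : y = Fin.last n
    · subst h4
      exact (hlast.1 hyy').symm
    by_cases h5 : y' = Fin.last n
    · subst h5
      exact hlast'.1 hyy'
    by_cases h6 : y = b
    · subst h6
      exact hb y' hy' hyy'
    by_cases h7 : y' = b
    · subst h7
      exact (hb y hy hyy'.symm).symm
    exact hs y y' (join_fixed_iff.2 ⟨hy, h6, h4⟩) (join_fixed_iff.2 ⟨hy', h7, h5⟩)
      (linked_join_right_iff.2 (Or.inl hyy'))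

section Sum

variable {R : Type*} [CommRing R] (δ : R) (w : ℕ → R)

/-- The last dot is isolated on both sides, hence never belongs to the gap: the exceptional last row
does not occur. -/
lemma sum_phi_addDot
    (hw0 : w 0 * δ + w 1 = 0) (hw1 : w 1 * δ + 2 * w 0 + w 2 = 0)
    (hw : ∀ j, 2 ≤ j → w j * δ + w (j - 1) + w (j + 1) = 0)
    (hk : n + 1 = 2 * p + (k + 1 + 1)) (hk0 : k ≠ 0) (T : DecParen n p)
    (S : DecParen n (p + 1)) :
    ∑ i : Fin (k + 1), w i * phi δ (T.addDot.joinAt hk i false (by simp)) S.addDot +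
      w 0 * phi δ (T.addDot.joinAt hk ⟨0, by omega⟩ true (by simp)) S.addDot = 0 := by
  by_cases hA : Admissible T.addDot S.addDot
  · obtain ⟨j, hj⟩ := hA.1.exists_gap hk
    rw [sum_phi_joinAt δ w hw0 hw1 hw hk (by omega) hA hj, if_neg]
    intro h
    have h1 : j.succ = Fin.last (k + 1) := Fin.ext (by simpa using h)
    have h2 := hj.1
    rw [h1, T.addDot.iso_last T.addDot_last] at h2
    have h3 := (linked_last_iff T.addDot_last S.addDot_last).1 h2.symm
    rw [← T.addDot.iso_last T.addDot_last hk] at h3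
    exact (Fin.castSucc_lt_last j).ne ((T.addDot.iso hk).injective h3)
  · simp [joinAt, phi_join_of_not_admissible δ hA]

/-- The exceptional last row occurs exactly when `T` and `U` are admissible, and closing creates no
loop. -/
lemma sum_phi_close
    (hw0 : w 0 * δ + w 1 = 0) (hw1 : w 1 * δ + 2 * w 0 + w 2 = 0)
    (hw : ∀ j, 2 ≤ j → w j * δ + w (j - 1) + w (j + 1) = 0)
    (hk : n + 1 = 2 * p + (k + 1 + 1)) (hk0 : k ≠ 0) (T U : DecParen n p) :
    ∑ i : Fin (k + 1), w i * phi δ (T.addDot.joinAt hk i false (by simp))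
        (U.close hk false (by simp)) +
      w 0 * phi δ (T.addDot.joinAt hk ⟨0, by omega⟩ true (by simp)) (U.close hk false (by simp)) =
      - w (k + 1) * phi δ T U := by
  have key := admissible_iff_close (T := T) (U := U) (hk := hk) (ε := false) (hε := by simp)
  by_cases hA : Admissible T.addDot (U.close hk false (by simp))
  · obtain ⟨j, hj⟩ := hA.1.exists_gap hk
    rw [sum_phi_joinAt δ w hw0 hw1 hw hk (by omega) hA hj]
    by_cases h : j = Fin.last k
    · have h1 : Admissible T U := key.2 ⟨hA, h ▸ hj⟩
      rw [if_pos (by simp [h]), phi_of_admissible δ h1, loops_close]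
    · have h1 : ¬ Admissible T U := fun h' => h (hj.unique (key.1 h').2)
      rw [if_neg fun h' => h (Fin.ext (by simpa using h')), phi_of_not_admissible δ h1, mul_zero]
  · have h1 : ¬ Admissible T U := fun h => hA (key.1 h).1
    simp [joinAt, phi_join_of_not_admissible δ hA, phi_of_not_admissible δ h1]

end Sum

/-- The form on diagrams without isolated dots. -/
lemma phi_close_close {R : Type*} [CommRing R] (δ : R) (hk : n + 1 = 2 * p + (0 + 1 + 1))
    (T U : DecParen n p) (ε ε' : Bool) :
    phi δ (T.close hk ε fun _ => rfl) (U.close hk ε' fun _ => rfl) =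
      if Even (T.D.card + U.D.card + ε.toNat + ε'.toNat) then δ * phi δ T U else 0 := by
  have key := admissible_iff_close (T := T) (U := U) (hk := hk) (ε := ε') (hε := fun _ => rfl)
  by_cases hA : Admissible T.addDot (U.close hk ε' fun _ => rfl)
  · obtain ⟨j, hj⟩ := hA.1.exists_gap hk
    have hj0 : j = Fin.last 0 := Subsingleton.elim _ _
    subst hj0
    have h1 : (U.close hk ε' fun _ => rfl).D.card = U.D.card + ε'.toNat := by
      obtain ⟨h1, h2, h3⟩ := U.close_eq_join hk ε' fun _ => rfl
      rw [h3, card_join_dec]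
      simp [addDot]
    have h2 : T.addDot.D.card = T.D.card := by simp [addDot]
    have h3 : (U.close hk ε' fun _ => rfl).ends = ∅ := by
      rw [← Finset.card_eq_zero]
      have := (U.close hk ε' fun _ => rfl).card_ends_add
      omega
    -- All components other than the strand in the gap are even loops, so this strand carries the
    -- parity of all decorations.
    have h4 := even_decCount_iff (S := T.addDot) (T := U.close hk ε' fun _ => rfl)
      (a := T.addDot.iso hk (Fin.last 0).castSucc) fun i hi => hA.2 _ (mem_loops.2 ⟨i, rfl, by
        intro x hx
        constructor
        · intro hx1
          obtain ⟨l, rfl⟩ := T.addDot.exists_iso hk hx1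
          refine hi (strand_eq_iff.2 ((mem_strand.1 hx).trans ?_))
          have h5 : l = (Fin.last 0).castSucc ∨ l = (Fin.last 0).succ := by
            have := l.isLt
            simp only [Fin.ext_iff, Fin.val_castSucc, Fin.val_succ, Fin.val_last]
            omega
          rcases h5 with rfl | rfl
          · exact Linked.refl _
          · exact hj.1.symm
        · intro hx1
          have h5 := mem_ends.2 hx1
          rw [h3] at h5
          simp at h5⟩)
    rw [h1, h2] at h4
    rw [phi_of_admissible δ (key.2 ⟨hA, hj⟩), DecParen.close, phi_joinAt δ hA hj, if_pos rfl,
      loops_close, mul_ite, mul_zero, mul_comm]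
    refine if_congr ?_ rfl rfl
    rw [Nat.even_add, ← h4, ← Nat.even_add]
    refine iff_of_eq (congrArg _ ?_)
    ring
  · have h1 : ¬ Admissible T U := fun h => hA (key.1 h).1
    rw [phi_of_not_admissible δ h1, mul_zero, ite_self, DecParen.close, joinAt]
    exact phi_join_of_not_admissible δ hA

end TLD

/-! ### The recursions for the determinant -/

namespace TLD

open DecParen Polynomial

variable {n p k : ℕ}

/-- Elimination in a matrix with two blocks of rows. -/
lemma det_of_elimination {R ι ι₁ ι₂ : Type*} [CommRing R] [Fintype ι] [DecidableEq ι]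
    [Fintype ι₁] [DecidableEq ι₁] [Fintype ι₂] [DecidableEq ι₂] (e : ι₁ ⊕ ι₂ ≃ ι)
    (G : Matrix ι ι R) (A : Matrix ι₁ ι₁ R) (B : Matrix ι₂ ι₂ R) (c d : R) (l : ι₂ → ι₁ → R)
    (hA : ∀ s s', G (e (Sum.inl s)) (e (Sum.inl s')) = A s s')
    (h0 : ∀ t s', ∑ s, l t s * G (e (Sum.inl s)) (e (Sum.inl s')) +
      c * G (e (Sum.inr t)) (e (Sum.inl s')) = 0)
    (hB : ∀ t u, ∑ s, l t s * G (e (Sum.inl s)) (e (Sum.inr u)) +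
      c * G (e (Sum.inr t)) (e (Sum.inr u)) = d * B t u) :
    c ^ Fintype.card ι₂ * G.det = d ^ Fintype.card ι₂ * A.det * B.det := by
  -- Left multiplication by a block lower triangular matrix of determinant `c ^ card ι₂` carries out
  -- the row operations.
  have h1 : Matrix.fromBlocks 1 0 (Matrix.of l) (c • 1) * G.submatrix e e =
      Matrix.fromBlocks A (Matrix.of fun s u => G (e (Sum.inl s)) (e (Sum.inr u))) 0 (d • B) := by
    ext (s | t) (s' | u)
    · simp [Matrix.mul_apply, Fintype.sum_sum_type, Matrix.one_apply, hA]
    · simp [Matrix.mul_apply, Fintype.sum_sum_type, Matrix.one_apply]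
    · simpa [Matrix.mul_apply, Fintype.sum_sum_type, Matrix.one_apply] using h0 t s'
    · simpa [Matrix.mul_apply, Fintype.sum_sum_type, Matrix.one_apply] using hB t u
  have h2 := congrArg Matrix.det h1
  rw [Matrix.det_mul, Matrix.det_fromBlocks_zero₁₂, Matrix.det_fromBlocks_zero₂₁,
    Matrix.det_submatrix_equiv_self, Matrix.det_smul, Matrix.det_smul, Matrix.det_one,
    Matrix.det_one] at h2
  linear_combination h2

/-- The coefficients of the orthogonal combination of joins. -/
noncomputable def weight (i : ℕ) : ℤ[X] := if i = 0 then X else (-1) ^ i * Q (i + 1)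

lemma weight_succ (i : ℕ) : weight (i + 1) = (-1) ^ (i + 1) * Q (i + 2) := by simp [weight]

/-- The start `weight 0 = X` forces `weight 1 = -X ^ 2`, and then `weight 2 = X ^ 3 - 2 * X` by the
fork: the initial values of `Q` up to sign. -/
lemma weight_rec_zero : weight 0 * X + weight 1 = 0 := by
  simp [weight, Q]
  ring

lemma weight_rec_one : weight 1 * X + 2 * weight 0 + weight 2 = 0 := by
  simp [weight, Q]
  ring

lemma weight_rec (j : ℕ) (hj : 2 ≤ j) : weight j * X + weight (j - 1) + weight (j + 1) = 0 := by
  obtain ⟨i, rfl⟩ := Nat.exists_eq_add_of_le' hj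
  have h1 : i + 2 - 1 = i + 1 := rfl
  rw [h1, weight_succ, weight_succ, weight_succ]
  simp only [Q]
  ring

/-- All joins except the last keep the final dot isolated, so they index rows of the first block and
may be used for elimination. -/
lemma joinAt_exists_addDot (hk : n + 1 = 2 * p + (k + 1 + 1)) (T : DecParen n p) (i : Fin (k + 1))
    (hi : i ≠ Fin.last k) (ε : Bool) (hε : ε = true → i.val = 0) :
    ∃ S : DecParen n (p + 1), S.addDot = T.addDot.joinAt hk i ε hε := by
  refine DecParen.exists_addDot _ (join_fixed_iff.2 ⟨T.addDot_last, ?_, ?_⟩)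
  · rw [← T.addDot.iso_last T.addDot_last hk]
    exact fun h => (Fin.castSucc_lt_last i).ne ((T.addDot.iso hk).injective h).symm
  · rw [← T.addDot.iso_last T.addDot_last hk]
    exact fun h => hi (Fin.succ_injective _ ((T.addDot.iso hk).injective h).symm)

lemma det_gram_split (hk : n + 1 = 2 * p + (k + 1 + 1)) (hk0 : k ≠ 0) :
    Q (k + 1) ^ Fintype.card (DecParen n p) * (gram (X : ℤ[X]) (n + 1) (p + 1)).det =
      Q (k + 2) ^ Fintype.card (DecParen n p) * (gram (X : ℤ[X]) n (p + 1)).det *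
        (gram (X : ℤ[X]) n p).det := by
  have hex : ∀ (T : DecParen n p) (i : Fin k), ∃ S : DecParen n (p + 1),
      S.addDot = T.addDot.joinAt hk i.castSucc false (by simp) := fun T i =>
    joinAt_exists_addDot hk T _ (Fin.castSucc_lt_last i).ne _ _
  have hex' : ∀ (T : DecParen n p), ∃ S : DecParen n (p + 1),
      S.addDot = T.addDot.joinAt hk ⟨0, by omega⟩ true (by simp) := fun T =>
    joinAt_exists_addDot hk T _ (fun h => hk0 (by simpa using (congrArg Fin.val h).symm)) _ _
  choose f hf using hex
  choose g hg using hex'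
  -- A sum of indicators, which gives the right coefficient without having to know that the joins
  -- are distinct.
  let l : DecParen n p → DecParen n (p + 1) → ℤ[X] := fun T S =>
    ∑ i : Fin k, (if S = f T i then weight i else 0) + if S = g T then weight 0 else 0
  have hsum : ∀ T (W : DecParen (n + 1) (p + 1)), ∑ S, l T S * phi X S.addDot W +
      weight k * phi X (T.close hk false (by simp)) W =
      ∑ i : Fin (k + 1), weight i * phi (X : ℤ[X]) (T.addDot.joinAt hk i false (by simp)) W +
      weight 0 * phi X (T.addDot.joinAt hk ⟨0, by omega⟩ true (by simp)) W := by
    intro T W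
    simp only [l, add_mul, Finset.sum_add_distrib, Finset.sum_mul, ite_mul, zero_mul]
    rw [Finset.sum_comm, Fin.sum_univ_castSucc]
    simp only [Finset.sum_ite_eq', Finset.mem_univ, if_true, hf, hg]
    simp only [Fin.val_castSucc]
    exact add_right_comm _ _ _
  have key := det_of_elimination (splitEquiv hk hk0) (gram (X : ℤ[X]) (n + 1) (p + 1))
    (gram (X : ℤ[X]) n (p + 1)) (gram (X : ℤ[X]) n p) (weight k) (- weight (k + 1)) l
    (by
      intro S S'
      rw [gram_eq_phi, gram_eq_phi]
      exact phi_addDot X S S')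
    (by
      intro T S
      rw [gram_eq_phi]
      exact (hsum T _).trans
        (sum_phi_addDot X weight weight_rec_zero weight_rec_one weight_rec hk hk0 T S))
    (by
      intro T U
      rw [gram_eq_phi, gram_eq_phi]
      exact (hsum T _).trans
        (sum_phi_close X weight weight_rec_zero weight_rec_one weight_rec hk hk0 T U))
  obtain ⟨i, rfl⟩ := Nat.exists_eq_succ_of_ne_zero hk0
  have h1 : weight (i + 1) = (-1) ^ (i + 1) * Q (i + 1 + 1) := weight_succ i
  have h2 : - weight (i + 1 + 1) = (-1) ^ (i + 1) * Q (i + 1 + 2) := by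
    rw [weight_succ]
    ring
  rw [Nat.succ_eq_add_one, h1, h2, mul_pow, mul_pow, mul_assoc, mul_assoc, mul_assoc] at key
  -- The pivots `weight k` and `- weight (k + 1)` have the same sign, which cancels.
  have h3 : ((((-1 : ℤ[X]) ^ (i + 1)) ^ Fintype.card (DecParen n p))) *
      (((-1 : ℤ[X]) ^ (i + 1)) ^ Fintype.card (DecParen n p)) = 1 := by
    rw [← mul_pow, ← mul_pow]
    simp
  have h4 := congrArg (fun a => (((-1 : ℤ[X]) ^ (i + 1)) ^ Fintype.card (DecParen n p)) * a) key
  simp only [← mul_assoc, h3, one_mul] at h4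
  exact h4

lemma det_gram_close (hk : n + 1 = 2 * p + (0 + 1 + 1)) {R : Type*} [CommRing R] (δ : R) :
    (gram δ (n + 1) (p + 1)).det =
      (δ ^ Fintype.card (DecParen n p) * (gram δ n p).det) ^ 2 := by
  rw [← Matrix.det_submatrix_equiv_self (closeEquiv hk)]
  have h1 : (gram δ (n + 1) (p + 1)).submatrix (closeEquiv hk) (closeEquiv hk) =
      Matrix.blockDiagonal fun _ : Bool => δ • gram δ n p := by
    ext ⟨T, β⟩ ⟨U, γ⟩
    rw [Matrix.blockDiagonal_apply, gram_eq_phi, gram_eq_phi]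
    refine (phi_close_close δ hk T U _ _).trans ?_
    simp only [Matrix.smul_apply, Matrix.of_apply, smul_eq_mul]
    refine if_congr ?_ rfl rfl
    have key : ∀ a : ℕ, (Even a ∧ decide (Odd a) = false) ∨ (¬ Even a ∧ decide (Odd a) = true) := by
      intro a
      rcases Nat.even_or_odd a with h | h
      · exact Or.inl ⟨h, decide_eq_false (Nat.not_odd_iff_even.2 h)⟩
      · exact Or.inr ⟨Nat.not_even_iff_odd.2 h, decide_eq_true h⟩
    rcases key T.D.card with ⟨h1, h1'⟩ | ⟨h1, h1'⟩ <;>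
      rcases key U.D.card with ⟨h2, h2'⟩ | ⟨h2, h2'⟩ <;> rw [h1', h2'] <;> cases β <;> cases γ <;>
      simp only [Bool.xor_true, Bool.xor_false, Bool.not_true, Bool.not_false, Bool.toNat_true,
        Bool.toNat_false, Nat.even_add, h1, h2] <;> decide
  rw [h1, Matrix.det_blockDiagonal]
  simp [sq]

lemma sigma_zero (S : DecParen n 0) (i : Fin n) : S.σ i = i := by
  have h := S.card_paired
  rw [mul_zero, Finset.card_eq_zero, Finset.filter_eq_empty_iff] at h
  simpa using h (Finset.mem_univ i)

lemma dec_zero (S : DecParen n 0) : S.D = ∅ := by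
  refine Finset.eq_empty_of_forall_notMem fun d hd => ?_
  exact S.dec_fst_not_fixed hd (sigma_zero S _)

instance : Unique (DecParen n 0) where
  default :=
    { σ := id
      D := ∅
      invol := fun _ => rfl
      isolated_outside := fun i j k h1 h2 _ h3 => (h1.trans h2).ne h3
      noncrossing := fun i j k l h1 h2 _ h3 => (h1.trans h2).ne h3.1
      card_paired := by simp
      dec_pair := by simp
      dec_isolated := by simp
      dec_outer := by simp }
  uniq S := DecParen.ext (funext (sigma_zero S)) (dec_zero S)

lemma det_gram_zero {R : Type*} [CommRing R] (δ : R) (n : ℕ) : (gram δ n 0).det = 1 := by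
  rw [Matrix.det_unique, gram_eq_phi, Matrix.of_apply]
  set S : DecParen n 0 := default
  have h1 : loops S S = ∅ := by
    refine Finset.eq_empty_of_forall_notMem fun C hC => ?_
    obtain ⟨i, rfl, h⟩ := mem_loops.1 hC
    exact (h i (mem_strand.2 (Linked.refl i))).1 (sigma_zero S i)
  have h2 : Admissible S S := by
    refine ⟨fun b b' _ _ h => ?_, by simp [h1]⟩
    exact h.map_eq (f := id) (sigma_zero S) (sigma_zero S)
  rw [phi_of_admissible δ h2, h1, Finset.card_empty, pow_zero]

/-- The same two decompositions count diagrams: Pascal's rule, and at `n + 1 = 2 * p + 2` the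
doubling of a central binomial coefficient. -/
lemma card_decParen (n p : ℕ) (h : 2 * p ≤ n) : Fintype.card (DecParen n p) = n.choose p := by
  induction n generalizing p with
  | zero =>
    obtain rfl : p = 0 := by omega
    simp
  | succ n ih =>
    cases p with
    | zero => simp
    | succ p =>
      by_cases h1 : n + 1 = 2 * p + (0 + 1 + 1)
      · rw [← Fintype.card_congr (closeEquiv h1), Fintype.card_prod, ih p (by omega),
          Fintype.card_bool, Nat.choose_succ_succ]
        obtain rfl : n = 2 * p + 1 := by omega
        rw [Nat.choose_symm_half]
        ring
      · obtain ⟨k, hk⟩ := Nat.exists_eq_add_of_le (show 2 * p + 2 ≤ n + 1 by omega)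
        have hk' : n + 1 = 2 * p + (k + 1 + 1) := by omega
        have hk0 : k ≠ 0 := by rintro rfl; omega
        rw [← Fintype.card_congr (splitEquiv hk' hk0), Fintype.card_sum, ih p (by omega),
          ih (p + 1) (by omega), Nat.choose_succ_succ, add_comm]

end TLD

/-! ### The closed product satisfies the recursions -/

namespace TLD

open Polynomial

section Product

variable {K : Type*} [Field K] (q : ℕ → K)

lemma prod_pow_choose_succ (f : ℕ → K) (n p : ℕ) :
    ∏ r ∈ Finset.range (p + 1), f r ^ (n + 1).choose r =
      (∏ r ∈ Finset.range (p + 1), f r ^ n.choose r) *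
        ∏ r ∈ Finset.range p, f (r + 1) ^ n.choose r := by
  rw [Finset.prod_range_succ', Finset.prod_range_succ' (fun r => f r ^ n.choose r)]
  simp only [Nat.choose_succ_succ, Nat.succ_eq_add_one, pow_add, Finset.prod_mul_distrib,
    Nat.choose_zero_right, pow_one]
  ring

/-- The first factor of the product formula. -/
def mainProduct (n p : ℕ) : K :=
  ∏ r ∈ Finset.range p, (q (n - p - r + 1) / q (p - r)) ^ n.choose r

/-- The second factor of the product formula. -/
def restProduct (n p : ℕ) : K :=
  ∏ j ∈ Finset.range (p - 1), mainProduct q (2 * j + 3) (j + 1) ^ (n - 2 * j - 4).choose (p - j - 2)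

/-- Substituting `j = p - s - 1` identifies each inner product as the main product of `(2 * j + 3, j
+ 1)`. -/
lemma gramProduct_eq (n p : ℕ) : gramProduct q n p = mainProduct q n p * restProduct q n p := by
  unfold gramProduct restProduct
  congr 1
  rw [← Finset.prod_range_reflect, ← Finset.Ico_add_one_right_eq_Icc,
    Finset.prod_Ico_eq_prod_range]
  refine Finset.prod_congr (by simp) fun j hj => ?_
  have hj' : j < p - 1 := by simpa using hj
  have h1 : p - 1 - 1 - j + 1 = p - (1 + j) := by omega
  have h2 : 2 * (p - 1 - 1 - j) + 3 = 2 * (p - (1 + j)) + 1 := by omega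
  have h3 : n - 2 * (p - 1 - 1 - j) - 4 = n - 2 * (p - (1 + j) + 1) := by omega
  have h4 : p - (p - 1 - 1 - j) - 2 = 1 + j - 1 := by omega
  rw [h1, h2, h3, h4]
  congr 1
  refine Finset.prod_congr rfl fun r hr => ?_
  have hr' : r < p - (1 + j) := by simpa using hr
  have h5 : 2 * (p - (1 + j)) + 1 - (p - (1 + j)) - r + 1 = p - (1 + j) - r + 2 := by omega
  rw [h5]

variable {q}

/-- After Pascal's rule both sides have the same numerators and denominators, paired differently,
for `r < p`. Only the boundary term `r = p` leaves a quotient. -/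
lemma mainProduct_split (hq : ∀ k, 1 ≤ k → q k ≠ 0) {n p : ℕ} (h : 2 * p + 2 ≤ n) :
    mainProduct q (n + 1) (p + 1) = mainProduct q n (p + 1) * mainProduct q n p *
      (q (n - 2 * p + 1) / q (n - 2 * p)) ^ n.choose p := by
  unfold mainProduct
  rw [prod_pow_choose_succ (fun r => q (n + 1 - (p + 1) - r + 1) / q (p + 1 - r)),
    Finset.prod_range_succ, Finset.prod_range_succ]
  have h1 : n + 1 - (p + 1) - p + 1 = n - 2 * p + 1 := by omega
  have h2 : n - (p + 1) - p + 1 = n - 2 * p := by omega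
  have h3 : (∏ r ∈ Finset.range p, (q (n + 1 - (p + 1) - r + 1) / q (p + 1 - r)) ^ n.choose r) *
      ∏ r ∈ Finset.range p,
        (q (n + 1 - (p + 1) - (r + 1) + 1) / q (p + 1 - (r + 1))) ^ n.choose r =
      (∏ r ∈ Finset.range p, (q (n - (p + 1) - r + 1) / q (p + 1 - r)) ^ n.choose r) *
        ∏ r ∈ Finset.range p, (q (n - p - r + 1) / q (p - r)) ^ n.choose r := by
    rw [← Finset.prod_mul_distrib, ← Finset.prod_mul_distrib]
    refine Finset.prod_congr rfl fun r hr => ?_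
    have hr' : r < p := by simpa using hr
    have h4 : n + 1 - (p + 1) - (r + 1) + 1 = n - (p + 1) - r + 1 := by omega
    have h5 : n + 1 - (p + 1) - r + 1 = n - p - r + 1 := by omega
    have h6 : p + 1 - (r + 1) = p - r := by omega
    rw [h4, h5, h6, ← mul_pow, ← mul_pow]
    congr 1
    rw [div_mul_div_comm, div_mul_div_comm, mul_comm (q (n - p - r + 1))]
  rw [h1, h2]
  have h7 : (q (n - 2 * p + 1) / q (p + 1 - p)) ^ n.choose p =
      (q (n - 2 * p) / q (p + 1 - p)) ^ n.choose p *
        (q (n - 2 * p + 1) / q (n - 2 * p)) ^ n.choose p := by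
    rw [← mul_pow]
    congr 1
    have := hq (n - 2 * p) (by omega)
    have := hq (p + 1 - p) (by omega)
    field_simp
  rw [h7]
  linear_combination (q (n - 2 * p) / q (p + 1 - p)) ^ n.choose p *
        (q (n - 2 * p + 1) / q (n - 2 * p)) ^ n.choose p * h3

/-- After Pascal's rule the shifted numerators `q (p + 1 - r)` cancel the denominators. -/
lemma mainProduct_close (hq : ∀ k, 1 ≤ k → q k ≠ 0) (p : ℕ) :
    mainProduct q (2 * p + 2) (p + 1) =
      (q 2 / q 1) ^ (2 * p + 1).choose p * mainProduct q (2 * p + 1) p := by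
  unfold mainProduct
  rw [prod_pow_choose_succ (fun r => q (2 * p + 2 - (p + 1) - r + 1) / q (p + 1 - r)),
    Finset.prod_range_succ]
  have h1 : 2 * p + 2 - (p + 1) - p + 1 = 2 := by omega
  have h2 : p + 1 - p = 1 := by omega
  have h3 : (∏ r ∈ Finset.range p,
      (q (2 * p + 2 - (p + 1) - r + 1) / q (p + 1 - r)) ^ (2 * p + 1).choose r) *
      ∏ r ∈ Finset.range p,
        (q (2 * p + 2 - (p + 1) - (r + 1) + 1) / q (p + 1 - (r + 1))) ^ (2 * p + 1).choose r =
      ∏ r ∈ Finset.range p, (q (2 * p + 1 - p - r + 1) / q (p - r)) ^ (2 * p + 1).choose r := by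
    rw [← Finset.prod_mul_distrib]
    refine Finset.prod_congr rfl fun r hr => ?_
    have hr' : r < p := by simpa using hr
    have h4 : 2 * p + 2 - (p + 1) - (r + 1) + 1 = p + 1 - r := by omega
    have h5 : 2 * p + 2 - (p + 1) - r + 1 = 2 * p + 1 - p - r + 1 := by omega
    have h6 : p + 1 - (r + 1) = p - r := by omega
    rw [h4, h5, h6, ← mul_pow]
    congr 1
    exact div_mul_div_cancel₀ (hq _ (by omega))
  rw [h1, h2, ← h3]
  ring

lemma restProduct_split {n p : ℕ} (h : 2 * p + 2 ≤ n) :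
    restProduct q (n + 1) (p + 1) = restProduct q n (p + 1) * restProduct q n p := by
  unfold restProduct
  cases p with
  | zero => simp
  | succ p =>
    simp only [Nat.add_sub_cancel]
    rw [Finset.prod_range_succ, Finset.prod_range_succ]
    have h1 : p + 1 + 1 - p - 2 = 0 := by omega
    rw [h1, Nat.choose_zero_right, Nat.choose_zero_right, mul_right_comm,
      ← Finset.prod_mul_distrib]
    congr 1
    refine Finset.prod_congr rfl fun j hj => ?_
    have hj' : j < p := by simpa using hj
    rw [← pow_add]
    congr 1
    obtain ⟨m, hm⟩ := Nat.exists_eq_add_of_le (show 2 * j + 4 ≤ n by omega)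
    have h2 : n + 1 - 2 * j - 4 = m + 1 := by omega
    have h3 : n - 2 * j - 4 = m := by omega
    have h4 : p + 1 + 1 - j - 2 = (p + 1 - j - 2) + 1 := by omega
    rw [h2, h3, h4, Nat.choose_succ_succ, add_comm]

/-- The square in the recursion needs a second copy of `mainProduct q (2 * p + 1) p`: it is the
factor `j = p - 1`, which is new. The other exponents double, as C(2m+2, m+1) = 2 C(2m+1, m). -/
lemma restProduct_close (p : ℕ) :
    restProduct q (2 * p + 2) (p + 1) =
      mainProduct q (2 * p + 1) p * restProduct q (2 * p + 1) p ^ 2 := by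
  unfold restProduct
  cases p with
  | zero => simp [mainProduct]
  | succ p =>
    simp only [Nat.add_sub_cancel]
    rw [Finset.prod_range_succ]
    have h1 : p + 1 + 1 - p - 2 = 0 := by omega
    rw [h1, Nat.choose_zero_right, pow_one, mul_comm, ← Finset.prod_pow]
    congr 1
    refine Finset.prod_congr rfl fun j hj => ?_
    have hj' : j < p := by simpa using hj
    rw [← pow_mul]
    congr 1
    obtain ⟨m, hm⟩ := Nat.exists_eq_add_of_le (show j + 1 ≤ p by omega)
    have h2 : 2 * (p + 1) + 2 - 2 * j - 4 = 2 * m + 1 + 1 := by omega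
    have h3 : 2 * (p + 1) + 1 - 2 * j - 4 = 2 * m + 1 := by omega
    have h4 : p + 1 + 1 - j - 2 = m + 1 := by omega
    have h5 : p + 1 - j - 2 = m := by omega
    rw [h2, h3, h4, h5, Nat.choose_succ_succ, Nat.choose_symm_half]
    ring

lemma gramProduct_split (hq : ∀ k, 1 ≤ k → q k ≠ 0) {n p : ℕ} (h : 2 * p + 2 ≤ n) :
    gramProduct q (n + 1) (p + 1) = gramProduct q n (p + 1) * gramProduct q n p *
      (q (n - 2 * p + 1) / q (n - 2 * p)) ^ n.choose p := by
  simp only [gramProduct_eq]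
  rw [mainProduct_split hq h, restProduct_split h]
  ring

lemma gramProduct_close (hq : ∀ k, 1 ≤ k → q k ≠ 0) (p : ℕ) :
    gramProduct q (2 * p + 2) (p + 1) =
      ((q 2 / q 1) ^ (2 * p + 1).choose p * gramProduct q (2 * p + 1) p ^ 2) := by
  simp only [gramProduct_eq]
  rw [mainProduct_close hq, restProduct_close]
  ring

end Product

/-! ### The generic determinant and its specializations -/

lemma eval_Q (k : ℕ) : (Q (k + 2)).eval 2 = 4 := by
  induction k using Nat.strong_induction_on with
  | _ k ih =>
    match k with
    | 0 => norm_num [Q]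
    | 1 => norm_num [Q]
    | k + 2 =>
      have h1 := ih k (by omega)
      have h2 := ih (k + 1) (by omega)
      -- At 2 the recursion has the constant solution 4, since 2 · 4 - 4 = 4.
      have h3 : Q (k + 2 + 2) = X * Q (k + 1 + 2) - Q (k + 2) := rfl
      rw [h3, eval_sub, eval_mul, eval_X, h1, h2]
      norm_num

lemma Q_ne_zero (k : ℕ) (hk : 1 ≤ k) : Q k ≠ 0 := by
  intro h
  match k with
  | 1 => simp [Q] at h
  | k + 2 => simpa [h] using eval_Q k

lemma algebraMap_det_gram (n p : ℕ) (hnp : 2 * p ≤ n) :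
    algebraMap ℤ[X] (FractionRing ℤ[X]) (gram (X : ℤ[X]) n p).det =
      gramProduct (fun k => algebraMap ℤ[X] (FractionRing ℤ[X]) (Q k)) n p := by
  set φ := algebraMap ℤ[X] (FractionRing ℤ[X])
  have hq : ∀ k, 1 ≤ k → φ (Q k) ≠ 0 := fun k hk =>
    (map_ne_zero_iff φ (IsFractionRing.injective ℤ[X] (FractionRing ℤ[X]))).2 (Q_ne_zero k hk)
  induction n generalizing p with
  | zero =>
    obtain rfl : p = 0 := by omega
    rw [det_gram_zero, map_one]
    simp [gramProduct]
  | succ n ih =>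
    cases p with
    | zero =>
      rw [det_gram_zero, map_one]
      simp [gramProduct]
    | succ p =>
      have h2 := ih p (by omega)
      by_cases h : n + 1 = 2 * p + (0 + 1 + 1)
      · rw [det_gram_close h, map_pow, map_mul, map_pow, h2, card_decParen n p (by omega)]
        obtain rfl : n = 2 * p + 1 := by omega
        have h3 : φ (Q 2) = φ X ^ 2 := by simp [Q]
        have h4 : φ (Q 1) = 1 := by simp [Q]
        rw [gramProduct_close hq, h3, h4]
        ring
      · obtain ⟨k, hk⟩ := Nat.exists_eq_add_of_le (show 2 * p + 2 ≤ n + 1 by omega)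
        have hk' : n + 1 = 2 * p + (k + 1 + 1) := by omega
        have hk0 : k ≠ 0 := by rintro rfl; omega
        have h1 := ih (p + 1) (by omega)
        have h3 := congrArg φ (det_gram_split hk' hk0)
        simp only [map_mul, map_pow] at h3
        rw [h1, h2, card_decParen n p (by omega)] at h3
        rw [gramProduct_split hq (by omega)]
        have h4 : n - 2 * p = k + 1 := by omega
        rw [h4, div_pow]
        have h5 := pow_ne_zero (n.choose p) (hq (k + 1) (by omega))
        have h6 : k + 1 + 1 = k + 2 := rfl
        rw [h6, mul_div_assoc', eq_div_iff h5]
        linear_combination h3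

lemma phi_map {R R' : Type*} [CommRing R] [CommRing R'] (f : R →+* R') (δ : R) {n p q : ℕ}
    (S : DecParen n p) (T : DecParen n q) : f (phi δ S T) = phi (f δ) S T := by
  unfold phi
  split_ifs <;> simp

/-- Each entry is 0 or a power of the parameter, so every Gram matrix is the image of the generic
one over ℤ[X]. -/
lemma det_gram_eq_aeval {R : Type*} [CommRing R] (δ : R) (n p : ℕ) :
    (gram δ n p).det = aeval δ (gram (X : ℤ[X]) n p).det := by
  rw [AlgHom.map_det]
  congr 1
  ext S T
  rw [gram_eq_phi, gram_eq_phi]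
  have h1 := phi_map ((aeval δ : ℤ[X] →ₐ[ℤ] R) : ℤ[X] →+* R) X S T
  simpa using h1.symm

/-- The numerator of the product formula if `q` is `fun n p r => Q (n - p - r + 1)`, and its
denominator if `q` is `fun _ p r => Q (p - r)`. -/
noncomputable def productOf (q : ℕ → ℕ → ℕ → ℤ[X]) (n p : ℕ) : ℤ[X] :=
  (∏ r ∈ Finset.range p, q n p r ^ n.choose r) *
    ∏ s ∈ Finset.Icc 1 (p - 1),
      (∏ r ∈ Finset.range (p - s), q (2 * (p - s) + 1) (p - s) r ^ (2 * (p - s) + 1).choose r) ^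
          (n - 2 * (p - s + 1)).choose (s - 1)

lemma gramProduct_eq_div {K : Type*} [Field K] (f : ℤ[X] →+* K) (n p : ℕ) :
    gramProduct (fun k => f (Q k)) n p =
      f (productOf (fun n p r => Q (n - p - r + 1)) n p) /
        f (productOf (fun _ p r => Q (p - r)) n p) := by
  simp only [gramProduct, productOf, map_mul, map_prod, map_pow, div_pow, Finset.prod_div_distrib]
  rw [div_mul_div_comm]
  congr 2
  refine Finset.prod_congr rfl fun s _ => ?_
  congr 1
  refine Finset.prod_congr rfl fun r hr => ?_
  have hr' : r < p - s := by simpa using hr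
  have h1 : p - s - r + 2 = 2 * (p - s) + 1 - (p - s) - r + 1 := by omega
  rw [h1]

lemma map_denominator_ne_zero {K : Type*} [Field K] (f : ℤ[X] →+* K) (n p : ℕ)
    (h : ∀ k, 1 ≤ k → k ≤ p → f (Q k) ≠ 0) :
    f (productOf (fun _ p r => Q (p - r)) n p) ≠ 0 := by
  simp only [productOf, map_mul, map_prod, map_pow]
  refine mul_ne_zero (Finset.prod_ne_zero_iff.2 fun r hr => pow_ne_zero _ ?_)
    (Finset.prod_ne_zero_iff.2 fun s hs => pow_ne_zero _ (Finset.prod_ne_zero_iff.2 fun r hr =>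
      pow_ne_zero _ ?_))
  · have hr' : r < p := by simpa using hr
    exact h _ (by omega) (by omega)
  · have hr' : r < p - s := by simpa using hr
    exact h _ (by omega) (by omega)

end TLD

theorem proposition6p16 (n p : ℕ) (hnp : 2 * p ≤ n) :
    -- `det G(n, p)` is, over every ring, the value at `δ` of one polynomial with integer
    -- coefficients, which is the closed product in the field of rational functions;
    (∃ F : Polynomial ℤ,
      algebraMap (Polynomial ℤ) (FractionRing (Polynomial ℤ)) F =
        TLD.gramProduct
          (fun k => algebraMap (Polynomial ℤ) (FractionRing (Polynomial ℤ)) (TLD.Q k)) n p ∧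
      ∀ (R : Type*) [CommRing R] (δ : R),
        (TLD.gram δ n p).det = Polynomial.aeval δ F) ∧
    -- over a field the formula holds for every value `δ` at which no denominator vanishes.
    (∀ (K : Type*) [Field K] (δ : K),
      (∀ k, 1 ≤ k → k ≤ p → Polynomial.aeval δ (TLD.Q k) ≠ 0) →
      (TLD.gram δ n p).det =
        TLD.gramProduct (fun k => Polynomial.aeval δ (TLD.Q k)) n p) := by
  refine ⟨⟨_, TLD.algebraMap_det_gram n p hnp, fun R _ δ => TLD.det_gram_eq_aeval δ n p⟩,
    fun K _ δ h => ?_⟩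
  have h1 := TLD.algebraMap_det_gram n p hnp
  have hinj := IsFractionRing.injective (Polynomial ℤ) (FractionRing (Polynomial ℤ))
  -- Clearing denominators turns the generic formula into an identity in ℤ[X], which survives
  -- evaluation at `δ`; the division is redone in `K`, where only the denominators must not vanish.
  rw [TLD.gramProduct_eq_div, eq_div_iff (TLD.map_denominator_ne_zero _ n p fun k hk _ =>
    (map_ne_zero_iff _ hinj).2 (TLD.Q_ne_zero k hk)), ← map_mul] at h1
  have h2 := congrArg (Polynomial.aeval δ) (hinj h1)
  rw [map_mul] at h2
  rw [TLD.det_gram_eq_aeval]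
  refine Eq.trans ?_ (TLD.gramProduct_eq_div ((Polynomial.aeval δ : Polynomial ℤ →ₐ[ℤ] K) :
    Polynomial ℤ →+* K) n p).symm
  exact (eq_div_iff (TLD.map_denominator_ne_zero _ n p h)).2 h2
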